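/- Let $(W,S)$ be a Coxeter system with $S$ finite, with length function $\ell$, and let $m\ge 0$ be an integer. Let $V$ be the real vector space with basis $\{\alpha_s : s\in S\}$ and symmetric bilinear form $\langle\alpha_s,\alpha_t\rangle=-\cos(\pi/m(s,t))$ (equal to $-1$ if $m(s,t)=\infty$), on which $W$ acts by $s v=v-2\langle v,\alpha_s\rangle\alpha_s$. Let $\Phi=\{w\alpha_s : w\in W, s\in S\}$, and let $\Phi^+$ be the set of roots with nonnegative coefficients in the basis of simple roots; a root is negative ($<0$) if all its coefficients are nonpositive. For $\beta=u\alpha_s\in\Phi$ let $s_\beta=usu^{-1}$. For $w\in W$ let $$\Phi(w)=\{\beta\in\Phi^+ : w^{-1}\beta<0\},\qquad \Phi^1(w)=\{\beta\in\Phi(w) : \ell(s_\beta w)=\ell(w)-1\},\qquad \Phi^R(w)=\{-w\alpha_s : s\in S,\ \ell(ws)<\ell(w)\}.$$ A root $\beta\in\Phi^+$ dominates $\alpha\in\Phi^+$ if for all $w\in W$, $w^{-1}\beta<0$ implies $w^{-1}\alpha<0$. Let $\mathscr E_m$ be the set of $\beta\in\Phi^+$ that dominate at most $m$ positive roots other than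 $\beta$ itself. The set of $m$-low elements is $L_m=\{w\in W : \Phi^1(w)\subseteq\mathscr E_m\}$. The $m$-Shi partition $\mathscr S_m$ is the partition of $W$ in which $x,y$ lie in the same part if and only if $\Phi(x)\cap\mathscr E_m=\Phi(y)\cap\mathscr E_m$. Order $W$ by the right weak order: $x\preceq y$ if and only if $\ell(y)=\ell(x)+\ell(x^{-1}y)$. The gate of a subset $X\subseteq W$, if it exists, is the element $g\in X$ with $g\preceq x$ for all $x\in X$. An element $x$ of a poset $P$ is join-irreducible if it is not the minimal element of $P$ and, for all $a,b\in P$ whose join in $P$ exists, $x=a\vee b$ implies $x=a$ or $x=b$. **Theorem 1.7.** Every part of the $m$-Shi partition $\mathscr S_m$ has a gate, the set of these gates is $L_m$, and the set of tight gates $$L_m^0=\{g\in L_m : |\Phi^R(g)|=1\}$$ is exactly the set of join-irreducible elements of the partially ordered set $(L_m,\preceq)$. -/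

import Mathlib

/-- An element of a poset is join-irreducible if it is not the minimal element and whenever it is
the join (least upper bound) of two elements of the poset, it is one of them. -/
def IsJoinIrreducible {P : Type*} [PartialOrder P] (x : P) : Prop :=
  ¬ IsMin x ∧ ∀ a b : P, IsLUB {a, b} x → x = a ∨ x = b

namespace CoxeterMatrix

variable {B : Type*} (M : CoxeterMatrix B)

/-- The symmetric bilinear form on the real vector space with basis `(α_i)`, `i ∈ B`, given by
`⟨α_i, α_j⟩ = -cos (π / m(i,j))`. Mathlib encodes `m(i,j) = ∞` as `0`, and `-cos (π / 0) = -1` is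
the right value in that case. -/
noncomputable def geomForm : (B →₀ ℝ) →ₗ[ℝ] (B →₀ ℝ) →ₗ[ℝ] ℝ :=
  Finsupp.linearCombination ℝ fun i =>
    Finsupp.linearCombination ℝ fun j => -Real.cos (Real.pi / (M i j : ℝ))

/-- The simple root `α_i`. -/
noncomputable def simpleRoot (_ : CoxeterMatrix B) (i : B) : B →₀ ℝ := Finsupp.single i 1

theorem geomForm_simpleRoot (i j : B) :
    M.geomForm (M.simpleRoot i) (M.simpleRoot j) = -Real.cos (Real.pi / (M i j : ℝ)) := by
  simp [geomForm, simpleRoot]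

theorem two_geomForm_self (i : B) :
    ((2 : ℝ) • M.geomForm (M.simpleRoot i)) (M.simpleRoot i) = 2 := by
  simp [geomForm_simpleRoot]

/-- The simple reflection `v ↦ v - 2 ⟨α_i, v⟩ α_i`. -/
noncomputable def simpleReflection (i : B) : (B →₀ ℝ) ≃ₗ[ℝ] (B →₀ ℝ) :=
  Module.reflection (M.two_geomForm_self i)

theorem simpleReflection_apply (i : B) (v : B →₀ ℝ) :
    M.simpleReflection i v = v - (2 * M.geomForm (M.simpleRoot i) v) • M.simpleRoot i := by
  simp [simpleReflection, Module.reflection_apply]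

theorem chebyshevS_mul_sin (θ : ℝ) (n : ℤ) :
    (Polynomial.Chebyshev.S ℝ n).eval (2 * Real.cos θ) * Real.sin θ = Real.sin ((n + 1) * θ) := by
  rw [← Polynomial.Chebyshev.U_real_cos, ← Polynomial.Chebyshev.S_comp_two_mul_X]
  simp

theorem simpleReflection_isLiftable : M.IsLiftable M.simpleReflection := by
  intro i j
  rcases eq_or_ne i j with rfl | hij
  · rw [M.diagonal, pow_one]
    ext1 v
    exact Module.involutive_reflection (M.two_geomForm_self i) v
  have hM : M j i = M i j := (M.symmetric i j).symm
  rcases Nat.eq_zero_or_pos (M i j) with h0 | hpos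
  · rw [h0, pow_zero]
  have h1 : M i j ≠ 1 := M.off_diagonal i j hij
  ext1 v
  simp only [simpleReflection]
  rw [Module.reflection_mul_reflection_pow_apply _ _ _ v
    (2 * Real.cos (2 * Real.pi / (M i j : ℝ))) (by
      simp only [LinearMap.smul_apply, geomForm_simpleRoot, hM, smul_eq_mul]
      rw [mul_div_assoc, Real.cos_two_mul]
      ring)]
  rcases Nat.lt_or_ge 2 (M i j) with h2 | h2
  swap
  · obtain h2 : M i j = 2 := by omega
    have e1 : M.geomForm (M.simpleRoot i) (M.simpleRoot j) = 0 := by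
      simp [geomForm_simpleRoot, h2]
    have e2 : M.geomForm (M.simpleRoot j) (M.simpleRoot i) = 0 := by
      simp [geomForm_simpleRoot, hM, h2]
    have e3 : Real.cos (2 * Real.pi / 2) = -1 := by simp
    simp only [h2, LinearMap.smul_apply, e1, e2]
    norm_num
    module
  set n : ℕ := M i j with hn
  have hnpos : (0 : ℝ) < n := by exact_mod_cast hpos
  have hn2 : (2 : ℝ) < n := by exact_mod_cast h2
  set θ : ℝ := 2 * Real.pi / n with hθ
  have hnθ : n * θ = 2 * Real.pi := by rw [hθ]; field_simp
  have hsin : Real.sin θ ≠ 0 := by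
    apply ne_of_gt
    apply Real.sin_pos_of_pos_of_lt_pi
    · positivity
    · rw [hθ, div_lt_iff₀ hnpos]
      nlinarith [Real.pi_pos]
  have hS := chebyshevS_mul_sin θ
  rcases Nat.even_or_odd' n with ⟨k, hk | hk⟩
  · have hkθ : k * θ = Real.pi := by
      have : (n : ℝ) = 2 * k := by exact_mod_cast hk
      rw [this] at hnθ
      linarith
    have hz : (Polynomial.Chebyshev.S ℝ ((k : ℤ) - 1)).eval (2 * Real.cos θ) = 0 := by
      have := hS (k - 1)
      push_cast at this
      rw [sub_add_cancel, hkθ, Real.sin_pi] at this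
      exact (mul_eq_zero.mp this).resolve_right hsin
    have a1 : ((n : ℤ) - 2) / 2 = k - 1 := by omega
    have a2 : ((n : ℤ) - 1) / 2 = k - 1 := by omega
    rw [a1, a2, hz]
    simp
  · have hkθ : (2 * k + 1) * θ = 2 * Real.pi := by
      have : (n : ℝ) = 2 * k + 1 := by exact_mod_cast hk
      rwa [this] at hnθ
    have hz : (Polynomial.Chebyshev.S ℝ (k : ℤ)).eval (2 * Real.cos θ) +
        (Polynomial.Chebyshev.S ℝ ((k : ℤ) - 1)).eval (2 * Real.cos θ) = 0 := by
      have b1 := hS k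
      have b2 := hS (k - 1)
      push_cast at b1 b2
      rw [sub_add_cancel] at b2
      have b3 : ((k : ℝ) + 1) * θ = 2 * Real.pi - k * θ := by linarith
      rw [b3, Real.sin_two_pi_sub] at b1
      have : ((Polynomial.Chebyshev.S ℝ (k : ℤ)).eval (2 * Real.cos θ) +
        (Polynomial.Chebyshev.S ℝ ((k : ℤ) - 1)).eval (2 * Real.cos θ)) * Real.sin θ = 0 := by
        rw [add_mul, b1, b2]
        ring
      exact (mul_eq_zero.mp this).resolve_right hsin
    have a1 : ((n : ℤ) - 2) / 2 = k - 1 := by omega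
    have a2 : ((n : ℤ) - 1) / 2 = k := by omega
    have a3 : ((n : ℤ) - 3) / 2 = k - 1 := by omega
    have a4 : (n : ℤ) / 2 = k := by omega
    rw [a1, a2, a3, a4, hz]
    simp

end CoxeterMatrix

namespace CoxeterSystem

variable {B W : Type*} [Group W] {M : CoxeterMatrix B} (cs : CoxeterSystem M W)

/-- The geometric representation of `W`: the simple reflection `s_i` acts by
`v ↦ v - 2 ⟨α_i, v⟩ α_i`. -/
noncomputable def geomRep : W →* ((B →₀ ℝ) ≃ₗ[ℝ] (B →₀ ℝ)) :=
  cs.lift ⟨M.simpleReflection, M.simpleReflection_isLiftable⟩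

theorem geomRep_simple (i : B) : cs.geomRep (cs.simple i) = M.simpleReflection i :=
  cs.lift_apply_simple M.simpleReflection_isLiftable i

/-- The root system `Φ = {w α_i | w ∈ W, i ∈ B}`. -/
def roots : Set (B →₀ ℝ) := {β | ∃ (w : W) (i : B), β = cs.geomRep w (M.simpleRoot i)}

/-- `β > 0`: a root all of whose coordinates in the basis of simple roots are nonnegative. -/
def IsPositiveRoot (β : B →₀ ℝ) : Prop := β ∈ cs.roots ∧ ∀ i, 0 ≤ β i

/-- `β < 0`: a root all of whose coordinates in the basis of simple roots are nonpositive. -/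
def IsNegativeRoot (β : B →₀ ℝ) : Prop := β ∈ cs.roots ∧ ∀ i, β i ≤ 0

/-- `t` is the reflection `s_β` of the root `β`, i.e. `t = u s_i u⁻¹` where `β = u α_i`. -/
def IsReflectionOf (t : W) (β : B →₀ ℝ) : Prop :=
  ∃ (u : W) (i : B), β = cs.geomRep u (M.simpleRoot i) ∧ t = u * cs.simple i * u⁻¹

/-- The (left) inversion set `Φ(w) = {β ∈ Φ⁺ | w⁻¹ β < 0}`. -/
def inversionSet (w : W) : Set (B →₀ ℝ) :=
  {β | cs.IsPositiveRoot β ∧ cs.IsNegativeRoot (cs.geomRep w⁻¹ β)}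

/-- The short inversions `Φ¹(w) = {β ∈ Φ(w) | ℓ(s_β w) = ℓ(w) - 1}`. -/
def shortInversions (w : W) : Set (B →₀ ℝ) :=
  {β | β ∈ cs.inversionSet w ∧ ∃ t, cs.IsReflectionOf t β ∧ cs.length (t * w) + 1 = cs.length w}

/-- The right-descent roots `Φᴿ(w) = {-w α_s | s ∈ D_R(w)}`. -/
def rightDescentRoots (w : W) : Set (B →₀ ℝ) :=
  {β | ∃ i : B, cs.IsRightDescent w i ∧ β = -cs.geomRep w (M.simpleRoot i)}

/-- The root `β` dominates the root `α`: whenever `w⁻¹ β < 0`, also `w⁻¹ α < 0`. -/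
def Dominates (β α : B →₀ ℝ) : Prop :=
  ∀ w : W, cs.IsNegativeRoot (cs.geomRep w⁻¹ β) → cs.IsNegativeRoot (cs.geomRep w⁻¹ α)

/-- The `m`-elementary roots: positive roots dominating at most `m` positive roots other than
themselves. -/
def elementaryRoots (m : ℕ) : Set (B →₀ ℝ) :=
  {β | cs.IsPositiveRoot β ∧
    {α | cs.IsPositiveRoot α ∧ α ≠ β ∧ cs.Dominates β α}.encard ≤ (m : ℕ∞)}

/-- The `m`-elementary inversion set `ℰ_m(w) = Φ(w) ∩ ℰ_m`. -/
def elementaryInversionSet (m : ℕ) (w : W) : Set (B →₀ ℝ) :=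
  cs.inversionSet w ∩ cs.elementaryRoots m

/-- The set `L_m` of `m`-low elements: those `w` with `Φ¹(w) ⊆ ℰ_m`. -/
def lowElements (m : ℕ) : Set W := {w | cs.shortInversions w ⊆ cs.elementaryRoots m}

/-- The right weak order: `x ⪯ y` iff `ℓ(y) = ℓ(x) + ℓ(x⁻¹ y)`. -/
@[reducible]
def rightWeakOrder : PartialOrder W where
  le x y := cs.length y = cs.length x + cs.length (x⁻¹ * y)
  le_refl x := by simp
  le_trans x y z hxy hyz := by
    have h1 := cs.length_mul_le (x⁻¹ * y) (y⁻¹ * z)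
    have h2 := cs.length_mul_le x (x⁻¹ * z)
    simp only [mul_assoc, mul_inv_cancel_left] at h1 h2
    omega
  le_antisymm x y hxy hyx := by
    have h : cs.length (x⁻¹ * y) = 0 := by omega
    rw [cs.length_eq_zero_iff] at h
    exact inv_mul_eq_one.mp h

/-- The join-irreducible elements of the poset `(P, ⪯)`, for a subset `P` of `W` with the right
weak order. Joins are taken in the poset `P`. -/
def joinIrreducibles (P : Set W) : Set W :=
  letI := cs.rightWeakOrder
  {g | ∃ h : g ∈ P, IsJoinIrreducible (⟨g, h⟩ : P)}

/-- The `m`-Shi partition: `x` and `y` are in the same part iff `ℰ_m(x) = ℰ_m(y)`. -/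
def shiPartition (m : ℕ) : Setoid W := Setoid.ker (cs.elementaryInversionSet m)

/-- `g` is the gate of a subset `X` of `W`: it lies in `X` and is a prefix of all elements of `X`.
(Such an element is unique, and it is the unique element of minimal length of `X`.) -/
def IsGate (X : Set W) (g : W) : Prop :=
  letI := cs.rightWeakOrder
  IsLeast X g

/-- The partition of `W` into the classes of `r` is gated: each part has a gate. -/
def IsGated (r : Setoid W) : Prop := ∀ X ∈ r.classes, ∃ g, cs.IsGate X g

/-- The set of gates of the parts of a partition of `W`. -/
def gates (r : Setoid W) : Set W := {g | ∃ X ∈ r.classes, cs.IsGate X g}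

/-- The tight elements `X⁰ = {x ∈ X | |Φᴿ(x)| = 1}` of a set `X` of elements of `W`. If `X` is the
set of gates of a gated partition, these are the tight gates of the partition. -/
def tight (X : Set W) : Set W := {x | x ∈ X ∧ (cs.rightDescentRoots x).encard = 1}

end CoxeterSystem

/-! ### The geometric form and reflections in unit vectors. -/

namespace CoxeterMatrix

variable {B : Type*} (M : CoxeterMatrix B)

/-! The weak order is inclusion of inversion sets (`inversionSet_subset_iff`), and `Φ(x) ⊆ Φ(y)`
already follows from `Φ¹(x) ⊆ Φ(y)` (`inversionSet_subset_of_shortInversions_subset`), by a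
convexity argument. So an `m`-low element lies below every `y` whose inversion set contains its
`m`-elementary inversions. In particular it is the gate of its part.

What is left for the gates is that every part contains a low element below each of its members. From
`y`, strip right descents whose root is not `m`-elementary: the part does not change and the length
drops, until `Φᴿ(w) ⊆ ℰ_m`. That `w` is then low is the main point
(`exists_rightDescentRoots_encard_le`): for a short inversion `α` of `w`, some right-descent root of
`w` dominates at least as many roots as `α`.

This is proved by descent on the depth of `-w⁻¹α`. Passing to a suitable `v` above `w`, one finds a
right-descent root `ρ` of `v`, still a short inversion of `w` and of smaller depth, such that `α` is
a positive combination of `ρ` and another root made negative by `v⁻¹`. So only the plane of `α` and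
`ρ` matters. If `⟨α, ρ⟩ ≥ 1`, then `ρ` dominates `α`. Otherwise the roots of the plane form a finite
dihedral system in which shortness makes `α` a simple root and `ρ` a non-simple one.

Within such a system, reflecting `α` in a root at a non-acute angle does not decrease the number of
dominated roots (`encard_dominatedRoots_le_reflect`). This reaches half of the angles directly; the
others need the step from `α` to `s_α γ`, with `γ` the other simple root
(`encard_dominatedRoots_le_of_angle`). A root dominated by `α` but not by `s_α γ` satisfies tight
inequalities. A root of almost minimal height over the plane excludes them, except in special
positions for dihedral orders 8 and 12 (`dihedral_rigidity`), where an explicit injection repairs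
the count.

For join-irreducibility: if `g` has a single right descent `i`, every low element strictly below `g`
lies below the gate of the part of `g s_i`, so no two of them have join `g`. With two right descents
`i`, `j`, the element `g` is the join of the gates of the parts of `g s_i` and `g s_j`. -/

theorem geomForm_comm (x y : B →₀ ℝ) : M.geomForm x y = M.geomForm y x := by
  have h : M.geomForm = M.geomForm.flip := by
    ext i j
    have := M.geomForm_simpleRoot i j
    have h2 := M.geomForm_simpleRoot j i
    simp only [simpleRoot] at this h2
    simp [this, h2, M.symmetric i j]
  conv_lhs => rw [h]
  rfl

theorem geomForm_simpleRoot_self (i : B) : M.geomForm (M.simpleRoot i) (M.simpleRoot i) = 1 := by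
  simp [geomForm_simpleRoot]

/-- The reflection `v ↦ v - 2 ⟨β, v⟩ β` in a vector `β`. -/
noncomputable def reflect (β v : B →₀ ℝ) : B →₀ ℝ := v - (2 * M.geomForm β v) • β

theorem geomForm_reflect_left (β x y : B →₀ ℝ) :
    M.geomForm (M.reflect β x) y = M.geomForm x y - 2 * M.geomForm β x * M.geomForm β y := by
  simp [reflect]

theorem geomForm_reflect_right (β x y : B →₀ ℝ) :
    M.geomForm x (M.reflect β y) = M.geomForm x y - 2 * M.geomForm β y * M.geomForm x β := by
  simp [reflect]

theorem simpleReflection_eq_reflect (i : B) (v : B →₀ ℝ) :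
    M.simpleReflection i v = M.reflect (M.simpleRoot i) v :=
  M.simpleReflection_apply i v

theorem geomForm_reflect_reflect {β : B →₀ ℝ} (hβ : M.geomForm β β = 1) (x y : B →₀ ℝ) :
    M.geomForm (M.reflect β x) (M.reflect β y) = M.geomForm x y := by
  simp only [geomForm_reflect_left, geomForm_reflect_right, hβ, M.geomForm_comm x β]
  ring

theorem reflect_reflect {β : B →₀ ℝ} (hβ : M.geomForm β β = 1) (x : B →₀ ℝ) :
    M.reflect β (M.reflect β x) = x := by
  simp only [reflect, map_sub, map_smul, hβ, smul_eq_mul]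
  module

theorem reflect_self {β : B →₀ ℝ} (hβ : M.geomForm β β = 1) : M.reflect β β = -β := by
  simp only [reflect, hβ]
  module

theorem reflect_neg (β v : B →₀ ℝ) : M.reflect β (-v) = -M.reflect β v := by
  simp only [reflect, map_neg]
  module

theorem simpleRoot_nonneg (i : B) : 0 ≤ M.simpleRoot i := by
  classical
  intro j
  simp only [simpleRoot, Finsupp.single_apply]
  split_ifs <;> simp

theorem reflect_simpleRoot_apply_of_ne {i j : B} (h : j ≠ i) (v : B →₀ ℝ) :
    M.reflect (M.simpleRoot i) v j = v j := by
  simp [reflect, simpleRoot, h.symm]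

end CoxeterMatrix

/-! ### The ratios sin(nθ) / sin θ and their degenerate case. -/

/-- The sequence `0, 1, 2c, …` with `a (n + 2) = 2 c a (n + 1) - a n`. -/
def sinRatio (c : ℝ) : ℕ → ℝ
  | 0 => 0
  | 1 => 1
  | n + 2 => 2 * c * sinRatio c (n + 1) - sinRatio c n

theorem sinRatio_cos_mul_sin (θ : ℝ) (n : ℕ) :
    sinRatio (Real.cos θ) n * Real.sin θ = Real.sin (n * θ) := by
  induction n using Nat.twoStepInduction with
  | zero => simp [sinRatio]
  | one => simp [sinRatio]
  | more n h1 h2 =>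
    rw [sinRatio, sub_mul, mul_assoc, h2, h1]
    have e1 : ((n + 2 : ℕ) : ℝ) * θ = (n + 1 : ℕ) * θ + θ := by push_cast; ring
    have e2 : (n : ℝ) * θ = (n + 1 : ℕ) * θ - θ := by push_cast; ring
    rw [e1, e2, Real.sin_add, Real.sin_sub]
    ring

theorem sinRatio_one (n : ℕ) : sinRatio 1 n = n := by
  induction n using Nat.twoStepInduction with
  | zero => simp [sinRatio]
  | one => simp [sinRatio]
  | more n h1 h2 =>
    rw [sinRatio, h2, h1]
    push_cast
    ring

theorem sinRatio_nonneg {m n : ℕ} (hm : m ≠ 1) (h : m ≠ 0 → n ≤ m) :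
    0 ≤ sinRatio (Real.cos (Real.pi / m)) n := by
  rcases Nat.eq_zero_or_pos m with rfl | hm0
  -- `m = 0` encodes infinity: `π / 0 = 0`, so the parameter is `cos 0 = 1` and the ratio is `n`.
  · simp [sinRatio_one]
  have h2 : 2 ≤ m := by omega
  have hm' : (0 : ℝ) < m := by exact_mod_cast hm0
  have hs : 0 < Real.sin (Real.pi / m) := by
    apply Real.sin_pos_of_pos_of_lt_pi (by positivity)
    apply div_lt_self Real.pi_pos
    exact_mod_cast h2
  refine nonneg_of_mul_nonneg_left ?_ hs
  rw [sinRatio_cos_mul_sin]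
  apply Real.sin_nonneg_of_nonneg_of_le_pi (by positivity)
  rw [← mul_div_assoc, div_le_iff₀ hm', mul_comm]
  have : (n : ℝ) ≤ m := by exact_mod_cast h (by omega)
  exact mul_le_mul_of_nonneg_left this Real.pi_pos.le

/-! ### Every root is positive or negative. -/

namespace CoxeterSystem

variable {B W : Type*} [Group W] {M : CoxeterMatrix B} (cs : CoxeterSystem M W)

theorem geomRep_mul (u v : W) (x : B →₀ ℝ) :
    cs.geomRep (u * v) x = cs.geomRep u (cs.geomRep v x) := by
  rw [map_mul]; rfl

theorem geomRep_one (x : B →₀ ℝ) : cs.geomRep 1 x = x := by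
  rw [map_one]; rfl

theorem geomRep_inv_geomRep (w : W) (x : B →₀ ℝ) : cs.geomRep w⁻¹ (cs.geomRep w x) = x := by
  rw [← geomRep_mul, inv_mul_cancel, geomRep_one]

theorem geomRep_geomRep_inv (w : W) (x : B →₀ ℝ) : cs.geomRep w (cs.geomRep w⁻¹ x) = x := by
  rw [← geomRep_mul, mul_inv_cancel, geomRep_one]

theorem geomRep_simple_apply (i : B) (x : B →₀ ℝ) :
    cs.geomRep (cs.simple i) x = M.reflect (M.simpleRoot i) x := by
  rw [geomRep_simple, M.simpleReflection_eq_reflect]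

theorem geomForm_geomRep (w : W) (x y : B →₀ ℝ) :
    M.geomForm (cs.geomRep w x) (cs.geomRep w y) = M.geomForm x y := by
  induction w using cs.simple_induction_left generalizing x y with
  | one => simp
  | mul_simple_left w i ih =>
    rw [geomRep_mul, geomRep_mul, geomRep_simple_apply, geomRep_simple_apply,
      M.geomForm_reflect_reflect (M.geomForm_simpleRoot_self i), ih]

theorem geomRep_reflect (w : W) (x y : B →₀ ℝ) :
    cs.geomRep w (M.reflect x y) = M.reflect (cs.geomRep w x) (cs.geomRep w y) := by
  simp [CoxeterMatrix.reflect, geomForm_geomRep]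

variable {cs}

theorem simpleRoot_mem_roots (i : B) : M.simpleRoot i ∈ cs.roots := ⟨1, i, (cs.geomRep_one _).symm⟩

theorem geomRep_mem_roots {β : B →₀ ℝ} (w : W) (h : β ∈ cs.roots) : cs.geomRep w β ∈ cs.roots := by
  obtain ⟨u, i, rfl⟩ := h
  exact ⟨w * u, i, (cs.geomRep_mul ..).symm⟩

theorem neg_mem_roots {β : B →₀ ℝ} (h : β ∈ cs.roots) : -β ∈ cs.roots := by
  obtain ⟨u, i, rfl⟩ := h
  refine ⟨u * cs.simple i, i, ?_⟩
  rw [geomRep_mul, geomRep_simple_apply, M.reflect_self (M.geomForm_simpleRoot_self i), map_neg]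

theorem neg_mem_roots_iff {β : B →₀ ℝ} : -β ∈ cs.roots ↔ β ∈ cs.roots :=
  ⟨fun h => by simpa using neg_mem_roots h, neg_mem_roots⟩

theorem geomForm_self {β : B →₀ ℝ} (h : β ∈ cs.roots) : M.geomForm β β = 1 := by
  obtain ⟨u, i, rfl⟩ := h
  rw [geomForm_geomRep, M.geomForm_simpleRoot_self]

theorem ne_zero_of_mem_roots {β : B →₀ ℝ} (h : β ∈ cs.roots) : β ≠ 0 := by
  rintro rfl
  simpa using geomForm_self h

theorem exists_isReflectionOf {β : B →₀ ℝ} (h : β ∈ cs.roots) : ∃ t, cs.IsReflectionOf t β := by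
  obtain ⟨u, i, rfl⟩ := h
  exact ⟨_, u, i, rfl, rfl⟩

theorem IsReflectionOf.geomRep_apply {β : B →₀ ℝ} {t : W} (h : cs.IsReflectionOf t β)
    (v : B →₀ ℝ) : cs.geomRep t v = M.reflect β v := by
  obtain ⟨u, i, rfl, rfl⟩ := h
  rw [geomRep_mul, geomRep_mul, geomRep_simple_apply, geomRep_reflect, geomRep_geomRep_inv]

theorem IsReflectionOf.mul_self {β : B →₀ ℝ} {t : W} (h : cs.IsReflectionOf t β) :
    t * t = 1 := by
  obtain ⟨u, i, rfl, rfl⟩ := h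
  simp [mul_assoc]

theorem IsReflectionOf.inv {β : B →₀ ℝ} {t : W} (h : cs.IsReflectionOf t β) :
    t⁻¹ = t := inv_eq_of_mul_eq_one_left h.mul_self

theorem reflect_mem_roots {β γ : B →₀ ℝ} (hβ : β ∈ cs.roots) (hγ : γ ∈ cs.roots) :
    M.reflect β γ ∈ cs.roots := by
  obtain ⟨t, ht⟩ := exists_isReflectionOf hβ
  rw [← ht.geomRep_apply]
  exact geomRep_mem_roots t hγ

variable (cs)

/-- Peeling the letters `t, i, t, …` off the right end of `w` turns `α_i` into a dihedral root whose
coefficients are consecutive sine ratios. This reduces the sign of `w α_i` to those of `v α_i` and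
`v α_t` for a shorter `v`. -/
theorem geomRep_mul_inv_alternatingWord (w : W) (i t : B) (k : ℕ) :
    cs.geomRep w (M.simpleRoot i) =
      cs.geomRep (w * (cs.wordProd (alternatingWord i t k))⁻¹)
        (if Even k then
          sinRatio (Real.cos (Real.pi / M i t)) (k + 1) • M.simpleRoot i +
            sinRatio (Real.cos (Real.pi / M i t)) k • M.simpleRoot t
        else
          sinRatio (Real.cos (Real.pi / M i t)) k • M.simpleRoot i +
            sinRatio (Real.cos (Real.pi / M i t)) (k + 1) • M.simpleRoot t) := by
  induction k with
  | zero => simp [alternatingWord, sinRatio]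
  | succ k ih =>
    rw [ih, alternatingWord_succ', wordProd_cons, mul_inv_rev, ← mul_assoc, inv_simple,
      geomRep_mul _ _ (cs.simple _)]
    congr 1
    have e1 := M.geomForm_simpleRoot i t
    have e2 := M.geomForm_simpleRoot t i
    rw [M.symmetric t i] at e2
    by_cases hk : Even k
    · have hk' : ¬ Even (k + 1) := by simpa [Nat.even_add_one] using hk
      rw [if_pos hk, if_neg hk', if_pos hk, geomRep_simple_apply]
      simp only [CoxeterMatrix.reflect, map_add, map_smul, e2,
        M.geomForm_simpleRoot_self, sinRatio, smul_eq_mul]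
      module
    · have hk' : Even (k + 1) := by simpa [Nat.even_add_one] using hk
      rw [if_neg hk, if_pos hk', if_neg hk, geomRep_simple_apply]
      simp only [CoxeterMatrix.reflect, map_add, map_smul, e1,
        M.geomForm_simpleRoot_self, sinRatio, smul_eq_mul]
      module

theorem length_mul_inv_alternatingWord_of_le {w : W} {i t : B} {j k : ℕ} (hjk : j ≤ k)
    (h : cs.length (w * (cs.wordProd (alternatingWord i t k))⁻¹) + k = cs.length w) :
    cs.length (w * (cs.wordProd (alternatingWord i t j))⁻¹) + j = cs.length w := by
  induction k, hjk using Nat.le_induction with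
  | base => exact h
  | succ k hk ih =>
    apply ih
    rw [alternatingWord_succ', wordProd_cons, mul_inv_rev, ← mul_assoc, inv_simple] at h
    have h1 := cs.length_mul_simple (w * (cs.wordProd (alternatingWord i t k))⁻¹)
      (if Even k then t else i)
    have h2 := cs.length_mul_le w (cs.wordProd (alternatingWord i t k))⁻¹
    have h3 := cs.length_mul_le (w * (cs.wordProd (alternatingWord i t k))⁻¹)
      (cs.wordProd (alternatingWord i t k))
    have h4 := cs.length_wordProd_le (alternatingWord i t k)
    rw [length_alternatingWord] at h4
    rw [inv_mul_cancel_right] at h3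
    omega

/-- Once `M i t` letters come off, the braid relation rewrites them to end in `i`, which would make
`i` a right descent. This bound keeps the sine ratios nonnegative. -/
theorem lt_of_length_mul_inv_alternatingWord {w : W} {i t : B} {k : ℕ} (hM : M i t ≠ 0)
    (hi : ¬ cs.IsRightDescent w i)
    (h : cs.length (w * (cs.wordProd (alternatingWord i t k))⁻¹) + k = cs.length w) :
    k < M i t := by
  by_contra! hk
  have h1 := cs.length_mul_inv_alternatingWord_of_le hk h
  have hb : cs.wordProd (alternatingWord i t (M i t)) =
    cs.wordProd (alternatingWord t i (M i t)) := by
    have := cs.wordProd_braidWord_eq i t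
    rwa [braidWord, braidWord, M.symmetric t i] at this
  obtain ⟨n, hn⟩ := Nat.exists_eq_succ_of_ne_zero hM
  apply hi
  have e : w * cs.simple i = w * (cs.wordProd (alternatingWord i t (M i t)))⁻¹ *
      cs.wordProd (alternatingWord i t n) := by
    rw [hb, hn, alternatingWord_succ, wordProd_concat]
    simp [mul_assoc]
  have h2 := cs.length_mul_le (w * (cs.wordProd (alternatingWord i t (M i t)))⁻¹)
    (cs.wordProd (alternatingWord i t n))
  have h3 := cs.length_wordProd_le (alternatingWord i t n)
  rw [length_alternatingWord] at h3
  rw [← e] at h2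
  unfold IsRightDescent
  omega

theorem geomRep_simpleRoot_nonneg {w : W} {i : B} (h : ¬ cs.IsRightDescent w i) :
    0 ≤ cs.geomRep w (M.simpleRoot i) := by
  induction hn : cs.length w using Nat.strong_induction_on generalizing w i with
  | _ n ih =>
  subst hn
  by_cases hw : w = 1
  · rw [hw, geomRep_one]
    exact M.simpleRoot_nonneg i
  obtain ⟨t, ht⟩ := cs.exists_rightDescent_of_ne_one hw
  have hti : i ≠ t := by rintro rfl; exact h ht
  -- `P k`: peeling `k` alternating letters off `w`, beginning with `t`, shortens it by `k`. For the
  -- largest such `k`, neither `i` nor `t` is a right descent of the remainder: one by maximality,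
  -- the other because it was just removed.
  let P : ℕ → Prop := fun k =>
    cs.length (w * (cs.wordProd (alternatingWord i t k))⁻¹) + k = cs.length w
  classical
  have hP1 : P 1 := by
    have := (cs.isRightDescent_iff).mp ht
    simpa [P, alternatingWord] using this
  have hbd : ∀ k, P k → k ≤ cs.length w := fun k hk => by simp only [P] at hk; omega
  set k := Nat.findGreatest P (cs.length w) with hk
  have hPk : P k := Nat.findGreatest_spec (hbd 1 hP1) hP1
  have hk1 : 1 ≤ k := Nat.le_findGreatest (hbd 1 hP1) hP1
  have hPk' : ¬ P (k + 1) := fun h' => by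
    have := Nat.le_findGreatest (hbd _ h') h'
    omega
  clear_value k
  set v := w * (cs.wordProd (alternatingWord i t k))⁻¹ with hv
  have hvw : cs.length v < cs.length w := by simp only [P, ← hv] at hPk; omega
  have hnext : ¬ cs.IsRightDescent v (if Even k then t else i) := by
    intro hd
    rw [isRightDescent_iff] at hd
    apply hPk'
    simp only [P]
    simp only [P, ← hv] at hPk
    rw [alternatingWord_succ', wordProd_cons, mul_inv_rev, ← mul_assoc, inv_simple, ← hv]
    omega
  have hlast : ¬ cs.IsRightDescent v (if Even k then i else t) := by
    obtain ⟨j, rfl⟩ : ∃ j, k = j + 1 := ⟨k - 1, by omega⟩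
    have hPj : P j := cs.length_mul_inv_alternatingWord_of_le (Nat.le_succ j) hPk
    simp only [P] at hPj
    simp only [P, ← hv] at hPk
    have e : v * cs.simple (if Even j then t else i) =
        w * (cs.wordProd (alternatingWord i t j))⁻¹ := by
      rw [hv, alternatingWord_succ', wordProd_cons, mul_inv_rev, ← mul_assoc, inv_simple,
        mul_assoc, simple_mul_simple_self, mul_one]
    have e2 : (if Even (j + 1) then i else t) = (if Even j then t else i) := by
      by_cases hj : Even j
      · simp [Nat.even_add_one, hj]
      · simp [Nat.even_add_one, hj]
    rw [e2]
    unfold IsRightDescent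
    rw [e]
    omega
  have hvi : 0 ≤ cs.geomRep v (M.simpleRoot i) := by
    apply ih _ hvw _ rfl
    by_cases he : Even k <;> simp only [he, if_true, if_false] at hnext hlast <;> assumption
  have hvt : 0 ≤ cs.geomRep v (M.simpleRoot t) := by
    apply ih _ hvw _ rfl
    by_cases he : Even k <;> simp only [he, if_true, if_false] at hnext hlast <;> assumption
  have hlt : M i t ≠ 0 → k < M i t := fun h0 => cs.lt_of_length_mul_inv_alternatingWord h0 h hPk
  have hm1 : M i t ≠ 1 := M.off_diagonal i t hti
  have hA : 0 ≤ sinRatio (Real.cos (Real.pi / M i t)) k :=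
    sinRatio_nonneg hm1 fun h0 => (hlt h0).le
  have hA' : 0 ≤ sinRatio (Real.cos (Real.pi / M i t)) (k + 1) :=
    sinRatio_nonneg hm1 hlt
  rw [cs.geomRep_mul_inv_alternatingWord w i t k, ← hv]
  split_ifs
  all_goals
    rw [map_add, map_smul, map_smul]
    exact add_nonneg (smul_nonneg (by assumption) hvi) (smul_nonneg (by assumption) hvt)

theorem geomRep_simpleRoot_nonpos {w : W} {i : B} (h : cs.IsRightDescent w i) :
    cs.geomRep w (M.simpleRoot i) ≤ 0 := by
  rw [isRightDescent_iff_not_isRightDescent_mul] at h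
  have := cs.geomRep_simpleRoot_nonneg h
  rw [geomRep_mul, geomRep_simple_apply, M.reflect_self (M.geomForm_simpleRoot_self i),
    map_neg] at this
  simpa using this

variable {cs}

theorem isPositiveRoot_iff {β : B →₀ ℝ} : cs.IsPositiveRoot β ↔ β ∈ cs.roots ∧ 0 ≤ β := Iff.rfl

theorem isNegativeRoot_iff {β : B →₀ ℝ} : cs.IsNegativeRoot β ↔ β ∈ cs.roots ∧ β ≤ 0 := Iff.rfl

theorem isNegativeRoot_neg {β : B →₀ ℝ} : cs.IsNegativeRoot (-β) ↔ cs.IsPositiveRoot β := by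
  rw [isPositiveRoot_iff, isNegativeRoot_iff, neg_mem_roots_iff, neg_nonpos]

theorem isPositiveRoot_neg {β : B →₀ ℝ} : cs.IsPositiveRoot (-β) ↔ cs.IsNegativeRoot β := by
  rw [isPositiveRoot_iff, isNegativeRoot_iff, neg_mem_roots_iff, neg_nonneg]

theorem isPositiveRoot_or_isNegativeRoot {β : B →₀ ℝ} (h : β ∈ cs.roots) :
    cs.IsPositiveRoot β ∨ cs.IsNegativeRoot β := by
  have h' := h
  obtain ⟨w, i, rfl⟩ := h
  by_cases hd : cs.IsRightDescent w i
  · exact Or.inr ⟨h', cs.geomRep_simpleRoot_nonpos hd⟩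
  · exact Or.inl ⟨h', cs.geomRep_simpleRoot_nonneg hd⟩

theorem IsPositiveRoot.not_isNegativeRoot {β : B →₀ ℝ} (h : cs.IsPositiveRoot β) :
    ¬ cs.IsNegativeRoot β := fun h' =>
  ne_zero_of_mem_roots h.1 (le_antisymm (isNegativeRoot_iff.1 h').2 (isPositiveRoot_iff.1 h).2)

theorem isNegativeRoot_iff_not {β : B →₀ ℝ} (h : β ∈ cs.roots) :
    cs.IsNegativeRoot β ↔ ¬ cs.IsPositiveRoot β :=
  ⟨fun h1 h2 => h2.not_isNegativeRoot h1, (isPositiveRoot_or_isNegativeRoot h).resolve_left⟩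

theorem not_isNegativeRoot_iff {β : B →₀ ℝ} (h : β ∈ cs.roots) :
    ¬ cs.IsNegativeRoot β ↔ cs.IsPositiveRoot β := by
  rw [isNegativeRoot_iff_not h, not_not]

theorem isPositiveRoot_of_nonneg_comb {x y : B →₀ ℝ} {a b : ℝ} (ha : 0 ≤ a) (hb : 0 ≤ b)
    (hx : 0 ≤ x) (hy : 0 ≤ y) (h : a • x + b • y ∈ cs.roots) :
    cs.IsPositiveRoot (a • x + b • y) :=
  ⟨h, add_nonneg (smul_nonneg ha hx) (smul_nonneg hb hy)⟩

theorem isPositiveRoot_simpleRoot (i : B) : cs.IsPositiveRoot (M.simpleRoot i) :=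
  ⟨simpleRoot_mem_roots i, M.simpleRoot_nonneg i⟩

theorem isRightDescent_iff_isNegativeRoot {w : W} {i : B} :
    cs.IsRightDescent w i ↔ cs.IsNegativeRoot (cs.geomRep w (M.simpleRoot i)) := by
  refine ⟨fun h => ⟨⟨_, _, rfl⟩, cs.geomRep_simpleRoot_nonpos h⟩, fun h => ?_⟩
  by_contra hd
  exact IsPositiveRoot.not_isNegativeRoot ⟨h.1, cs.geomRep_simpleRoot_nonneg hd⟩ h

theorem not_isRightDescent_iff_isPositiveRoot {w : W} {i : B} :
    ¬ cs.IsRightDescent w i ↔ cs.IsPositiveRoot (cs.geomRep w (M.simpleRoot i)) := by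
  rw [isRightDescent_iff_isNegativeRoot, not_isNegativeRoot_iff ⟨_, _, rfl⟩]

/-- Otherwise `β` would be a nonnegative multiple of `α_i`, and both have norm 1. Since `s_i`
changes only the `i`-th coordinate, it therefore keeps every positive root but `α_i` positive. -/
theorem IsPositiveRoot.exists_apply_pos {β : B →₀ ℝ} (h : cs.IsPositiveRoot β) {i : B}
    (hi : β ≠ M.simpleRoot i) : ∃ j, j ≠ i ∧ 0 < β j := by
  classical
  by_contra! hc
  have e : β = β i • M.simpleRoot i := by
    ext j
    by_cases hj : j = i
    · subst hj; simp [CoxeterMatrix.simpleRoot]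
    · have := le_antisymm (hc j hj) (h.2 j)
      simp [CoxeterMatrix.simpleRoot, Ne.symm hj, this]
  have h1 := geomForm_self h.1
  have h2 := h.2 i
  rw [e] at h1
  simp only [map_smul, LinearMap.smul_apply, smul_eq_mul, M.geomForm_simpleRoot_self] at h1
  have h3 : β i = 1 := by nlinarith
  rw [h3, one_smul] at e
  exact hi e

theorem IsPositiveRoot.reflect_simpleRoot {β : B →₀ ℝ} (h : cs.IsPositiveRoot β) {i : B}
    (hi : β ≠ M.simpleRoot i) : cs.IsPositiveRoot (M.reflect (M.simpleRoot i) β) := by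
  have hr := reflect_mem_roots (simpleRoot_mem_roots i) h.1
  refine (isPositiveRoot_or_isNegativeRoot hr).resolve_right fun hn => ?_
  obtain ⟨j, hj, hpos⟩ := h.exists_apply_pos hi
  have := hn.2 j
  rw [M.reflect_simpleRoot_apply_of_ne hj] at this
  linarith

/-! ### Inversion sets, length and the weak order. -/

theorem inversionSet_one : cs.inversionSet 1 = ∅ := by
  ext β
  simp only [inversionSet, Set.mem_ofPred_eq, inv_one, geomRep_one, Set.mem_empty_iff_false,
    iff_false, not_and]
  exact fun h => h.not_isNegativeRoot

theorem mem_inversionSet_of_nonneg_comb {w : W} {x y : B →₀ ℝ} {a b : ℝ} (ha : 0 ≤ a) (hb : 0 ≤ b)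
    (hx : x ∈ cs.inversionSet w) (hy : y ∈ cs.inversionSet w) (h : a • x + b • y ∈ cs.roots) :
    a • x + b • y ∈ cs.inversionSet w := by
  refine ⟨isPositiveRoot_of_nonneg_comb ha hb hx.1.2 hy.1.2 h, geomRep_mem_roots _ h, ?_⟩
  have hx' : cs.geomRep w⁻¹ x ≤ 0 := hx.2.2
  have hy' : cs.geomRep w⁻¹ y ≤ 0 := hy.2.2
  change cs.geomRep w⁻¹ (a • x + b • y) ≤ 0
  rw [map_add, map_smul, map_smul]
  exact add_nonpos (smul_nonpos_of_nonneg_of_nonpos ha hx') (smul_nonpos_of_nonneg_of_nonpos hb hy')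

theorem inversionSet_mul_simple {w : W} {i : B} (h : ¬ cs.IsRightDescent w i) :
    cs.inversionSet (w * cs.simple i) =
      insert (cs.geomRep w (M.simpleRoot i)) (cs.inversionSet w) := by
  ext β
  simp only [inversionSet, Set.mem_ofPred_eq, Set.mem_insert_iff, mul_inv_rev, inv_simple,
    geomRep_mul, geomRep_simple_apply]
  constructor
  · rintro ⟨hβ, hn⟩
    by_cases he : cs.geomRep w⁻¹ β = M.simpleRoot i
    · left; rw [← he, geomRep_geomRep_inv]
    · right
      refine ⟨hβ, ?_⟩
      by_contra hc
      rw [not_isNegativeRoot_iff (geomRep_mem_roots _ hβ.1)] at hc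
      exact (hc.reflect_simpleRoot he).not_isNegativeRoot hn
  · rintro (rfl | ⟨hβ, hn⟩)
    · refine ⟨not_isRightDescent_iff_isPositiveRoot.1 h, ?_⟩
      rw [geomRep_inv_geomRep, M.reflect_self (M.geomForm_simpleRoot_self i), isNegativeRoot_neg]
      exact isPositiveRoot_simpleRoot i
    · refine ⟨hβ, ?_⟩
      rw [← isPositiveRoot_neg, ← M.reflect_neg]
      apply IsPositiveRoot.reflect_simpleRoot (isPositiveRoot_neg.2 hn)
      intro he
      apply hβ.not_isNegativeRoot
      have : β = -cs.geomRep w (M.simpleRoot i) := by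
        rw [← he, map_neg, geomRep_geomRep_inv, neg_neg]
      rw [this, isNegativeRoot_neg]
      exact not_isRightDescent_iff_isPositiveRoot.1 h

theorem geomRep_simpleRoot_notMem_inversionSet (w : W) (i : B) :
    cs.geomRep w (M.simpleRoot i) ∉ cs.inversionSet w := by
  rintro ⟨-, h⟩
  rw [geomRep_inv_geomRep] at h
  exact (isPositiveRoot_simpleRoot i).not_isNegativeRoot h

variable (cs) in
theorem finite_inversionSet_and_ncard (w : W) :
    (cs.inversionSet w).Finite ∧ (cs.inversionSet w).ncard = cs.length w := by
  induction hn : cs.length w generalizing w with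
  | zero =>
    rw [length_eq_zero_iff] at hn
    simp [hn, inversionSet_one]
  | succ n ih =>
    have hw : w ≠ 1 := by rintro rfl; simp at hn
    obtain ⟨i, hi⟩ := cs.exists_rightDescent_of_ne_one hw
    have h1 := cs.isRightDescent_iff.1 hi
    obtain ⟨hf, hc⟩ := ih (w * cs.simple i) (by omega)
    have e := inversionSet_mul_simple (cs.isRightDescent_iff_not_isRightDescent_mul.1 hi)
    rw [simple_mul_simple_cancel_right] at e
    rw [e]
    refine ⟨hf.insert _, ?_⟩
    rw [Set.ncard_insert_of_notMem (geomRep_simpleRoot_notMem_inversionSet _ _) hf, hc]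

variable (cs) in
theorem finite_inversionSet (w : W) : (cs.inversionSet w).Finite :=
  (cs.finite_inversionSet_and_ncard w).1

variable (cs) in
theorem ncard_inversionSet (w : W) : (cs.inversionSet w).ncard = cs.length w :=
  (cs.finite_inversionSet_and_ncard w).2

theorem inversionSet_subset_of_length_eq {w v : W}
    (h : cs.length v = cs.length w + cs.length (w⁻¹ * v)) :
    cs.inversionSet w ⊆ cs.inversionSet v := by
  obtain ⟨u, rfl⟩ : ∃ u, v = w * u := ⟨w⁻¹ * v, by simp⟩
  rw [inv_mul_cancel_left] at h
  induction hn : cs.length u generalizing u with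
  | zero =>
    rw [length_eq_zero_iff] at hn
    simp [hn]
  | succ n ih =>
    have hu : u ≠ 1 := by rintro rfl; simp at hn
    obtain ⟨i, hi⟩ := cs.exists_rightDescent_of_ne_one hu
    have h1 := cs.isRightDescent_iff.1 hi
    have h2 := cs.length_mul_le w (u * cs.simple i)
    have h3 := cs.length_mul_simple (w * u) i
    rw [mul_assoc] at h3
    have hd : cs.IsRightDescent (w * u) i := by
      unfold IsRightDescent
      rw [mul_assoc]
      omega
    have e := inversionSet_mul_simple (cs.isRightDescent_iff_not_isRightDescent_mul.1 hd)
    rw [simple_mul_simple_cancel_right] at e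
    rw [e, mul_assoc]
    exact (ih (u * cs.simple i) (by omega) (by omega)).trans (Set.subset_insert _ _)

/-- Strip a right descent `i` from `w` and induct. That the removed root is an inversion of `v` says
exactly that `i` is a left descent of `(w s_i)⁻¹ v`. -/
theorem length_eq_of_inversionSet_subset {w v : W} (h : cs.inversionSet w ⊆ cs.inversionSet v) :
    cs.length v = cs.length w + cs.length (w⁻¹ * v) := by
  induction hn : cs.length w generalizing w with
  | zero =>
    rw [length_eq_zero_iff] at hn
    simp [hn]
  | succ n ih =>
    have hw : w ≠ 1 := by rintro rfl; simp at hn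
    obtain ⟨i, hi⟩ := cs.exists_rightDescent_of_ne_one hw
    have h1 := cs.isRightDescent_iff.1 hi
    have e := inversionSet_mul_simple (cs.isRightDescent_iff_not_isRightDescent_mul.1 hi)
    rw [simple_mul_simple_cancel_right] at e
    have h2 := ih ((Set.subset_insert _ _).trans (e ▸ h)) (by omega)
    have hm : cs.geomRep (w * cs.simple i) (M.simpleRoot i) ∈ cs.inversionSet v :=
      h (e ▸ Set.mem_insert _ _)
    have h3 := hm.2
    rw [← geomRep_mul, ← isRightDescent_iff_isNegativeRoot, ← isLeftDescent_inv_iff,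
      isLeftDescent_iff] at h3
    have e2 : cs.simple i * (v⁻¹ * (w * cs.simple i))⁻¹ = w⁻¹ * v := by simp [mul_assoc]
    have e3 : (v⁻¹ * (w * cs.simple i))⁻¹ = (w * cs.simple i)⁻¹ * v := by simp
    rw [e2, e3] at h3
    omega

theorem inversionSet_subset_iff {w v : W} :
    cs.inversionSet w ⊆ cs.inversionSet v ↔ cs.length v = cs.length w + cs.length (w⁻¹ * v) :=
  ⟨length_eq_of_inversionSet_subset, inversionSet_subset_of_length_eq⟩

end CoxeterSystem

/-! ### Short inversions determine the inversion set. -/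

/-- The sum of the coordinates of a vector. -/
noncomputable def coordSum (B : Type*) : (B →₀ ℝ) →ₗ[ℝ] ℝ := Finsupp.linearCombination ℝ fun _ => 1

theorem coordSum_pos {B : Type*} {v : B →₀ ℝ} (h : 0 ≤ v) (h0 : v ≠ 0) : 0 < coordSum B v := by
  rw [coordSum, Finsupp.linearCombination_apply]
  refine Finset.sum_pos (fun i hi => ?_) (Finsupp.support_nonempty_iff.2 h0)
  have := (h i).lt_of_ne (Finsupp.mem_support_iff.1 hi).symm
  simpa using this

/-- A point strictly between two points of at most its own Euclidean norm, stated for rays: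
if `u + v = w`, then comparing normalizations forces `u` and `v` to be proportional. -/
theorem smul_eq_smul_of_normalized_le {B : Type*} [Fintype B] {u v : B → ℝ} {a b K : ℝ}
    (ha : 0 < a) (hb : 0 < b) (hu : u ⬝ᵥ u ≤ K * a ^ 2) (hv : v ⬝ᵥ v ≤ K * b ^ 2)
    (huv : (u + v) ⬝ᵥ (u + v) = K * (a + b) ^ 2) : b • u = a • v := by
  have h1 : (u + v) ⬝ᵥ (u + v) = u ⬝ᵥ u + 2 * (u ⬝ᵥ v) + v ⬝ᵥ v := by
    rw [add_dotProduct, dotProduct_add, dotProduct_add, dotProduct_comm v u]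
    ring
  have h2 : (b • u - a • v) ⬝ᵥ (b • u - a • v) =
      b ^ 2 * (u ⬝ᵥ u) - 2 * a * b * (u ⬝ᵥ v) + a ^ 2 * (v ⬝ᵥ v) := by
    simp only [sub_dotProduct, dotProduct_sub, smul_dotProduct, dotProduct_smul, smul_eq_mul,
      dotProduct_comm v u]
    ring
  have h3 : K * a * b ≤ u ⬝ᵥ v := by nlinarith
  have h4 : (b • u - a • v) ⬝ᵥ (b • u - a • v) ≤ 0 := by
    rw [h2]
    have e1 := mul_le_mul_of_nonneg_left hu (sq_nonneg b)
    have e2 := mul_le_mul_of_nonneg_left hv (sq_nonneg a)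
    have e3 := mul_le_mul_of_nonneg_left h3 (mul_pos ha hb).le
    nlinarith
  have h5 : (b • u - a • v) ⬝ᵥ (b • u - a • v) = 0 :=
    le_antisymm h4 (Finset.sum_nonneg fun i _ => mul_self_nonneg _)
  rw [dotProduct_self_eq_zero] at h5
  exact sub_eq_zero.1 h5

namespace CoxeterSystem

variable {B W : Type*} [Group W] {M : CoxeterMatrix B} {cs : CoxeterSystem M W}

theorem IsPositiveRoot.coordSum_pos {β : B →₀ ℝ} (h : cs.IsPositiveRoot β) : 0 < coordSum B β :=
  _root_.coordSum_pos h.2 (ne_zero_of_mem_roots h.1)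

theorem IsNegativeRoot.coordSum_neg {β : B →₀ ℝ} (h : cs.IsNegativeRoot β) : coordSum B β < 0 := by
  have := (isPositiveRoot_neg.2 h).coordSum_pos
  rw [map_neg] at this
  linarith

theorem IsPositiveRoot.eq_of_smul_eq {x y : B →₀ ℝ} (hx : cs.IsPositiveRoot x)
    (hy : cs.IsPositiveRoot y) {c : ℝ} (h : x = c • y) : x = y := by
  have h1 := geomForm_self hx.1
  rw [h] at h1
  simp only [map_smul, LinearMap.smul_apply, smul_eq_mul, geomForm_self hy.1] at h1
  have h2 := hx.coordSum_pos
  rw [h, map_smul, smul_eq_mul] at h2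
  have h3 : 0 < c := pos_of_mul_pos_left h2 hy.coordSum_pos.le
  have h4 : c = 1 := by nlinarith
  rw [h, h4, one_smul]

theorem geomForm_pos_of_reflect_isNegativeRoot {β ν : B →₀ ℝ} (hβ : cs.IsPositiveRoot β)
    (hν : cs.IsPositiveRoot ν) (h : cs.IsNegativeRoot (M.reflect β ν)) : 0 < M.geomForm β ν := by
  have h1 := h.coordSum_neg
  simp only [CoxeterMatrix.reflect, map_sub, map_smul, smul_eq_mul] at h1
  by_contra! hc
  nlinarith [hβ.coordSum_pos, hν.coordSum_pos]

theorem mem_inversionSet_iff {w : W} {β : B →₀ ℝ} :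
    β ∈ cs.inversionSet w ↔ cs.IsPositiveRoot β ∧ cs.IsNegativeRoot (cs.geomRep w⁻¹ β) := Iff.rfl

/-- Send `ν ∈ Φ(tw)` to `s_β ν` if that is positive and to itself otherwise. This is injective, with
image `Φ(w)` without `β` and without the roots `μ` whose partner `-s_β μ` is an inversion too. Hence
the length drops by one exactly when there are no partners. -/
theorem length_reflection_mul {w t : W} {β : B →₀ ℝ} (hβ : β ∈ cs.inversionSet w)
    (ht : cs.IsReflectionOf t β) :
    cs.length (t * w) = ((cs.inversionSet w \ {β}) \
      {μ | -M.reflect β μ ∈ cs.inversionSet w}).ncard := by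
  classical
  rw [← ncard_inversionSet]
  let h : (B →₀ ℝ) → (B →₀ ℝ) := fun ν =>
    if cs.IsPositiveRoot (M.reflect β ν) then M.reflect β ν else ν
  have hββ := geomForm_self hβ.1.1
  have hmem : ∀ ν, ν ∈ cs.inversionSet (t * w) ↔
      cs.IsPositiveRoot ν ∧ cs.IsNegativeRoot (cs.geomRep w⁻¹ (M.reflect β ν)) := by
    intro ν
    rw [mem_inversionSet_iff, mul_inv_rev, geomRep_mul, ht.inv, ht.geomRep_apply]
  have hinj : Set.InjOn h (cs.inversionSet (t * w)) := by
    intro ν hν ν' hν' he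
    simp only [h] at he
    split_ifs at he with h1 h2 h2
    · rw [← M.reflect_reflect hββ ν, he, M.reflect_reflect hββ]
    · rw [← he, M.reflect_reflect hββ] at h2
      exact absurd hν.1 h2
    · rw [he, M.reflect_reflect hββ] at h1
      exact absurd hν'.1 h1
    · exact he
  rw [← Set.InjOn.ncard_image hinj]
  congr 1
  ext μ
  simp only [Set.mem_image, Set.mem_sdiff, Set.mem_singleton_iff, Set.mem_ofPred_eq]
  constructor
  · rintro ⟨ν, hν, rfl⟩
    have hν' := (hmem ν).1 hν
    have hr : M.reflect β ν ∈ cs.roots := reflect_mem_roots hβ.1.1 hν.1.1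
    simp only [h]
    split_ifs with h1
    · refine ⟨⟨⟨h1, hν'.2⟩, fun he => ?_⟩, fun hm => ?_⟩
      · have : ν = -β := by rw [← M.reflect_reflect hββ ν, he, M.reflect_self hββ]
        rw [this, isPositiveRoot_neg] at hν'
        exact hβ.1.not_isNegativeRoot hν'.1
      · rw [M.reflect_reflect hββ] at hm
        exact hν.1.not_isNegativeRoot (isPositiveRoot_neg.1 hm.1)
    · rw [← isNegativeRoot_iff_not hr] at h1
      refine ⟨⟨⟨hν.1, ?_⟩, ?_⟩, fun hm => ?_⟩
      · have hc := geomForm_pos_of_reflect_isNegativeRoot hβ.1 hν.1 h1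
        rw [← isPositiveRoot_neg]
        have e : -cs.geomRep w⁻¹ ν = (1 : ℝ) • -cs.geomRep w⁻¹ (M.reflect β ν) +
            (2 * M.geomForm β ν) • -cs.geomRep w⁻¹ β := by
          simp only [CoxeterMatrix.reflect, map_sub, map_smul]
          module
        have hroot := neg_mem_roots (geomRep_mem_roots w⁻¹ hν.1.1)
        rw [e] at hroot ⊢
        exact isPositiveRoot_of_nonneg_comb zero_le_one (by positivity)
          (isPositiveRoot_neg.2 hν'.2).2 (isPositiveRoot_neg.2 hβ.2).2 hroot
      · rintro rfl
        have := hν'.2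
        rw [M.reflect_self hββ, map_neg, isNegativeRoot_neg] at this
        exact this.not_isNegativeRoot hβ.2
      · have := hm.2
        rw [map_neg, isNegativeRoot_neg] at this
        exact this.not_isNegativeRoot hν'.2
  · rintro ⟨⟨hμ, hne⟩, hm⟩
    have hr : M.reflect β μ ∈ cs.roots := reflect_mem_roots hβ.1.1 hμ.1.1
    by_cases h1 : cs.IsPositiveRoot (M.reflect β μ)
    · refine ⟨M.reflect β μ, (hmem _).2 ⟨h1, ?_⟩, ?_⟩
      · rw [M.reflect_reflect hββ]; exact hμ.2
      · simp only [h, M.reflect_reflect hββ, if_pos hμ.1]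
    · refine ⟨μ, (hmem _).2 ⟨hμ.1, ?_⟩, by simp only [h, if_neg h1]⟩
      by_contra hc
      apply hm
      rw [not_isNegativeRoot_iff (geomRep_mem_roots _ hr)] at hc
      rw [← isNegativeRoot_iff_not hr, ← isPositiveRoot_neg] at h1
      exact ⟨h1, by rwa [map_neg, isNegativeRoot_neg]⟩

/-- An inversion `β` of `w` is short if and only if no other inversion is mapped to the negative of
an inversion by the reflection in `β`. -/
theorem mem_shortInversions_iff {w : W} {β : B →₀ ℝ} :
    β ∈ cs.shortInversions w ↔ β ∈ cs.inversionSet w ∧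
      ∀ μ ∈ cs.inversionSet w, μ ≠ β → -M.reflect β μ ∉ cs.inversionSet w := by
  have hf := cs.finite_inversionSet w
  refine and_congr_right fun hβ => ?_
  have hn := Set.ncard_sdiff_singleton_add_one hβ hf
  rw [ncard_inversionSet] at hn
  constructor
  · rintro ⟨t, ht, hl⟩ μ hμ hne hm
    rw [length_reflection_mul hβ ht] at hl
    have := Set.ncard_lt_ncard (s := (cs.inversionSet w \ {β}) \
      {μ | -M.reflect β μ ∈ cs.inversionSet w}) (t := cs.inversionSet w \ {β})
      ⟨Set.sdiff_subset, fun hs => (hs ⟨hμ, hne⟩).2 hm⟩ (hf.subset Set.sdiff_subset)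
    omega
  · intro h
    obtain ⟨t, ht⟩ := exists_isReflectionOf hβ.1.1
    refine ⟨t, ht, ?_⟩
    rw [length_reflection_mul hβ ht, ← hn]
    congr 2
    ext μ
    simp only [Set.mem_sdiff, Set.mem_singleton_iff, Set.mem_ofPred_eq, and_iff_left_iff_imp]
    exact fun hμ => h μ hμ.1 hμ.2

theorem shortInversions_subset (w : W) : cs.shortInversions w ⊆ cs.inversionSet w := fun _ h => h.1

theorem mem_shortInversions_of_subset {w v : W} (h : cs.inversionSet w ⊆ cs.inversionSet v)
    {β : B →₀ ℝ} (hw : β ∈ cs.inversionSet w) (hv : β ∈ cs.shortInversions v) :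
    β ∈ cs.shortInversions w := by
  rw [mem_shortInversions_iff] at hv ⊢
  exact ⟨hw, fun μ hμ hne hm => hv.2 μ (h hμ) hne (h hm)⟩

theorem rightDescentRoots_subset_shortInversions (w : W) :
    cs.rightDescentRoots w ⊆ cs.shortInversions w := by
  rintro _ ⟨i, hi, rfl⟩
  refine ⟨⟨?_, ?_⟩, w * cs.simple i * w⁻¹, ⟨w * cs.simple i, i, ?_, ?_⟩, ?_⟩
  · rw [isPositiveRoot_neg]
    exact isRightDescent_iff_isNegativeRoot.1 hi
  · rw [map_neg, geomRep_inv_geomRep, isNegativeRoot_neg]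
    exact isPositiveRoot_simpleRoot i
  · rw [geomRep_mul, geomRep_simple_apply, M.reflect_self (M.geomForm_simpleRoot_self i), map_neg]
  · simp [mul_assoc]
  · rw [inv_mul_cancel_right]
    exact cs.isRightDescent_iff.1 hi

/-- Suppose `Φ(x) ⊄ Φ(y)`. Normalize the inversions of `x` by a functional `a` positive on them and
maximize a functional `f` whose sign detects `Φ(y)`. A point of largest Euclidean norm among the
maximizers is extreme, hence a short inversion, and `f > 0` puts it outside `Φ(y)`. Finiteness of
`B` provides the norm. -/
theorem inversionSet_subset_of_shortInversions_subset [Finite B] {x y : W}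
    (h : cs.shortInversions x ⊆ cs.inversionSet y) : cs.inversionSet x ⊆ cs.inversionSet y := by
  classical
  have := Fintype.ofFinite B
  by_contra hns
  obtain ⟨β₀, hβ₀x, hβ₀y⟩ := Set.not_subset.1 hns
  have hf := cs.finite_inversionSet x
  let a : (B →₀ ℝ) →ₗ[ℝ] ℝ := -(coordSum B ∘ₗ (cs.geomRep x⁻¹).toLinearMap)
  let f : (B →₀ ℝ) →ₗ[ℝ] ℝ := coordSum B ∘ₗ (cs.geomRep y⁻¹).toLinearMap
  have ha : ∀ β ∈ cs.inversionSet x, 0 < a β := fun β hβ => by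
    have := hβ.2.coordSum_neg
    simp only [a, LinearMap.neg_apply, LinearMap.comp_apply, LinearEquiv.coe_coe]
    linarith
  have hfpos : ∀ β ∈ cs.inversionSet x, 0 < f β → β ∉ cs.inversionSet y := by
    intro β _ h0 hy
    have := hy.2.coordSum_neg
    simp only [f, LinearMap.comp_apply, LinearEquiv.coe_coe] at h0
    linarith
  obtain ⟨β₁, hβ₁, hmax₁⟩ := Set.exists_max_image _ (fun β => f β / a β) hf ⟨β₀, hβ₀x⟩
  set r := f β₁ / a β₁ with hr
  have hr0 : 0 < r := by
    refine lt_of_lt_of_le ?_ (hmax₁ β₀ hβ₀x)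
    refine div_pos ?_ (ha _ hβ₀x)
    apply IsPositiveRoot.coordSum_pos (cs := cs)
    by_contra hc
    apply hβ₀y
    exact ⟨hβ₀x.1, (isNegativeRoot_iff_not (geomRep_mem_roots _ hβ₀x.1.1)).2 hc⟩
  have hle : ∀ β ∈ cs.inversionSet x, f β ≤ r * a β := fun β hβ =>
    (div_le_iff₀ (ha β hβ)).1 (hmax₁ β hβ)
  obtain ⟨β, ⟨hβ, hβr⟩, hmax⟩ := Set.exists_max_image
    (cs.inversionSet x ∩ {β | f β = r * a β}) (fun β => ((β : B → ℝ) ⬝ᵥ β) / (a β) ^ 2)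
    (hf.subset Set.inter_subset_left)
    ⟨β₁, hβ₁, by simp only [Set.mem_ofPred_eq, hr]; field_simp [(ha _ hβ₁).ne']⟩
  simp only [Set.mem_ofPred_eq] at hβr
  have hshort : β ∉ cs.shortInversions x := fun hs => by
    refine hfpos β hβ ?_ (h hs)
    rw [hβr]
    exact mul_pos hr0 (ha _ hβ)
  rw [mem_shortInversions_iff] at hshort
  push Not at hshort
  obtain ⟨μ, hμ, hne, hμ'⟩ := hshort hβ
  set μ' := -M.reflect β μ with hμ'def
  set k := M.geomForm β μ with hk
  have hsum : μ + μ' = (2 * k) • β := by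
    simp only [hμ'def, CoxeterMatrix.reflect, ← hk]
    module
  have ha' : a μ + a μ' = 2 * k * a β := by rw [← map_add, hsum, map_smul, smul_eq_mul]
  have hf' : f μ + f μ' = 2 * k * f β := by rw [← map_add, hsum, map_smul, smul_eq_mul]
  have haμ := ha μ hμ
  have haμ' := ha μ' hμ'
  have haβ := ha β hβ
  have hk0 : 0 < 2 * k := by
    by_contra! hc
    nlinarith
  -- After normalization `β` lies between `μ` and its partner `μ'`, so both attain the maximal ratio
  -- as well. Strict convexity of the norm then makes the two proportional, hence equal, and finally
  -- equal to `β`.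
  have h1 := hle μ hμ
  have h2 := hle μ' hμ'
  have h3 : r * (a μ + a μ') = f μ + f μ' := by rw [ha', hf', hβr]; ring
  have e1 : f μ = r * a μ := by linarith
  have e2 : f μ' = r * a μ' := by linarith
  have n1 := (div_le_iff₀ (by positivity)).1 (hmax μ ⟨hμ, e1⟩)
  have n2 := (div_le_iff₀ (by positivity)).1 (hmax μ' ⟨hμ', e2⟩)
  have n3 : ((μ : B → ℝ) + (μ' : B → ℝ)) ⬝ᵥ ((μ : B → ℝ) + (μ' : B → ℝ)) =
      ((β : B → ℝ) ⬝ᵥ β) / (a β) ^ 2 * (a μ + a μ') ^ 2 := by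
    rw [← Finsupp.coe_add, hsum, ha', Finsupp.coe_smul, smul_dotProduct, dotProduct_smul]
    simp only [smul_eq_mul]
    field_simp
  have h4 := smul_eq_smul_of_normalized_le haμ haμ' n1 n2 n3
  have h5 : a μ' • μ = a μ • μ' := by
    ext i
    exact congrFun h4 i
  have h6 : μ = μ' := hμ.1.eq_of_smul_eq hμ'.1 (c := (a μ')⁻¹ * a μ) (by
    rw [mul_smul, ← h5, smul_smul, inv_mul_cancel₀ haμ'.ne', one_smul])
  apply hne
  apply hμ.1.eq_of_smul_eq hβ.1 (c := k)
  rw [← h6] at hsum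
  have : (2 : ℝ) • μ = (2 : ℝ) • k • β := by rw [smul_smul, ← hsum]; module
  exact smul_right_injective _ (two_ne_zero) this

end CoxeterSystem

/-! ### Dominance and the values of the form. -/

theorem one_le_of_pos_recurrence {g : ℕ → ℝ} {c : ℝ} (hpos : ∀ n, 0 < g n)
    (hrec : ∀ n, g (n + 2) = 2 * c * g (n + 1) - g n) : 1 ≤ c := by
  by_contra! hc
  -- For `c < 1` the positive sequence `g` is strictly concave. A negative increment soon makes it
  -- negative. If no increment is negative, then `g ≥ g 0`, and the increments fall by at least `(2
  -- - 2c) g 0` each time.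
  have hd : ∀ n, g (n + 2) - g (n + 1) < g (n + 1) - g n := fun n => by
    rw [hrec]
    nlinarith [hpos (n + 1)]
  have hanti : Antitone fun n => g (n + 1) - g n := antitone_nat_of_succ_le fun n => (hd n).le
  by_cases hneg : ∃ n, g (n + 1) - g n < 0
  · obtain ⟨n, hn⟩ := hneg
    have hlin : ∀ k : ℕ, g (n + k) ≤ g n + k * (g (n + 1) - g n) := fun k => by
      induction k with
      | zero => simp
      | succ k ih =>
        have := hanti (Nat.le_add_right n k)
        simp only at this
        push_cast
        rw [← add_assoc]
        linarith
    obtain ⟨k, hk⟩ := exists_nat_gt (g n / (-(g (n + 1) - g n)))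
    rw [div_lt_iff₀ (by linarith)] at hk
    linarith [hlin k, hpos (n + k)]
  · push Not at hneg
    have hmono : Monotone g := monotone_nat_of_le_succ fun n => by linarith [hneg n]
    have hlin : ∀ k : ℕ, g (k + 1) - g k ≤ g 1 - g 0 - k * ((2 - 2 * c) * g 0) := fun k => by
      induction k with
      | zero => simp
      | succ k ih =>
        have h1 := hmono (Nat.zero_le (k + 1))
        have h2 : (2 - 2 * c) * g 0 ≤ (2 - 2 * c) * g (k + 1) :=
          mul_le_mul_of_nonneg_left h1 (by linarith)
        have h3 := hrec k
        push_cast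
        linarith
    have hG : 0 < (2 - 2 * c) * g 0 := mul_pos (by linarith) (hpos 0)
    obtain ⟨k, hk⟩ := exists_nat_gt ((g 1 - g 0) / ((2 - 2 * c) * g 0))
    rw [div_lt_iff₀ hG] at hk
    linarith [hlin k, hneg k]

theorem sinRatio_add_one_le {c : ℝ} (hc : 1 ≤ c) (n : ℕ) :
    0 ≤ sinRatio c n ∧ sinRatio c n + 1 ≤ sinRatio c (n + 1) := by
  induction n with
  | zero => simp [sinRatio]
  | succ n ih =>
    rw [sinRatio]
    constructor <;> nlinarith

/-- The expression is `⟨y, rotSeq x y n⟩` for unit vectors with `⟨x, y⟩ = c`; its monotonicity tells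
the terms of the sequence apart. -/
theorem strictMono_sinRatio_sub {c : ℝ} (hc : 1 < c) :
    StrictMono fun n => sinRatio c (n + 1) - c * sinRatio c n := by
  have key : ∀ n, 0 < sinRatio c (n + 1) - c * sinRatio c n ∧
      0 < sinRatio c (n + 2) - c * sinRatio c (n + 1) -
        (sinRatio c (n + 1) - c * sinRatio c n) := fun n => by
    induction n with
    | zero => constructor <;> simp [sinRatio]; linarith
    | succ n ih =>
      have e : sinRatio c (n + 3) = 2 * c * sinRatio c (n + 2) - sinRatio c (n + 1) := rfl
      have e2 : sinRatio c (n + 2) = 2 * c * sinRatio c (n + 1) - sinRatio c n := rfl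
      constructor
      · linarith
      · change 0 < sinRatio c (n + 3) - c * sinRatio c (n + 2) - _
        rw [e]
        nlinarith
  exact strictMono_nat_of_lt_succ fun n => by linarith [(key n).2]

namespace CoxeterMatrix

variable {B : Type*} (M : CoxeterMatrix B)

/-- The sequence of vectors starting with `y`, `2 c y - x`, where `c = ⟨x, y⟩`, obtained by
iterating `(x, y) ↦ (y, 2 c y - x)`. -/
noncomputable def rotSeq (x y : B →₀ ℝ) (n : ℕ) : B →₀ ℝ :=
  sinRatio (M.geomForm x y) (n + 1) • y - sinRatio (M.geomForm x y) n • x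

theorem rotSeq_zero (x y : B →₀ ℝ) : M.rotSeq x y 0 = y := by simp [rotSeq, sinRatio]

theorem rotSeq_one (x y : B →₀ ℝ) : M.rotSeq x y 1 = -M.reflect y x := by
  simp only [rotSeq, sinRatio, reflect, M.geomForm_comm x y]
  module

theorem rotSeq_add_two (x y : B →₀ ℝ) (n : ℕ) :
    M.rotSeq x y (n + 2) = (2 * M.geomForm x y) • M.rotSeq x y (n + 1) - M.rotSeq x y n := by
  simp only [rotSeq, sinRatio]
  module

theorem geomForm_rotSeq {x y : B →₀ ℝ} (hx : M.geomForm x x = 1) (hy : M.geomForm y y = 1)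
    (n : ℕ) : M.geomForm (M.rotSeq x y n) (M.rotSeq x y n) = 1 ∧
      M.geomForm (M.rotSeq x y n) (M.rotSeq x y (n + 1)) = M.geomForm x y := by
  induction n with
  | zero =>
    rw [rotSeq_zero, rotSeq_one]
    refine ⟨hy, ?_⟩
    simp only [reflect, map_neg, map_sub, map_smul, hy, M.geomForm_comm x y, smul_eq_mul]
    ring
  | succ n ih =>
    have h1 : M.geomForm (M.rotSeq x y (n + 1)) (M.rotSeq x y (n + 1)) = 1 := by
      have e : sinRatio (M.geomForm x y) (n + 2) =
        2 * (M.geomForm x y) * sinRatio (M.geomForm x y) (n + 1) - sinRatio (M.geomForm x y) n := rfl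
      have h := ih.1
      have h' := ih.2
      simp only [rotSeq, map_sub, map_smul, LinearMap.sub_apply, LinearMap.smul_apply,
        smul_eq_mul, hx, hy, M.geomForm_comm y x, e] at h h' ⊢
      linear_combination h
    refine ⟨h1, ?_⟩
    rw [rotSeq_add_two, map_sub, map_smul, smul_eq_mul, h1, M.geomForm_comm _ (M.rotSeq x y n), ih.2]
    ring

theorem rotSeq_add_two_eq_neg_reflect {x y : B →₀ ℝ} (hx : M.geomForm x x = 1)
    (hy : M.geomForm y y = 1) (n : ℕ) :
    M.rotSeq x y (n + 2) = -M.reflect (M.rotSeq x y (n + 1)) (M.rotSeq x y n) := by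
  rw [rotSeq_add_two, reflect, M.geomForm_comm (M.rotSeq x y (n + 1)),
    (M.geomForm_rotSeq hx hy n).2]
  module

theorem injective_rotSeq {x y : B →₀ ℝ} (hc : 1 ≤ M.geomForm x y) (hy : M.geomForm y y = 1)
    (hne : x ≠ y) : Function.Injective (M.rotSeq x y) := by
  rcases hc.eq_or_lt with h1 | h1
  · intro n k h
    simp only [rotSeq, ← h1, sinRatio_one] at h
    have e : ((n : ℝ) - k) • (y - x) = 0 := by
      have : ((n : ℝ) - k) • (y - x) =
        (((n + 1 : ℕ) : ℝ) • y - (n : ℝ) • x) - (((k + 1 : ℕ) : ℝ) • y - (k : ℝ) • x) := by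
          push_cast; module
      rw [this, h, sub_self]
    rcases smul_eq_zero.1 e with h2 | h2
    · exact_mod_cast sub_eq_zero.1 h2
    · exact absurd (sub_eq_zero.1 h2).symm hne
  · intro n k h
    apply (strictMono_sinRatio_sub h1).injective
    have h2 := congrArg (M.geomForm y) h
    simp only [rotSeq, map_sub, map_smul, smul_eq_mul, hy, M.geomForm_comm y x] at h2
    linarith

end CoxeterMatrix

namespace CoxeterSystem

variable {B W : Type*} [Group W] {M : CoxeterMatrix B} {cs : CoxeterSystem M W}

theorem rotSeq_mem_roots {x y : B →₀ ℝ} (hx : x ∈ cs.roots) (hy : y ∈ cs.roots) (n : ℕ) :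
    M.rotSeq x y n ∈ cs.roots := by
  induction n using Nat.twoStepInduction with
  | zero => rwa [M.rotSeq_zero]
  | one => rw [M.rotSeq_one]; exact neg_mem_roots (reflect_mem_roots hy hx)
  | more n h1 h2 =>
    rw [M.rotSeq_add_two_eq_neg_reflect (geomForm_self hx) (geomForm_self hy)]
    exact neg_mem_roots (reflect_mem_roots h2 h1)

theorem Dominates.refl (x : B →₀ ℝ) : cs.Dominates x x := fun _ h => h

theorem Dominates.trans {x y z : B →₀ ℝ} (h1 : cs.Dominates x y) (h2 : cs.Dominates y z) :
    cs.Dominates x z := fun w h => h2 w (h1 w h)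

theorem Dominates.geomRep {x y : B →₀ ℝ} (h : cs.Dominates x y) (g : W) :
    cs.Dominates (cs.geomRep g x) (cs.geomRep g y) := fun w hw => by
  have := h (g⁻¹ * w)
  simp only [mul_inv_rev, inv_inv, geomRep_mul] at this
  exact this hw

theorem Dominates.neg {x y : B →₀ ℝ} (hx : x ∈ cs.roots) (h : cs.Dominates x y) : cs.Dominates (-y) (-x) := fun w hw => by
  rw [map_neg, isNegativeRoot_neg] at hw ⊢
  rw [← not_isNegativeRoot_iff (geomRep_mem_roots _ hx)]
  exact fun hn => hw.not_isNegativeRoot (h w hn)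

theorem Dominates.reflect {x y z : B →₀ ℝ} (hz : z ∈ cs.roots) (h : cs.Dominates x y) :
    cs.Dominates (M.reflect z x) (M.reflect z y) := by
  obtain ⟨t, ht⟩ := exists_isReflectionOf hz
  rw [← ht.geomRep_apply, ← ht.geomRep_apply]
  exact h.geomRep t

theorem Dominates.neg_reflect {x y : B →₀ ℝ} (hx : x ∈ cs.roots) (hy : y ∈ cs.roots)
    (h : cs.Dominates x y) : cs.Dominates y (-M.reflect y x) := by
  have h1 := (h.reflect hy).neg (reflect_mem_roots hy hx)
  rwa [M.reflect_self (geomForm_self hy), neg_neg] at h1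

/-- Reflecting `x`, `y` in `y` and negating turns "`x` dominates `y`" into "`y` dominates `-s_y x`".
Iterating yields a chain of dominances along the rotation sequence. -/
theorem Dominates.rotSeq {x y : B →₀ ℝ} (hx : x ∈ cs.roots) (hy : y ∈ cs.roots)
    (h : cs.Dominates x y) (n : ℕ) : cs.Dominates x (M.rotSeq x y n) := by
  suffices key : ∀ n, cs.Dominates (M.rotSeq x y n) (M.rotSeq x y (n + 1)) by
    induction n with
    | zero => rwa [M.rotSeq_zero]
    | succ n ih => exact ih.trans (key n)
  intro n
  induction n with
  | zero =>
    rw [M.rotSeq_zero, M.rotSeq_one]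
    exact h.neg_reflect hx hy
  | succ n ih =>
    rw [M.rotSeq_add_two_eq_neg_reflect (geomForm_self hx) (geomForm_self hy)]
    exact ih.neg_reflect (rotSeq_mem_roots hx hy n) (rotSeq_mem_roots hx hy _)

theorem exists_isNegativeRoot_geomRep_inv {x : B →₀ ℝ} (hx : x ∈ cs.roots) :
    ∃ w : W, cs.IsNegativeRoot (cs.geomRep w⁻¹ x) := by
  obtain ⟨u, i, rfl⟩ := hx
  refine ⟨u * cs.simple i, ?_⟩
  rw [mul_inv_rev, inv_simple, geomRep_mul, geomRep_inv_geomRep, geomRep_simple_apply,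
    M.reflect_self (M.geomForm_simpleRoot_self i), isNegativeRoot_neg]
  exact isPositiveRoot_simpleRoot i

/-- Choose `w` with `w⁻¹ x < 0`. Then `w⁻¹` makes the whole rotation sequence negative, so minus the
coordinate sums form a positive sequence with the rotation recurrence, which excludes `⟨x, y⟩ < 1`.
-/
theorem Dominates.one_le_geomForm {x y : B →₀ ℝ} (hx : x ∈ cs.roots) (hy : y ∈ cs.roots)
    (h : cs.Dominates x y) : 1 ≤ M.geomForm x y := by
  obtain ⟨w, hw⟩ := exists_isNegativeRoot_geomRep_inv hx
  apply one_le_of_pos_recurrence (g := fun n => -coordSum B (cs.geomRep w⁻¹ (M.rotSeq x y n)))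
  · intro n
    have := (h.rotSeq hx hy n w hw).coordSum_neg
    linarith
  · intro n
    simp only [M.rotSeq_add_two, map_sub, map_smul, smul_eq_mul]
    ring

/-- If `⟨x, y⟩ ≤ -1`, the dihedral group of `x`, `y` produces infinitely many roots that are
nonnegative combinations of the two; all would be inversions of `w`. -/
theorem neg_one_lt_geomForm {w : W} {x y : B →₀ ℝ} (hx : x ∈ cs.inversionSet w)
    (hy : y ∈ cs.inversionSet w) : -1 < M.geomForm x y := by
  by_contra! hc
  have hc' : 1 ≤ M.geomForm (-x) y := by
    rw [map_neg, LinearMap.neg_apply]; linarith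
  have e : ∀ n, M.rotSeq (-x) y n = sinRatio (M.geomForm (-x) y) (n + 1) • y +
      sinRatio (M.geomForm (-x) y) n • x := fun n => by
    rw [CoxeterMatrix.rotSeq]; module
  have hmem : ∀ n, M.rotSeq (-x) y n ∈ cs.inversionSet w := fun n => by
    have hr := rotSeq_mem_roots (neg_mem_roots hx.1.1) hy.1.1 n
    rw [e] at hr ⊢
    exact mem_inversionSet_of_nonneg_comb (sinRatio_add_one_le hc' _).1
      (sinRatio_add_one_le hc' _).1 hy hx hr
  have hne : -x ≠ y := by
    rintro rfl
    exact hx.1.not_isNegativeRoot (isPositiveRoot_neg.1 hy.1)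
  exact Set.infinite_of_injective_forall_mem
    (M.injective_rotSeq hc' (geomForm_self hy.1.1) hne) hmem (cs.finite_inversionSet w)

/-- Witnesses `w`, `u` against both dominances make `-w⁻¹ x` and `w⁻¹ y` inversions of `w⁻¹ u` with
product at most `-1`. -/
theorem dominates_or_dominates {x y : B →₀ ℝ} (hx : x ∈ cs.roots) (hy : y ∈ cs.roots)
    (h : 1 ≤ M.geomForm x y) : cs.Dominates x y ∨ cs.Dominates y x := by
  by_contra! hc
  simp only [Dominates, not_forall] at hc
  obtain ⟨⟨w, hwx, hwy⟩, ⟨u, huy, hux⟩⟩ := hc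
  rw [not_isNegativeRoot_iff (geomRep_mem_roots _ hy)] at hwy
  rw [not_isNegativeRoot_iff (geomRep_mem_roots _ hx)] at hux
  have h1 : -cs.geomRep w⁻¹ x ∈ cs.inversionSet (w⁻¹ * u) := by
    refine ⟨isPositiveRoot_neg.2 hwx, ?_⟩
    rw [map_neg, ← geomRep_mul, isNegativeRoot_neg]
    simpa [mul_assoc] using hux
  have h2 : cs.geomRep w⁻¹ y ∈ cs.inversionSet (w⁻¹ * u) := by
    refine ⟨hwy, ?_⟩
    rw [← geomRep_mul]
    simpa [mul_assoc] using huy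
  have := neg_one_lt_geomForm h1 h2
  rw [map_neg, LinearMap.neg_apply, geomForm_geomRep] at this
  linarith

theorem isNegativeRoot_of_nonneg_comb {x y : B →₀ ℝ} {a b : ℝ} (ha : 0 ≤ a) (hb : 0 ≤ b)
    (hx : x ≤ 0) (hy : y ≤ 0) (h : a • x + b • y ∈ cs.roots) :
    cs.IsNegativeRoot (a • x + b • y) :=
  ⟨h, add_nonpos (smul_nonpos_of_nonneg_of_nonpos ha hx)
    (smul_nonpos_of_nonneg_of_nonpos hb hy)⟩

/-- Split by the sign of `w⁻¹ γ`. If it is positive, `w⁻¹ s_γ α < 0` forces `w⁻¹ α < 0`. If it is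
negative, dominance of `s_γ δ` by `s_γ α` gives `w⁻¹ s_γ δ < 0`, hence `w⁻¹ δ < 0`. -/
theorem Dominates.reflect_left {α γ δ : B →₀ ℝ} (hα : α ∈ cs.roots) (hγ : γ ∈ cs.roots)
    (hδ : δ ∈ cs.roots) (h : cs.Dominates α δ) (hγδ : 0 ≤ M.geomForm γ δ)
    (hαγ : M.geomForm γ α ≤ 0) : cs.Dominates (M.reflect γ α) δ := fun w hw => by
  rcases isPositiveRoot_or_isNegativeRoot (geomRep_mem_roots w⁻¹ hγ) with hp | hn
  · apply h
    have hr := geomRep_mem_roots w⁻¹ hα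
    have e : cs.geomRep w⁻¹ α = (1 : ℝ) • cs.geomRep w⁻¹ (M.reflect γ α) +
        (-(2 * M.geomForm γ α)) • -cs.geomRep w⁻¹ γ := by
      simp only [CoxeterMatrix.reflect, map_sub, map_smul]; module
    rw [e] at hr ⊢
    exact isNegativeRoot_of_nonneg_comb zero_le_one (by linarith) hw.2
      (isNegativeRoot_neg.2 hp).2 hr
  · have h1 := h.reflect hγ w hw
    have hr := geomRep_mem_roots w⁻¹ hδ
    have e : cs.geomRep w⁻¹ δ = (1 : ℝ) • cs.geomRep w⁻¹ (M.reflect γ δ) +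
        (2 * M.geomForm γ δ) • cs.geomRep w⁻¹ γ := by
      simp only [CoxeterMatrix.reflect, map_sub, map_smul]; module
    rw [e] at hr ⊢
    exact isNegativeRoot_of_nonneg_comb zero_le_one (by linarith) h1.2 hn.2 hr

/-! ### Counting dominated roots. -/

variable (cs) in
/-- The positive roots strictly dominated by `β`. -/
def dominatedRoots (β : B →₀ ℝ) : Set (B →₀ ℝ) :=
  {α | cs.IsPositiveRoot α ∧ α ≠ β ∧ cs.Dominates β α}

theorem mem_elementaryRoots_iff {m : ℕ} {β : B →₀ ℝ} :
    β ∈ cs.elementaryRoots m ↔ cs.IsPositiveRoot β ∧ (cs.dominatedRoots β).encard ≤ m := Iff.rfl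

theorem insert_dominatedRoots {β : B →₀ ℝ} (h : cs.IsPositiveRoot β) :
    insert β (cs.dominatedRoots β) = {α | cs.IsPositiveRoot α ∧ cs.Dominates β α} := by
  ext α
  simp only [dominatedRoots, Set.mem_insert_iff, Set.mem_ofPred_eq]
  constructor
  · rintro (rfl | ⟨h1, -, h2⟩)
    · exact ⟨h, .refl α⟩
    · exact ⟨h1, h2⟩
  · intro h1
    by_cases he : α = β
    · exact Or.inl he
    · exact Or.inr ⟨h1.1, he, h1.2⟩

theorem encard_dominatedRoots_add_one {β : B →₀ ℝ} (h : cs.IsPositiveRoot β) :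
    (cs.dominatedRoots β).encard + 1 = {α | cs.IsPositiveRoot α ∧ cs.Dominates β α}.encard := by
  rw [← insert_dominatedRoots h, Set.encard_insert_of_notMem]
  exact fun hm => hm.2.1 rfl

theorem encard_dominatedRoots_le_iff {α β : B →₀ ℝ} (hα : cs.IsPositiveRoot α)
    (hβ : cs.IsPositiveRoot β) :
    (cs.dominatedRoots α).encard ≤ (cs.dominatedRoots β).encard ↔
      {δ | cs.IsPositiveRoot δ ∧ cs.Dominates α δ}.encard ≤
        {δ | cs.IsPositiveRoot δ ∧ cs.Dominates β δ}.encard := by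
  rw [← encard_dominatedRoots_add_one hα, ← encard_dominatedRoots_add_one hβ]
  exact (ENat.add_le_add_iff_right ENat.one_ne_top).symm

theorem Dominates.encard_dominatedRoots_le {α β : B →₀ ℝ} (hα : cs.IsPositiveRoot α)
    (hβ : cs.IsPositiveRoot β) (h : cs.Dominates β α) :
    (cs.dominatedRoots α).encard ≤ (cs.dominatedRoots β).encard := by
  rw [encard_dominatedRoots_le_iff hα hβ]
  exact Set.encard_le_encard fun δ hδ => ⟨hδ.1, h.trans hδ.2⟩

theorem isPositiveRoot_reflect {α γ : B →₀ ℝ} (hα : cs.IsPositiveRoot α)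
    (hγ : cs.IsPositiveRoot γ) (h : M.geomForm γ α ≤ 0) : cs.IsPositiveRoot (M.reflect γ α) := by
  have hr := reflect_mem_roots hγ.1 hα.1
  have e : M.reflect γ α = (1 : ℝ) • α + (-(2 * M.geomForm γ α)) • γ := by
    rw [CoxeterMatrix.reflect]; module
  rw [e] at hr ⊢
  exact isPositiveRoot_of_nonneg_comb zero_le_one (by linarith) hα.2 hγ.2 hr

/-- Reflection by `γ` carries the roots dominated by `α` to roots dominated by `s_γ α`, but may
spoil positivity. So apply it only to those `δ` with `⟨γ, δ⟩ < 0` whose image is not itself a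
positive root dominated by `α`; the other `δ` are dominated by `s_γ α` already. The second condition
makes the map injective. -/
theorem encard_dominatedRoots_le_reflect {α γ : B →₀ ℝ} (hα : cs.IsPositiveRoot α)
    (hγ : cs.IsPositiveRoot γ) (h : M.geomForm γ α ≤ 0) :
    (cs.dominatedRoots α).encard ≤ (cs.dominatedRoots (M.reflect γ α)).encard := by
  classical
  have hγγ := geomForm_self hγ.1
  rw [encard_dominatedRoots_le_iff hα (isPositiveRoot_reflect hα hγ h)]
  let f : (B →₀ ℝ) → (B →₀ ℝ) := fun δ =>
    if 0 ≤ M.geomForm γ δ ∨ cs.IsPositiveRoot (M.reflect γ δ) ∧ cs.Dominates α (M.reflect γ δ)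
    then δ else M.reflect γ δ
  refine Set.encard_le_encard_of_injOn (f := f) ?_ ?_
  · intro δ hδ
    simp only [f]
    split_ifs with hc
    · refine ⟨hδ.1, ?_⟩
      rcases hc with hc | hc
      · exact hδ.2.reflect_left hα.1 hγ.1 hδ.1.1 hc h
      · have := hc.2.reflect hγ.1
        rwa [M.reflect_reflect hγγ] at this
    · push Not at hc
      exact ⟨isPositiveRoot_reflect hδ.1 hγ hc.1.le, hδ.2.reflect hγ.1⟩
  · intro δ hδ δ' hδ' he
    simp only [f] at he
    split_ifs at he with h1 h2 h2
    · exact he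
    · exact absurd (Or.inr ⟨he ▸ hδ.1, he ▸ hδ.2⟩) h2
    · exact absurd (Or.inr ⟨he ▸ hδ'.1, he ▸ hδ'.2⟩) h1
    · rw [← M.reflect_reflect hγγ δ, he, M.reflect_reflect hγγ]

end CoxeterSystem

/-! ### Trigonometry of multiples, and circles of unit vectors. -/

/-- Multiples of an acute angle `ψ` which is not of the form `π / n` come close to `π`. -/
theorem exists_eq_pi_div_of_lt_sin {ψ : ℝ} (h0 : 0 < ψ) (h1 : ψ < Real.pi / 2)
    (h : ∀ j : ℕ, Real.sin (j * ψ) ≠ 0 → Real.sin ψ < √2 * |Real.sin (j * ψ)|) :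
    ∃ n : ℕ, 3 ≤ n ∧ ψ = Real.pi / n := by
  have hpi := Real.pi_pos
  set N := ⌈Real.pi / ψ⌉₊ with hN
  have hN0 : 0 < N := Nat.ceil_pos.2 (by positivity)
  have hle : Real.pi ≤ N * ψ := (div_le_iff₀ h0).1 (Nat.le_ceil _)
  have hlt : ((N : ℝ) - 1) * ψ < Real.pi := by
    rw [← lt_div_iff₀ h0]
    linarith [Nat.ceil_lt_add_one (a := Real.pi / ψ) (by positivity)]
  rcases hle.eq_or_lt with he | hl
  · refine ⟨N, ?_, ?_⟩
    · by_contra! hc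
      have : (N : ℝ) ≤ 2 := by exact_mod_cast Nat.le_of_lt_succ hc
      nlinarith
    · have : (N : ℝ) ≠ 0 := by positivity
      rw [he]; field_simp
  exfalso
  -- Now `π` lies strictly between `jψ` and `(j+1)ψ`. The two sines have absolute values `sin ε` and
  -- `sin (ψ - ε)` with sum at most `2 sin (ψ/2)`, so both can exceed `sin ψ / √2` only if `cos
  -- (ψ/2) < √2/2`.
  obtain ⟨j, hj⟩ := Nat.exists_eq_succ_of_ne_zero hN0.ne'
  rw [hj] at hl hlt
  push_cast at hl hlt
  set ε := Real.pi - j * ψ with hε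
  have hε0 : 0 < ε := by linarith
  have hε1 : ε < ψ := by linarith
  have e1 : Real.sin (j * ψ) = Real.sin ε := by rw [hε, Real.sin_pi_sub]
  have e2 : Real.sin ((j + 1 : ℕ) * ψ) = -Real.sin (ψ - ε) := by
    rw [← Real.sin_add_pi]; congr 1; push_cast; rw [hε]; ring
  have s1 : 0 < Real.sin ε := Real.sin_pos_of_pos_of_lt_pi hε0 (by linarith)
  have s2 : 0 < Real.sin (ψ - ε) := Real.sin_pos_of_pos_of_lt_pi (by linarith) (by linarith)
  have g1 := h j (by rw [e1]; exact s1.ne')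
  have g2 := h (j + 1) (by rw [e2]; exact (neg_neg_of_pos s2).ne)
  rw [e1, abs_of_pos s1] at g1
  rw [e2, abs_neg, abs_of_pos s2] at g2
  have hsum : Real.sin ε + Real.sin (ψ - ε) =
      2 * Real.sin (ψ / 2) * Real.cos (ψ / 2 - ε) := by
    have a1 : ε = ψ / 2 - (ψ / 2 - ε) := by ring
    have a2 : ψ - ε = ψ / 2 + (ψ / 2 - ε) := by ring
    rw [a2]
    conv_lhs => rw [a1]
    rw [Real.sin_sub, Real.sin_add]
    have : ψ / 2 - (ψ / 2 - (ψ / 2 - ε)) = ψ / 2 - ε := by ring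
    rw [this]
    ring
  have hdbl : Real.sin ψ = 2 * Real.sin (ψ / 2) * Real.cos (ψ / 2) := by
    rw [← Real.sin_two_mul]; congr 1; ring
  have hs : 0 < Real.sin (ψ / 2) := Real.sin_pos_of_pos_of_lt_pi (by linarith) (by linarith)
  have hc : √2 / 2 < Real.cos (ψ / 2) := by
    rw [← Real.cos_pi_div_four]
    exact Real.cos_lt_cos_of_nonneg_of_le_pi_div_two (by linarith) (by linarith) (by linarith)
  have h2 : (0 : ℝ) < √2 := by positivity
  have hc1 := Real.cos_le_one (ψ / 2 - ε)
  have k1 : 2 * Real.sin ψ < √2 * (2 * Real.sin (ψ / 2) * Real.cos (ψ / 2 - ε)) := by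
    rw [← hsum]; linarith
  have k2 : √2 * (2 * Real.sin (ψ / 2) * Real.cos (ψ / 2 - ε)) ≤ √2 * (2 * Real.sin (ψ / 2)) := by
    apply mul_le_mul_of_nonneg_left _ h2.le
    nlinarith
  rw [hdbl] at k1
  nlinarith

/-- The odd multiple `(2i+1)(π/2 - χ)` differs from `iπ` by `ω = π/2 - χ - 2iχ`. These decrease in
steps of `2χ`, so one of them lies in `(0, 2χ]`. -/
theorem exists_abs_sin_mul_le {χ : ℝ} (h0 : 0 < χ) (h1 : χ ≤ Real.pi / 4) :
    ∃ j : ℕ, Real.sin ((j + 1 : ℕ) * (Real.pi / 2 - χ)) ≠ 0 ∧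
      |Real.sin ((j + 1 : ℕ) * (Real.pi / 2 - χ))| ≤ Real.sin (2 * χ) := by
  have hpi := Real.pi_pos
  set N := ⌈(Real.pi / 2 - χ) / (2 * χ)⌉₊ with hN
  have hq : 0 < (Real.pi / 2 - χ) / (2 * χ) := div_pos (by linarith) (by linarith)
  have hN0 : 0 < N := Nat.ceil_pos.2 hq
  have hle : Real.pi / 2 - χ ≤ N * (2 * χ) := (div_le_iff₀ (by linarith)).1 (Nat.le_ceil _)
  have hlt : ((N : ℝ) - 1) * (2 * χ) < Real.pi / 2 - χ := by
    rw [← lt_div_iff₀ (by linarith)]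
    linarith [Nat.ceil_lt_add_one (a := (Real.pi / 2 - χ) / (2 * χ)) hq.le]
  obtain ⟨i, hi⟩ := Nat.exists_eq_succ_of_ne_zero hN0.ne'
  rw [hi] at hle hlt
  push_cast at hle hlt
  set ω := Real.pi / 2 - χ - i * (2 * χ) with hω
  have hω0 : 0 < ω := by linarith
  have hω1 : ω ≤ 2 * χ := by linarith
  have e : |Real.sin ((2 * i + 1 : ℕ) * (Real.pi / 2 - χ))| = Real.sin ω := by
    have : ((2 * i + 1 : ℕ) : ℝ) * (Real.pi / 2 - χ) = ω + i * Real.pi := by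
      push_cast; rw [hω]; ring
    rw [this, Real.sin_add_nat_mul_pi, abs_mul, abs_pow, abs_neg, abs_one, one_pow, one_mul,
      abs_of_pos]
    exact Real.sin_pos_of_pos_of_lt_pi hω0 (by linarith)
  refine ⟨2 * i, ?_, ?_⟩
  · rw [← abs_pos, e]
    exact Real.sin_pos_of_pos_of_lt_pi hω0 (by linarith)
  · rw [e]
    exact Real.sin_le_sin_of_le_of_le_pi_div_two (by linarith) (by linarith) hω1

namespace CoxeterMatrix

variable {B : Type*} (M : CoxeterMatrix B)

/-- Two vectors which are orthonormal for the geometric form. -/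
structure IsOrthonormalPair (e₁ e₂ : B →₀ ℝ) : Prop where
  fst : M.geomForm e₁ e₁ = 1
  snd : M.geomForm e₂ e₂ = 1
  fst_snd : M.geomForm e₁ e₂ = 0

/-- The point at angle `t` of the unit circle with axes `e₁` and `e₂`. -/
noncomputable def circlePoint (e₁ e₂ : B →₀ ℝ) (t : ℝ) : B →₀ ℝ :=
  Real.cos t • e₁ + Real.sin t • e₂

/-- The second axis of the circle through `x` and `y`, if `x` is the first axis and `φ` is
the angle between `x` and `y`. -/
noncomputable def secondAxis (x y : B →₀ ℝ) (φ : ℝ) : B →₀ ℝ :=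
  (Real.sin φ)⁻¹ • (y - Real.cos φ • x)

theorem circlePoint_zero (e₁ e₂ : B →₀ ℝ) : circlePoint e₁ e₂ 0 = e₁ := by simp [circlePoint]

theorem circlePoint_secondAxis {x y : B →₀ ℝ} {φ : ℝ} (h : Real.sin φ ≠ 0) :
    circlePoint x (secondAxis x y φ) φ = y := by
  rw [circlePoint, secondAxis, smul_smul, mul_inv_cancel₀ h]
  module

theorem circlePoint_add_pi (e₁ e₂ : B →₀ ℝ) (t : ℝ) :
    circlePoint e₁ e₂ (t + Real.pi) = -circlePoint e₁ e₂ t := by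
  simp only [circlePoint, Real.cos_add_pi, Real.sin_add_pi]
  module

variable {M}

theorem isOrthonormalPair_secondAxis {x y : B →₀ ℝ} {φ : ℝ} (hx : M.geomForm x x = 1)
    (hy : M.geomForm y y = 1) (hxy : M.geomForm x y = Real.cos φ) (h : Real.sin φ ≠ 0) :
    M.IsOrthonormalPair x (secondAxis x y φ) := by
  refine ⟨hx, ?_, ?_⟩
  · simp only [secondAxis, map_smul, map_sub, LinearMap.smul_apply, LinearMap.sub_apply, hx, hy,
      M.geomForm_comm y x, hxy, smul_eq_mul]
    field_simp
    linear_combination -Real.sin_sq_add_cos_sq φ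
  · simp [secondAxis, hx, hxy]

theorem geomForm_circlePoint_right (ξ e₁ e₂ : B →₀ ℝ) (t : ℝ) : M.geomForm ξ (circlePoint e₁ e₂ t) =
    Real.cos t * M.geomForm ξ e₁ + Real.sin t * M.geomForm ξ e₂ := by
  simp [circlePoint]

namespace IsOrthonormalPair

variable {e₁ e₂ : B →₀ ℝ}

theorem geomForm_circlePoint (h : M.IsOrthonormalPair e₁ e₂) (a b : ℝ) :
    M.geomForm (circlePoint e₁ e₂ a) (circlePoint e₁ e₂ b) = Real.cos (a - b) := by
  simp only [circlePoint, map_add, map_smul, LinearMap.add_apply, LinearMap.smul_apply, h.fst,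
    h.snd, h.fst_snd, M.geomForm_comm e₂ e₁, smul_eq_mul, Real.cos_sub]
  ring

theorem reflect_circlePoint (h : M.IsOrthonormalPair e₁ e₂) (a b : ℝ) :
    M.reflect (circlePoint e₁ e₂ a) (circlePoint e₁ e₂ b) = -circlePoint e₁ e₂ (2 * a - b) := by
  obtain ⟨d, rfl⟩ : ∃ d, b = a - d := ⟨a - b, by ring⟩
  have e1 : a - (a - d) = d := by ring
  have e2 : 2 * a - (a - d) = a + d := by ring
  rw [reflect, h.geomForm_circlePoint, e1, e2]
  simp only [circlePoint, Real.cos_add, Real.sin_add, Real.cos_sub, Real.sin_sub]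
  module

end IsOrthonormalPair

/-- All products of simple roots are at most 1, whatever the Coxeter matrix. For a positive root
this bounds the coordinate sum below by 1. -/
theorem geomForm_self_le {β : B →₀ ℝ} (h : 0 ≤ β) : M.geomForm β β ≤ (coordSum B β) ^ 2 := by
  have hβ : β = ∑ i ∈ β.support, β i • M.simpleRoot i := by
    conv_lhs => rw [← Finsupp.sum_single β]
    simp [Finsupp.sum, simpleRoot]
  have hc : ∀ i, coordSum B (M.simpleRoot i) = 1 := fun i => by simp [coordSum, simpleRoot]
  have e1 : coordSum B β = ∑ i ∈ β.support, β i := by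
    conv_lhs => rw [hβ]
    simp [hc]
  have e2 : M.geomForm β β = ∑ i ∈ β.support, β i *
      ∑ j ∈ β.support, β j * M.geomForm (M.simpleRoot i) (M.simpleRoot j) := by
    conv_lhs =>
      enter [2]
      rw [hβ]
    conv_lhs =>
      enter [1]
      rw [hβ]
    simp only [map_sum, LinearMap.sum_apply, map_smul, LinearMap.smul_apply, smul_eq_mul]
    refine Finset.sum_congr rfl fun i _ => congrArg _ (Finset.sum_congr rfl fun j _ => ?_)
    rw [M.geomForm_comm]
  rw [e1, e2, sq, Finset.sum_mul]
  refine Finset.sum_le_sum fun i _ => mul_le_mul_of_nonneg_left ?_ (h i)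
  refine Finset.sum_le_sum fun j _ => ?_
  rw [geomForm_simpleRoot]
  have h1 : 0 ≤ β j := h j
  have h2 := Real.neg_one_le_cos (Real.pi / (M i j : ℝ))
  nlinarith

end CoxeterMatrix

/-! ### Functionals vanishing on a dihedral plane, and almost minimal heights over it. -/

namespace CoxeterSystem

open CoxeterMatrix

variable {B W : Type*} [Group W] {M : CoxeterMatrix B} {cs : CoxeterSystem M W}

theorem IsPositiveRoot.one_le_coordSum {β : B →₀ ℝ} (h : cs.IsPositiveRoot β) :
    1 ≤ coordSum B β := by
  have h1 := M.geomForm_self_le (β := β) h.2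
  rw [geomForm_self h.1] at h1
  nlinarith [h.coordSum_pos]

/-- A linear functional `f` such that `f β ≥ 1` for all but finitely many positive roots `β`
excludes that `x > 0` dominates `y` in the direction of growing values of `f`. -/
theorem not_dominates_of_functional_le {f : (B →₀ ℝ) →ₗ[ℝ] ℝ}
    (hf : {β | cs.IsPositiveRoot β ∧ f β < 1}.Finite) {x y : B →₀ ℝ} (hx : cs.IsPositiveRoot x)
    (hy : y ∈ cs.roots) (hne : x ≠ y) (h0 : 0 ≤ f y) (hxy : f x ≤ f y) : ¬ cs.Dominates x y := by
  intro hd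
  have hc := hd.one_le_geomForm hx.1 hy
  have hinj := M.injective_rotSeq hc (geomForm_self hy) hne
  have hval : ∀ n, 0 ≤ f (M.rotSeq x y n) := fun n => by
    obtain ⟨h1, h2⟩ := sinRatio_add_one_le hc n
    simp only [CoxeterMatrix.rotSeq, map_sub, map_smul, smul_eq_mul]
    nlinarith
  obtain ⟨w, hw⟩ := exists_isNegativeRoot_geomRep_inv hx.1
  -- Each term of the rotation sequence is positive, hence an inversion of `w`, or the negative of
  -- one of the finitely many positive roots with `f < 1`. But the sequence is injective.
  have hsub : Set.range (M.rotSeq x y) ⊆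
      cs.inversionSet w ∪ (Neg.neg '' {β | cs.IsPositiveRoot β ∧ f β < 1}) := by
    rintro _ ⟨n, rfl⟩
    have hr := rotSeq_mem_roots hx.1 hy n
    rcases isPositiveRoot_or_isNegativeRoot hr with hp | hn
    · exact Or.inl ⟨hp, hd.rotSeq hx.1 hy n w hw⟩
    · refine Or.inr ⟨-M.rotSeq x y n, ⟨isPositiveRoot_neg.2 hn, ?_⟩, neg_neg _⟩
      rw [map_neg]
      linarith [hval n]
  exact Set.infinite_range_of_injective hinj
    (((cs.finite_inversionSet w).union (hf.image _)).subset hsub)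

/-- For a dihedral reflection subgroup with rotation of finite order there is a functional which
vanishes on its plane and is at least `1` on all but finitely many positive roots. -/
theorem exists_functional {e₁ e₂ : B →₀ ℝ} (h : M.IsOrthonormalPair e₁ e₂) {m : ℕ} (hm : 2 ≤ m)
    (h0 : circlePoint e₁ e₂ 0 ∈ cs.roots)
    (h1 : circlePoint e₁ e₂ (Real.pi / m) ∈ cs.roots) :
    ∃ f : (B →₀ ℝ) →ₗ[ℝ] ℝ, {β | cs.IsPositiveRoot β ∧ f β < 1}.Finite ∧
      ∀ t, f (circlePoint e₁ e₂ t) = 0 := by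
  obtain ⟨r₀, hr₀⟩ := exists_isReflectionOf h0
  obtain ⟨r₁, hr₁⟩ := exists_isReflectionOf h1
  set A := Real.pi / m with hA
  set g := r₁ * r₀ with hg
  have hrot : ∀ t, cs.geomRep g (circlePoint e₁ e₂ t) = circlePoint e₁ e₂ (t + 2 * A) := fun t => by
    rw [hg, geomRep_mul, hr₀.geomRep_apply, hr₁.geomRep_apply, h.reflect_circlePoint, M.reflect_neg,
      h.reflect_circlePoint, neg_neg]
    congr 1
    ring
  have hpow : ∀ (j : ℕ) (t), cs.geomRep (g ^ j) (circlePoint e₁ e₂ t) =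
      circlePoint e₁ e₂ (t + j * (2 * A)) := fun j t => by
    induction j generalizing t with
    | zero => simp
    | succ j ih =>
      rw [pow_succ, geomRep_mul, hrot, ih]
      congr 1
      push_cast
      ring
  -- The coordinate sum added up over `m` rotations is invariant under rotation of the plane. If no
  -- `g ^ j` makes the positive root `β` negative, all summands are positive and that of `j = 0` is
  -- at least 1.
  let f : (B →₀ ℝ) →ₗ[ℝ] ℝ :=
    ∑ j ∈ Finset.range m, coordSum B ∘ₗ (cs.geomRep (g ^ j)).toLinearMap
  have hfapp : ∀ v, f v = ∑ j ∈ Finset.range m, coordSum B (cs.geomRep (g ^ j) v) := fun v => by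
    simp [f]
  have hm0 : (m : ℝ) ≠ 0 := by positivity
  have hmA : m * (2 * A) = 2 * Real.pi := by rw [hA]; field_simp
  have hshift : ∀ t, f (circlePoint e₁ e₂ (t + 2 * A)) = f (circlePoint e₁ e₂ t) := fun t => by
    have hper : circlePoint e₁ e₂ (t + m * (2 * A)) = circlePoint e₁ e₂ t := by
      simp [circlePoint, hmA]
    have e : ∀ j : ℕ, t + 2 * A + j * (2 * A) = t + (j + 1 : ℕ) * (2 * A) := fun j => by
      push_cast; ring
    simp only [hfapp, hpow, e]
    have s1 := Finset.sum_range_succ (fun j : ℕ => coordSum B (circlePoint e₁ e₂ (t + j * (2 * A)))) m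
    have s2 := Finset.sum_range_succ' (fun j : ℕ => coordSum B (circlePoint e₁ e₂ (t + j * (2 * A)))) m
    simp only [hper] at s1
    simp only [Nat.cast_zero, zero_mul, add_zero] at s2
    linarith
  refine ⟨f, ?_, fun t => ?_⟩
  · refine Set.Finite.subset (s := ⋃ j ∈ Finset.range m, cs.inversionSet (g ^ j)⁻¹)
      (Set.Finite.biUnion (Finset.finite_toSet _) fun j _ => cs.finite_inversionSet _) ?_
    rintro β ⟨hβ, hlt⟩
    by_contra hc
    simp only [Set.mem_iUnion, not_exists, mem_inversionSet_iff, inv_inv, not_and] at hc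
    have hpos : ∀ j ∈ Finset.range m, cs.IsPositiveRoot (cs.geomRep (g ^ j) β) := fun j hj => by
      rw [← not_isNegativeRoot_iff (geomRep_mem_roots _ hβ.1)]
      exact hc j hj hβ
    have h2 : coordSum B (cs.geomRep (g ^ 0) β) ≤ f β := by
      rw [hfapp]
      exact Finset.single_le_sum (f := fun j => coordSum B (cs.geomRep (g ^ j) β))
        (fun j hj => (hpos j hj).coordSum_pos.le) (Finset.mem_range.2 (by omega))
    rw [pow_zero, geomRep_one] at h2
    linarith [hβ.one_le_coordSum]
  · have hs : 0 < Real.sin A := by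
      apply Real.sin_pos_of_pos_of_lt_pi
      · have := Real.pi_pos; positivity
      · exact div_lt_self Real.pi_pos (by exact_mod_cast hm)
    -- The point at `t` is a multiple of the difference of the points at `t - π/2 ± A`, on which the
    -- invariant `f` agrees.
    have h3 := hshift (t - Real.pi / 2 - A)
    have e : circlePoint e₁ e₂ (t - Real.pi / 2 - A + 2 * A) -
        circlePoint e₁ e₂ (t - Real.pi / 2 - A) = (2 * Real.sin A) • circlePoint e₁ e₂ t := by
      have a1 : t - Real.pi / 2 - A + 2 * A = (t + A) - Real.pi / 2 := by ring
      have a2 : t - Real.pi / 2 - A = (t - A) - Real.pi / 2 := by ring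
      rw [a1, a2]
      simp only [circlePoint, Real.cos_sub_pi_div_two, Real.sin_sub_pi_div_two]
      simp only [Real.sin_add, Real.cos_add, Real.sin_sub, Real.cos_sub]
      module
    have h4 := congrArg f e
    rw [map_sub, h3, sub_self, map_smul, smul_eq_mul] at h4
    exact (mul_eq_zero.1 h4.symm).resolve_left (by positivity)

variable (cs) in
/-- `t` is the coefficient at `δ` of a root in the space spanned by `e₁`, `e₂` and `δ`. -/
def IsRootCoeff (e₁ e₂ δ : B →₀ ℝ) (t : ℝ) : Prop := ∃ a b : ℝ, a • e₁ + b • e₂ + t • δ ∈ cs.roots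

/-- Since `f` vanishes on `e₁` and `e₂`, it measures the coefficient of `δ`, and nonzero values of
`f` on roots are bounded away from 0. So the nonzero coefficients have a positive infimum; the slack
`1.05` avoids having to attain it. -/
theorem exists_almost_minimal_isRootCoeff {f : (B →₀ ℝ) →ₗ[ℝ] ℝ}
    (hf : {β | cs.IsPositiveRoot β ∧ f β < 1}.Finite) {e₁ e₂ δ : B →₀ ℝ} (h₁ : f e₁ = 0)
    (h₂ : f e₂ = 0) (hδ : δ ∈ cs.roots) (h0 : f δ ≠ 0) :
    ∃ τ, 0 < τ ∧ cs.IsRootCoeff e₁ e₂ δ τ ∧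
      ∀ t, t ≠ 0 → cs.IsRootCoeff e₁ e₂ δ t → τ ≤ 1.05 * |t| := by
  have hval : ∀ a b t : ℝ, f (a • e₁ + b • e₂ + t • δ) = t * f δ := fun a b t => by
    simp [h₁, h₂]
  have hfin : ((fun β => |f β|) '' {β | cs.IsPositiveRoot β ∧ f β < 1} \ {0}).Finite :=
    (hf.image _).subset Set.sdiff_subset
  obtain ⟨ε, hε, hεle⟩ : ∃ ε : ℝ, 0 < ε ∧ ∀ β ∈ cs.roots, f β ≠ 0 → ε ≤ |f β| := by
    obtain ⟨ε', hε', hle'⟩ : ∃ ε : ℝ, 0 < ε ∧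
        ∀ r ∈ ((fun β => |f β|) '' {β | cs.IsPositiveRoot β ∧ f β < 1} \ {0}), ε ≤ r := by
      rcases Set.eq_empty_or_nonempty
        ((fun β => |f β|) '' {β | cs.IsPositiveRoot β ∧ f β < 1} \ {0}) with he | hne
      · rw [he]; exact ⟨1, one_pos, by simp⟩
      · obtain ⟨r, ⟨⟨β, -, rfl⟩, hr0⟩, hmin⟩ := Set.exists_min_image _ id hfin hne
        exact ⟨|f β|, lt_of_le_of_ne (abs_nonneg _) (Ne.symm hr0), hmin⟩
    have key : ∀ β, cs.IsPositiveRoot β → f β ≠ 0 → min ε' 1 ≤ |f β| := fun β hβ hne => by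
      by_cases hlt : f β < 1
      · exact (min_le_left _ _).trans (hle' _ ⟨⟨β, ⟨hβ, hlt⟩, rfl⟩, abs_ne_zero.2 hne⟩)
      · exact (min_le_right _ _).trans ((not_lt.1 hlt).trans (le_abs_self _))
    refine ⟨min ε' 1, lt_min hε' one_pos, fun β hβ hne => ?_⟩
    rcases isPositiveRoot_or_isNegativeRoot hβ with hp | hn
    · exact key β hp hne
    · have := key (-β) (isPositiveRoot_neg.2 hn) (by simpa using hne)
      rwa [map_neg, abs_neg] at this
  let S : Set ℝ := {r | ∃ t, t ≠ 0 ∧ cs.IsRootCoeff e₁ e₂ δ t ∧ r = |t|}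
  have hS1 : (1 : ℝ) ∈ S := ⟨1, one_ne_zero, ⟨0, 0, by simpa using hδ⟩, abs_one.symm⟩
  have hlow : ∀ r ∈ S, ε / |f δ| ≤ r := by
    rintro _ ⟨t, ht, ⟨a, b, hr⟩, rfl⟩
    rw [div_le_iff₀ (abs_pos.2 h0), ← abs_mul, ← hval a b t]
    exact hεle _ hr (by rw [hval]; exact mul_ne_zero ht h0)
  have hbdd : BddBelow S := ⟨_, hlow⟩
  have hinf : 0 < sInf S := (div_pos hε (abs_pos.2 h0)).trans_le (le_csInf ⟨1, hS1⟩ hlow)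
  obtain ⟨r, hr, hlt⟩ := exists_lt_of_csInf_lt ⟨1, hS1⟩ (b := 1.05 * sInf S) (by linarith)
  obtain ⟨t, ht, hcoef, rfl⟩ := hr
  have hle : ∀ t', t' ≠ 0 → cs.IsRootCoeff e₁ e₂ δ t' → |t| ≤ 1.05 * |t'| := fun t' ht' hc' => by
    have := csInf_le hbdd ⟨t', ht', hc', rfl⟩
    linarith
  refine ⟨|t|, abs_pos.2 ht, ?_, hle⟩
  rcases abs_choice t with he | he
  · rwa [he]
  · rw [he]
    obtain ⟨a, b, hr⟩ := hcoef
    refine ⟨-a, -b, ?_⟩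
    rw [← neg_mem_roots_iff]
    convert hr using 1
    module

/-- Rotating from `ν`, which has no `δ`-component, through `ξ` multiplies the coefficient of `ξ` by
the sine ratios for `⟨ν, ξ⟩`. -/
theorem IsRootCoeff.sinRatio {a b c d t : ℝ} {e₁ e₂ δ : B →₀ ℝ}
    (hξ : a • e₁ + b • e₂ + t • δ ∈ cs.roots) (hν : c • e₁ + d • e₂ ∈ cs.roots) (n : ℕ) :
    cs.IsRootCoeff e₁ e₂ δ (sinRatio (M.geomForm (c • e₁ + d • e₂) (a • e₁ + b • e₂ + t • δ))
      (n + 1) * t) := by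
  have h := rotSeq_mem_roots hν hξ n
  rw [CoxeterMatrix.rotSeq] at h
  set p := _root_.sinRatio (M.geomForm (c • e₁ + d • e₂) (a • e₁ + b • e₂ + t • δ)) (n + 1)
  set q := _root_.sinRatio (M.geomForm (c • e₁ + d • e₂) (a • e₁ + b • e₂ + t • δ)) n
  refine ⟨p * a - q * c, p * b - q * d, ?_⟩
  convert h using 1
  module

end CoxeterSystem

/-! ### Numerical estimates for the dihedral orders. -/

/-- The values of the form below `cos (π / 5)` which are admitted between a root of minimal
coefficient and the roots of a plane. -/
def IsGapValue (y : ℝ) : Prop := y = 1 / 2 ∨ y = √2 / 2 ∨ (1 + √5) / 4 ≤ y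

theorem lt_sqrt_five : 2.236 < √5 := Real.lt_sqrt_of_sq_lt (by norm_num)

theorem sqrt_five_lt : √5 < 2.2361 := (Real.sqrt_lt' (by norm_num)).2 (by norm_num)

theorem lt_sqrt_two : 1.414 < √2 := Real.lt_sqrt_of_sq_lt (by norm_num)

theorem sqrt_two_lt : √2 < 1.4143 := (Real.sqrt_lt' (by norm_num)).2 (by norm_num)

theorem IsGapValue.half_le {y : ℝ} (h : IsGapValue y) : 1 / 2 ≤ y := by
  rcases h with rfl | rfl | h
  · exact le_rfl
  · linarith [lt_sqrt_two]
  · linarith [lt_sqrt_five]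

theorem IsGapValue.eq_half_or {y : ℝ} (h : IsGapValue y) : y = 1 / 2 ∨ 1 / 2 ≤ y ^ 2 := by
  rcases h with rfl | rfl | h
  · exact Or.inl rfl
  · exact Or.inr (by rw [div_pow, Real.sq_sqrt zero_le_two]; norm_num)
  · exact Or.inr (by nlinarith [lt_sqrt_five])

theorem isGapValue_cos_pi_div {n : ℕ} (hn : 3 ≤ n) : IsGapValue (Real.cos (Real.pi / n)) := by
  have hpi := Real.pi_pos
  rcases Nat.lt_or_ge n 5 with h | h
  · obtain rfl | rfl : n = 3 ∨ n = 4 := by omega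
    · left; push_cast; exact Real.cos_pi_div_three
    · right; left; push_cast; exact Real.cos_pi_div_four
  · right; right
    rw [← Real.cos_pi_div_five]
    have h5 : (5 : ℝ) ≤ n := by exact_mod_cast h
    apply Real.cos_le_cos_of_nonneg_of_le_pi (by positivity)
    · linarith
    · gcongr

/-- With `s² = 0.195`, even `(1 + 1.05² tan²) s²` stays below `1/4`, which is what
`not_dihedral_seven` needs. -/
theorem sin_sq_lt_of_seven_le {m : ℕ} (hm : 7 ≤ m) : Real.sin (Real.pi / m) ^ 2 < 0.195 := by
  have hpi := Real.pi_pos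
  have h7 : (7 : ℝ) ≤ m := by exact_mod_cast hm
  have h1 : Real.sin (Real.pi / m) ≤ Real.sin (Real.pi / 7) := by
    have h3 : Real.pi / m ≤ Real.pi / 7 := by gcongr
    apply Real.sin_le_sin_of_le_of_le_pi_div_two
    · linarith [div_nonneg hpi.le (by linarith : (0 : ℝ) ≤ m)]
    · linarith
    · exact h3
  have h0 : 0 ≤ Real.sin (Real.pi / m) := by
    apply Real.sin_nonneg_of_nonneg_of_le_pi (by positivity)
    exact div_le_self hpi.le (by linarith)
  set x := Real.pi / 7 with hx
  have hxl : 0.4487 < x := by rw [hx]; linarith [Real.pi_gt_d4]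
  have hxu : x < 0.4488 := by rw [hx]; linarith [Real.pi_lt_d4]
  have hb := (abs_le.1 (Real.sin_bound (x := x) (by rw [abs_of_pos] <;> linarith))).2
  rw [abs_of_pos (by linarith)] at hb
  have h3 : 0.4487 ^ 3 ≤ x ^ 3 := by gcongr
  have h4 : x ^ 4 ≤ 0.4488 ^ 4 := by gcongr
  have h5 : Real.sin x < 0.4415 := by nlinarith
  nlinarith

/-- On the triangle `k ≥ 1`, `X ≥ 0`, `kc + Xs ≤ 1` the convex function `k² + X² - 1` is largest at
the vertex `(1/c, 0)`, where it equals `s²/c²`. -/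
theorem sq_add_sq_sub_one_mul_le {k X c s : ℝ} (hk : 1 ≤ k) (hX0 : 0 ≤ X) (hs0 : 0 < s)
    (hc0 : 0.7 ≤ c) (hsc : s ^ 2 + c ^ 2 = 1) (hb : k * c + X * s < 1) :
    (k ^ 2 + X ^ 2 - 1) * c ^ 2 ≤ s ^ 2 := by
  have hc : 0 < c := by linarith
  have hc1 : c < 1 := by nlinarith
  have e1 : X * s ≤ 1 - c := by nlinarith
  have e2 : X * c ^ 2 ≤ 2 * k * c * s := by
    have : X * c ^ 2 * s ≤ 2 * k * c * s * s := by
      have a1 : X * s * c ^ 2 ≤ (1 - c) * c ^ 2 := by gcongr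
      have a2 : (1 - c) * c ^ 2 ≤ 2 * c * s ^ 2 := by
        have e : s ^ 2 = (1 - c) * (1 + c) := by linarith
        have : 0 ≤ (1 - c) * c * (2 + c) := by
          apply mul_nonneg (mul_nonneg _ _) <;> linarith
        rw [e]
        linarith
      have a3 : 0 ≤ (k - 1) * (2 * c * s ^ 2) := mul_nonneg (by linarith) (by positivity)
      linarith
    exact le_of_mul_le_mul_right this hs0
  have e3 : (k * c + X * s) ^ 2 ≤ 1 := by
    have : 0 ≤ k * c + X * s := by positivity
    nlinarith
  have e4 : 0 ≤ X * (2 * k * c * s + X * s ^ 2 - X * c ^ 2) := by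
    apply mul_nonneg hX0
    have := mul_nonneg hX0 (sq_nonneg s)
    linarith
  have e5 : k ^ 2 * c ^ 2 + X ^ 2 * c ^ 2 ≤ 1 := by linarith
  linarith

/-- If `X > 0`, the left side of `hR` lies in `[1, 1.15]`. The admitted `u`, `v` give `1/2`, `1`, or
more than `1.3`; the value `1` forces `k² + X² = 1`, impossible as `k ≥ 1`. -/
theorem eq_zero_of_dihedral_four {k X τ u v : ℝ} (hk : 1 ≤ k) (hX : 0 ≤ X)
    (hb : k + X < √2)
    (hR : 1 + τ ^ 2 * (k ^ 2 + X ^ 2 - 1) = 2 * (u ^ 2 + v ^ 2 + 2 * u * v * (√2 / 2)))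
    (hτ0 : 0 < τ) (hu : u = 0 ∨ IsGapValue u) (hv : IsGapValue v)
    (ht : X ≠ 0 → τ ≤ 1.05 * (2 * X)) : X = 0 := by
  by_contra hx
  replace ht := ht hx
  have h2l := lt_sqrt_two
  have h2u := sqrt_two_lt
  have h2s : √2 ^ 2 = 2 := Real.sq_sqrt zero_le_two
  have hXpos : 0 < X := lt_of_le_of_ne hX (Ne.symm hx)
  have hv2 := hv.half_le
  set h := k ^ 2 + X ^ 2 - 1 with hh
  have hh0 : 0 ≤ h := by nlinarith
  have hh1 : h ≤ (1 - √2 * X) ^ 2 := by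
    have e1 : k ^ 2 ≤ (√2 - X) ^ 2 := by gcongr; linarith
    rw [hh]
    linear_combination e1 + (1 - X ^ 2) * h2s
  have hXl : √2 * X < 1 := by
    have : X < 0.4143 := by linarith
    nlinarith
  have hprod : X * (1 - √2 * X) ≤ 0.177 := by
    have e1 : √2 * (X * (1 - √2 * X)) ≤ 1 / 4 := by nlinarith [sq_nonneg (√2 * X - 1 / 2)]
    have e2 : 0 ≤ X * (1 - √2 * X) := mul_nonneg hX (by linarith)
    nlinarith
  have hH : τ ^ 2 * h ≤ 0.15 := by
    have e1 : τ ^ 2 ≤ (1.05 * (2 * X)) ^ 2 := by gcongr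
    have e2 : τ ^ 2 * h ≤ (1.05 * (2 * X)) ^ 2 * (1 - √2 * X) ^ 2 := by gcongr
    have e3 : (X * (1 - √2 * X)) ^ 2 ≤ 0.177 ^ 2 := by
      have : 0 ≤ X * (1 - √2 * X) := mul_nonneg hX (by linarith)
      gcongr
    linarith
  rcases hu with hu | hu
  · subst hu
    have hR' : 1 + τ ^ 2 * h = 2 * v ^ 2 := by linarith
    rcases hv with rfl | rfl | hv
    · have : 0 ≤ τ ^ 2 * h := mul_nonneg (sq_nonneg τ) hh0
      linarith
    · have : τ ^ 2 * h = 0 := by linarith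
      have hz : h = 0 := (mul_eq_zero.1 this).resolve_left (by positivity)
      have := sq_pos_of_pos hXpos
      nlinarith
    · have : (0.809 : ℝ) ^ 2 ≤ v ^ 2 := by
        have := lt_sqrt_five
        gcongr
        linarith
      linarith
  · have h1 := hu.half_le
    have e1 : 1 / 4 ≤ u * v := by nlinarith
    have e2 : 1 / 4 * 1.414 ≤ u * v * √2 := by gcongr
    have e3 : (1 / 2) ^ 2 ≤ u ^ 2 := by gcongr
    have e4 : (1 / 2) ^ 2 ≤ v ^ 2 := by gcongr
    linarith

/-- The left side of `hR` falls strictly between `1/4` (from `u = 0`, `v = 1/2`) and `1/2`, below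
which there is no other admitted value. The upper bound needs the sharper estimate of `τ` by twice
the product with a root at angle `2π/5`. -/
theorem not_dihedral_five {k h τ c s u v : ℝ} (hh0 : 0 ≤ h) (hcl : 0.809 < c)
    (hcu : c < 0.8091) (hsc : s ^ 2 + c ^ 2 = 1) (hkc : k * c ≤ 1) (hk : 1 ≤ k)
    (htan : h * c ^ 2 ≤ s ^ 2) (hτ0 : 0 < τ)
    (ht : τ ≤ 1.05 * (2 * (k * (2 * c ^ 2 - 1))))
    (hR : (1 + τ ^ 2 * h) * s ^ 2 = u ^ 2 + v ^ 2 + 2 * u * v * c)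
    (hu : u = 0 ∨ IsGapValue u) (hv : IsGapValue v) : False := by
  have hc2l : 0.654 < c ^ 2 := by nlinarith
  have hc2u : c ^ 2 < 0.6547 := by nlinarith
  have hk2 : k ≤ 1.2361 := by nlinarith
  have hy : k * (2 * c ^ 2 - 1) ≤ 1.2361 * (2 * 0.6547 - 1) := by gcongr; linarith
  have ht' : τ ≤ 0.8033 := by linarith
  have hh1 : h ≤ 0.5291 := by nlinarith
  have hH : τ ^ 2 * h ≤ 0.8033 ^ 2 * 0.5291 := by gcongr
  have hs2l : 0.345 < s ^ 2 := by linarith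
  have hs2u : s ^ 2 < 0.346 := by linarith
  have hup : (1 + τ ^ 2 * h) * s ^ 2 ≤ (1 + 0.8033 ^ 2 * 0.5291) * 0.346 := by gcongr
  have hlo : 0 ≤ τ ^ 2 * h * s ^ 2 := by positivity
  rcases hu with hu | hu
  · subst hu
    rcases hv.eq_half_or with rfl | hv
    · linarith
    · linarith
  · have h1 := hu.half_le
    have h2 := hv.half_le
    have e1 : 1 / 4 ≤ u * v := by nlinarith
    have e2 : 0 ≤ u * v * c := mul_nonneg (by linarith) (by linarith)
    have e3 : (1 / 2) ^ 2 ≤ u ^ 2 := by gcongr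
    have e4 : (1 / 2) ^ 2 ≤ v ^ 2 := by gcongr
    linarith

/-- Here `1/4` is both the least admitted value on the right and the value of the left side at `h =
0`; the next admitted value, `1/2`, is too large. -/
theorem eq_zero_of_dihedral_six {h τ u v : ℝ} (hτ0 : 0 < τ) (hτ : τ ≤ 1.05) (hh0 : 0 ≤ h)
    (hh1 : h ≤ 1 / 3) (hR : (1 + τ ^ 2 * h) * (1 / 4) = u ^ 2 + v ^ 2 + 2 * u * v * (√3 / 2))
    (hu : u = 0 ∨ IsGapValue u) (hv : IsGapValue v) : h = 0 := by
  have hH : τ ^ 2 * h ≤ 1.05 ^ 2 * (1 / 3) := by gcongr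
  rcases hu with hu | hu
  · subst hu
    rcases hv.eq_half_or with rfl | hv
    · have : τ ^ 2 * h = 0 := by linarith
      exact (mul_eq_zero.1 this).resolve_left (by positivity)
    · linarith
  · exfalso
    have h1 := hu.half_le
    have h2 := hv.half_le
    have e1 : 1 / 4 ≤ u * v := by nlinarith
    have e2 : 0 ≤ u * v * √3 := mul_nonneg (by linarith) (by positivity)
    have e3 : (1 / 2) ^ 2 ≤ u ^ 2 := by gcongr
    have e4 : (1 / 2) ^ 2 ≤ v ^ 2 := by gcongr
    linarith

theorem not_dihedral_seven {h τ c s u v : ℝ} (hs2 : s ^ 2 < 0.195) (hsc : s ^ 2 + c ^ 2 = 1)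
    (hc0 : 0 ≤ c) (hτ0 : 0 < τ) (hτ : τ ≤ 1.05) (hh0 : 0 ≤ h) (htan : h * c ^ 2 ≤ s ^ 2)
    (hR : (1 + τ ^ 2 * h) * s ^ 2 = u ^ 2 + v ^ 2 + 2 * u * v * c) (hu : 0 ≤ u)
    (hv : 1 / 2 ≤ v) : False := by
  have hh1 : h ≤ 0.2423 := by nlinarith
  have hup : (1 + τ ^ 2 * h) * s ^ 2 ≤ (1 + 1.05 ^ 2 * 0.2423) * 0.195 := by gcongr
  have e1 : 0 ≤ u * v * c := mul_nonneg (mul_nonneg hu (by linarith)) hc0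
  have e2 : (1 / 2) ^ 2 ≤ v ^ 2 := by gcongr
  linarith [sq_nonneg u]

/-- The quantity is the product of `δ` with a root at angle `±2π/5`; the bounds are the hypotheses
of `almost_minimal_le`. -/
theorem dihedral_five_bounds {k X c s : ℝ} (hk : 1 ≤ k) (hX : 0 ≤ X) (hs : 0 < s)
    (hc : c = (1 + √5) / 4) (hb : k * c + X * s < 1) :
    0 < k * (2 * c ^ 2 - 1) - X * (2 * s * c) ∧
      k * (2 * c ^ 2 - 1) - X * (2 * s * c) ≤ 1 / 2 := by
  have g1 := lt_sqrt_five
  have g2 := sqrt_five_lt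
  have hcl : 0.809 < c := by linarith
  have hcu : c < 0.8091 := by linarith
  have hmin5 : 4 * c ^ 2 = 2 * c + 1 := by
    have : √5 ^ 2 = 5 := Real.sq_sqrt (by norm_num)
    rw [hc]
    linear_combination this / 4
  have e1 : X * s < 1 - k * c := by linarith
  constructor
  · have e2 : X * s * (2 * c) < (1 - k * c) * (2 * c) := by
      apply mul_lt_mul_of_pos_right e1; linarith
    have e3 : k * (4 * c ^ 2 - 1) = k * (2 * c) := by rw [hmin5]; ring
    have e4 : 1 * (2 * c) ≤ k * (2 * c) := by gcongr
    linarith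
  · have hX2 : 0 ≤ X * (2 * s * c) := by
      have : 0 < c := by linarith
      positivity
    have a1 : k * 0.809 ≤ k * c := by gcongr
    have a3 : 0 ≤ X * s := by positivity
    have a2 : k ≤ 1.2361 := by linarith
    have a4 : k * (2 * c ^ 2 - 1) ≤ 1.2361 * (0.8091 - 1 / 2) := by
      have : 2 * c ^ 2 - 1 = c - 1 / 2 := by linarith
      rw [this]
      have : 0 ≤ c - 1 / 2 := by linarith
      gcongr
    linarith

/-- `hR` is the squared norm, times `sin²`, of the projection of a root to the plane, expressed by
its products `u`, `v` with neighbouring roots. The bound `hb` makes the left side small, the gap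
values keep the right side large; each order is a separate contest. -/
theorem dihedral_numeric {m : ℕ} (hm : 4 ≤ m) {k x τ u v : ℝ} (hk : 1 ≤ k)
    (hb : k * Real.cos (Real.pi / m) + |x| * Real.sin (Real.pi / m) < 1) (hτ0 : 0 < τ)
    (hτ : τ ≤ 1.05)
    (hR : (1 + τ ^ 2 * (k ^ 2 + x ^ 2 - 1)) * Real.sin (Real.pi / m) ^ 2 =
      u ^ 2 + v ^ 2 + 2 * u * v * Real.cos (Real.pi / m))
    (hu : u = 0 ∨ IsGapValue u) (hv : IsGapValue v)
    (h5 : m = 5 → τ ≤ 1.05 * (2 * (k * Real.cos (2 * (Real.pi / 5)) -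
      |x| * Real.sin (2 * (Real.pi / 5)))))
    (h4 : m = 4 → x ≠ 0 → τ ≤ 1.05 * (2 * |x|)) :
    m = 4 ∧ x = 0 ∨ m = 6 ∧ k = 1 ∧ x = 0 := by
  have hpi := Real.pi_pos
  have hm' : (4 : ℝ) ≤ m := by exact_mod_cast hm
  have hs0 : 0 < Real.sin (Real.pi / m) := by
    apply Real.sin_pos_of_pos_of_lt_pi (by positivity)
    exact div_lt_self hpi (by linarith)
  have hc0 : √2 / 2 ≤ Real.cos (Real.pi / m) := by
    rw [← Real.cos_pi_div_four]
    apply Real.cos_le_cos_of_nonneg_of_le_pi (by positivity) (by linarith)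
    gcongr
  have hc0' : 0.7 ≤ Real.cos (Real.pi / m) := by linarith [lt_sqrt_two]
  have hsc := Real.sin_sq_add_cos_sq (Real.pi / m)
  have hX0 := abs_nonneg x
  rw [← sq_abs x] at hR
  have hh0 : 0 ≤ k ^ 2 + |x| ^ 2 - 1 := by nlinarith
  have htan := sq_add_sq_sub_one_mul_le hk hX0 hs0 hc0' hsc hb
  have hu0 : 0 ≤ u := by
    rcases hu with rfl | h
    · exact le_rfl
    · linarith [h.half_le]
  rcases Nat.lt_or_ge m 7 with hlt | hge
  swap
  · exact (not_dihedral_seven (sin_sq_lt_of_seven_le hge) hsc (by linarith) hτ0 hτ hh0 htan hR hu0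
      hv.half_le).elim
  obtain rfl | rfl | rfl : m = 4 ∨ m = 5 ∨ m = 6 := by omega
  · left
    refine ⟨rfl, abs_eq_zero.1 ?_⟩
    push_cast at hb hR
    rw [Real.cos_pi_div_four, Real.sin_pi_div_four] at hb hR
    have h2s : √2 ^ 2 = 2 := Real.sq_sqrt zero_le_two
    refine eq_zero_of_dihedral_four hk hX0 ?_ ?_ hτ0 hu hv fun h => h4 rfl (abs_ne_zero.1 h)
    · have h2 : (0 : ℝ) < √2 := by positivity
      by_contra! hc
      have : √2 * √2 ≤ (k + |x|) * √2 := by gcongr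
      nlinarith
    · rw [div_pow, h2s] at hR
      linarith
  · exfalso
    have ht := h5 rfl
    push_cast at *
    rw [Real.cos_two_mul, Real.sin_two_mul] at ht
    have hc : Real.cos (Real.pi / 5) = (1 + √5) / 4 := Real.cos_pi_div_five
    have hXs := mul_nonneg hX0 hs0.le
    refine not_dihedral_five hh0 (by linarith [lt_sqrt_five]) (by linarith [sqrt_five_lt]) hsc
      (by linarith) hk htan hτ0 (ht.trans ?_) hR hu hv
    have : 0 ≤ |x| * (2 * Real.sin (Real.pi / 5) * Real.cos (Real.pi / 5)) := by
      apply mul_nonneg hX0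
      apply mul_nonneg <;> linarith
    linarith
  · right
    push_cast at hb hR htan
    rw [Real.cos_pi_div_six, Real.sin_pi_div_six] at hR htan
    have h3s : √3 ^ 2 = 3 := Real.sq_sqrt (by norm_num)
    rw [div_pow, h3s] at htan
    have hz := eq_zero_of_dihedral_six hτ0 hτ hh0 (by linarith) (by rw [← hR]; norm_num) hu hv
    have hx2 : |x| ^ 2 = 0 := by nlinarith [sq_nonneg |x|]
    refine ⟨rfl, by nlinarith, abs_eq_zero.1 (pow_eq_zero_iff two_ne_zero |>.1 hx2)⟩

/-! ### Rigidity of a root over a finite dihedral plane. -/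

namespace CoxeterSystem

open CoxeterMatrix

variable {B W : Type*} [Group W] {M : CoxeterMatrix B} {cs : CoxeterSystem M W}

/-- If the product is `cos ψ < 1`, rotation yields coefficients `τ sin(jψ) / sin ψ`. Almost
minimality allows none that is nonzero and much below `τ`, so `ψ = π/n`. As `ψ` is acute, `n ≥ 3`.
-/
theorem isGapValue_of_almost_minimal {e₁ e₂ δ : B →₀ ℝ} {τ : ℝ} (hτ : 0 < τ)
    (hmin : ∀ t, t ≠ 0 → cs.IsRootCoeff e₁ e₂ δ t → τ ≤ 1.05 * |t|) {a b θ : ℝ}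
    (hξ : a • e₁ + b • e₂ + τ • δ ∈ cs.roots) (hν : circlePoint e₁ e₂ θ ∈ cs.roots)
    (hpos : 0 < M.geomForm (circlePoint e₁ e₂ θ) (a • e₁ + b • e₂ + τ • δ)) :
    IsGapValue (M.geomForm (circlePoint e₁ e₂ θ) (a • e₁ + b • e₂ + τ • δ)) := by
  have hco := fun n => IsRootCoeff.sinRatio hξ hν n
  change ∀ n, cs.IsRootCoeff e₁ e₂ δ (_root_.sinRatio
    (M.geomForm (circlePoint e₁ e₂ θ) (a • e₁ + b • e₂ + τ • δ)) (n + 1) * τ) at hco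
  generalize M.geomForm (circlePoint e₁ e₂ θ) (a • e₁ + b • e₂ + τ • δ) = y at *
  rcases lt_or_ge y 1 with hy | hy
  swap
  · exact Or.inr (Or.inr (by linarith [sqrt_five_lt]))
  have hcos : Real.cos (Real.arccos y) = y := Real.cos_arccos (by linarith) hy.le
  have hs : 0 < Real.sin (Real.arccos y) :=
    Real.sin_pos_of_pos_of_lt_pi (Real.arccos_pos.2 hy)
      ((Real.arccos_lt_pi_div_two.2 hpos).trans (by linarith [Real.pi_pos]))
  obtain ⟨n, hn, he⟩ := exists_eq_pi_div_of_lt_sin (Real.arccos_pos.2 hy)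
    (Real.arccos_lt_pi_div_two.2 hpos) (fun j hj => by
      obtain ⟨n, rfl⟩ : ∃ n, j = n + 1 := by
        refine Nat.exists_eq_succ_of_ne_zero ?_
        rintro rfl
        simp at hj
      have hr := sinRatio_cos_mul_sin (Real.arccos y) (n + 1)
      rw [hcos] at hr
      have hr0 : _root_.sinRatio y (n + 1) ≠ 0 := fun h0 => hj (by rw [← hr, h0, zero_mul])
      have hle := hmin _ (mul_ne_zero hr0 hτ.ne') (hco n)
      rw [abs_mul, abs_of_pos hτ] at hle
      have h1 : 1 ≤ 1.05 * |_root_.sinRatio y (n + 1)| := by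
        by_contra! hc
        nlinarith
      rw [← hr, abs_mul, abs_of_pos hs]
      have := lt_sqrt_two
      have h2 : 0 < |_root_.sinRatio y (n + 1)| := abs_pos.2 hr0
      have h3 : 1 < √2 * |_root_.sinRatio y (n + 1)| := by nlinarith
      nlinarith)
  rw [← hcos, he]
  exact isGapValue_cos_pi_div hn

/-- Write the product as `y = sin χ`. Rotating `δ` itself, whose coefficient is 1, produces a
nonzero coefficient of size at most `sin 2χ / cos χ = 2y`. -/
theorem almost_minimal_le {e₁ e₂ δ : B →₀ ℝ} {τ : ℝ}
    (hmin : ∀ t, t ≠ 0 → cs.IsRootCoeff e₁ e₂ δ t → τ ≤ 1.05 * |t|) {θ : ℝ}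
    (hδ : δ ∈ cs.roots) (hν : circlePoint e₁ e₂ θ ∈ cs.roots)
    (hpos : 0 < M.geomForm (circlePoint e₁ e₂ θ) δ)
    (hlt : M.geomForm (circlePoint e₁ e₂ θ) δ ≤ 1 / 2) :
    τ ≤ 1.05 * (2 * M.geomForm (circlePoint e₁ e₂ θ) δ) := by
  have e0 : (0 : ℝ) • e₁ + (0 : ℝ) • e₂ + (1 : ℝ) • δ = δ := by simp
  have hco := fun n => IsRootCoeff.sinRatio (cs := cs) (a := 0) (b := 0) (t := 1)
    (by rwa [e0]) hν n
  rw [e0] at hco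
  change ∀ n, cs.IsRootCoeff e₁ e₂ δ (_root_.sinRatio
    (M.geomForm (circlePoint e₁ e₂ θ) δ) (n + 1) * 1) at hco
  generalize M.geomForm (circlePoint e₁ e₂ θ) δ = y at *
  set χ := Real.arcsin y with hχ
  have hsin : Real.sin χ = y := Real.sin_arcsin (by linarith) (by linarith)
  have hχ0 : 0 < χ := Real.arcsin_pos.2 hpos
  have hχ1 : χ ≤ Real.pi / 4 := by
    have h1 : Real.arcsin (Real.sin (Real.pi / 4)) = Real.pi / 4 :=
      Real.arcsin_sin (by linarith [Real.pi_pos]) (by linarith [Real.pi_pos])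
    rw [hχ, ← h1]
    apply Real.monotone_arcsin
    rw [Real.sin_pi_div_four]
    linarith [lt_sqrt_two]
  have hcos : 0 < Real.cos χ :=
    Real.cos_pos_of_mem_Ioo ⟨by linarith [Real.pi_pos], by linarith [Real.pi_pos]⟩
  obtain ⟨j, hj0, hj⟩ := exists_abs_sin_mul_le hχ0 hχ1
  have hr := sinRatio_cos_mul_sin (Real.pi / 2 - χ) (j + 1)
  rw [Real.cos_pi_div_two_sub, Real.sin_pi_div_two_sub, hsin] at hr
  have hr0 : _root_.sinRatio y (j + 1) ≠ 0 := fun h0 => hj0 (by rw [← hr, h0, zero_mul])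
  have hle := hmin _ (by rwa [mul_one]) (hco j)
  rw [mul_one] at hle
  rw [← hr, abs_mul, abs_of_pos hcos, Real.sin_two_mul, hsin] at hj
  have := le_of_mul_le_mul_right hj hcos
  linarith

/-- Project a root `ξ` of almost minimal `δ`-coefficient to the plane. The squared length `1 + τ²(k²
+ x² - 1)` is close to 1 by `hb`, while the products with two neighbouring roots must be 0 or gap
values. -/
theorem dihedral_rigidity {m : ℕ} (hm : 4 ≤ m) {e₁ e₂ : B →₀ ℝ} (h : M.IsOrthonormalPair e₁ e₂)
    (hroots : ∀ i : ℤ, circlePoint e₁ e₂ (i * (Real.pi / m)) ∈ cs.roots)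
    {f : (B →₀ ℝ) →ₗ[ℝ] ℝ} (hf : {β | cs.IsPositiveRoot β ∧ f β < 1}.Finite)
    (hfc : ∀ t, f (circlePoint e₁ e₂ t) = 0) {δ : B →₀ ℝ} (hδ : δ ∈ cs.roots) (hfδ : f δ ≠ 0)
    (hk : 1 ≤ M.geomForm δ e₁)
    (hb : M.geomForm δ e₁ * Real.cos (Real.pi / m) +
      |M.geomForm δ e₂| * Real.sin (Real.pi / m) < 1) :
    m = 4 ∧ M.geomForm δ e₂ = 0 ∨
      m = 6 ∧ M.geomForm δ e₁ = 1 ∧ M.geomForm δ e₂ = 0 := by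
  have hpi := Real.pi_pos
  have hm' : (4 : ℝ) ≤ m := by exact_mod_cast hm
  have hf1 : f e₁ = 0 := by simpa [circlePoint_zero] using hfc 0
  have hf2 : f e₂ = 0 := by simpa [circlePoint] using hfc (Real.pi / 2)
  obtain ⟨τ, hτ0, ⟨a, b, hξ⟩, hmin⟩ := exists_almost_minimal_isRootCoeff hf hf1 hf2 hδ hfδ
  set A := Real.pi / m with hA
  have hA0 : 0 < A := by positivity
  clear_value A
  set k := M.geomForm δ e₁ with hkdef
  set x := M.geomForm δ e₂ with hxdef
  have hcoord : ∀ t, M.geomForm (circlePoint e₁ e₂ t) δ = k * Real.cos t + x * Real.sin t :=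
    fun t => by rw [M.geomForm_comm, geomForm_circlePoint_right]; ring
  set ξ := a • e₁ + b • e₂ + τ • δ with hξdef
  have hξcoord : ∀ t, M.geomForm (circlePoint e₁ e₂ t) ξ =
      (a + τ * k) * Real.cos t + (b + τ * x) * Real.sin t := fun t => by
    rw [M.geomForm_comm, geomForm_circlePoint_right, hξdef]
    simp only [map_add, map_smul, LinearMap.add_apply, LinearMap.smul_apply, smul_eq_mul, h.fst,
      h.snd, h.fst_snd, M.geomForm_comm e₂ e₁, ← hkdef, ← hxdef]
    ring
  have hnorm : (a + τ * k) ^ 2 + (b + τ * x) ^ 2 = 1 + τ ^ 2 * (k ^ 2 + x ^ 2 - 1) := by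
    have h1 := geomForm_self hξ
    rw [hξdef] at h1
    simp only [map_add, map_smul, LinearMap.add_apply, LinearMap.smul_apply, smul_eq_mul, h.fst,
      h.snd, h.fst_snd, M.geomForm_comm e₂ e₁, ← hkdef, ← hxdef, geomForm_self hδ,
      M.geomForm_comm e₁ δ, M.geomForm_comm e₂ δ] at h1
    linear_combination h1
  obtain ⟨R, θ, hR0, hX, hY⟩ : ∃ R θ : ℝ, 0 ≤ R ∧ a + τ * k = R * Real.cos θ ∧
      b + τ * x = R * Real.sin θ := by
    refine ⟨‖(⟨a + τ * k, b + τ * x⟩ : ℂ)‖, Complex.arg ⟨a + τ * k, b + τ * x⟩, norm_nonneg _, ?_, ?_⟩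
    · rw [Complex.norm_mul_cos_arg]
    · rw [Complex.norm_mul_sin_arg]
  -- The index is chosen so that the roots at `iA + π` and `(i+1)A` lie on either side of the
  -- projection, making angle `π - A` with each other; their products with `ξ` are then nonnegative.
  set i := ⌊(θ - Real.pi / 2) / A⌋ with hi
  obtain ⟨r, hr⟩ : ∃ r, r = θ - Real.pi / 2 - i * A := ⟨_, rfl⟩
  have hr0 : 0 ≤ r := by
    have := (le_div_iff₀ hA0).1 (Int.floor_le ((θ - Real.pi / 2) / A))
    linarith
  have hrA : r < A := by
    have := (div_lt_iff₀ hA0).1 (Int.lt_floor_add_one ((θ - Real.pi / 2) / A))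
    linarith
  have hu : M.geomForm (circlePoint e₁ e₂ (i * A + Real.pi)) ξ = R * Real.sin r := by
    rw [hξcoord, hX, hY]
    have e : i * A = θ - r - Real.pi / 2 := by rw [hr]; ring
    rw [e, Real.cos_add_pi, Real.sin_add_pi, Real.cos_sub_pi_div_two, Real.sin_sub_pi_div_two,
      Real.sin_sub, Real.cos_sub]
    linear_combination R * Real.sin r * Real.sin_sq_add_cos_sq θ
  have hv : M.geomForm (circlePoint e₁ e₂ ((i + 1 : ℤ) * A)) ξ = R * Real.sin (A - r) := by
    rw [hξcoord, hX, hY]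
    have e : ((i + 1 : ℤ) : ℝ) * A = θ + (A - r) - Real.pi / 2 := by rw [hr]; push_cast; ring
    rw [e, Real.cos_sub_pi_div_two, Real.sin_sub_pi_div_two, Real.sin_add, Real.cos_add]
    linear_combination R * Real.sin (A - r) * Real.sin_sq_add_cos_sq θ
  have hRR : R ^ 2 = 1 + τ ^ 2 * (k ^ 2 + x ^ 2 - 1) := by
    rw [← hnorm, hX, hY]
    linear_combination -R ^ 2 * Real.sin_sq_add_cos_sq θ
  have hRpos : 0 < R := by
    rcases hR0.eq_or_lt with h0 | h0
    · rw [← h0] at hRR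
      nlinarith [mul_nonneg (sq_nonneg τ) (show 0 ≤ k ^ 2 + x ^ 2 - 1 by nlinarith)]
    · exact h0
  have hAlt : A < Real.pi := hA ▸ div_lt_self hpi (by linarith)
  have hvpos : 0 < R * Real.sin (A - r) :=
    mul_pos hRpos (Real.sin_pos_of_pos_of_lt_pi (by linarith) (by linarith))
  have hunonneg : 0 ≤ R * Real.sin r :=
    mul_nonneg hR0 (Real.sin_nonneg_of_nonneg_of_le_pi hr0 (by linarith))
  have hνu : circlePoint e₁ e₂ (i * A + Real.pi) ∈ cs.roots := by
    rw [circlePoint_add_pi]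
    exact neg_mem_roots (hroots i)
  have hgu : R * Real.sin r = 0 ∨ IsGapValue (R * Real.sin r) := by
    rcases hunonneg.eq_or_lt with h0 | h0
    · exact Or.inl h0.symm
    · rw [← hu] at h0 ⊢
      exact Or.inr (isGapValue_of_almost_minimal hτ0 hmin hξ hνu h0)
  have hgv : IsGapValue (R * Real.sin (A - r)) := by
    rw [← hv] at hvpos ⊢
    exact isGapValue_of_almost_minimal hτ0 hmin hξ (hroots (i + 1)) hvpos
  have hτ1 : τ ≤ 1.05 := by
    have := hmin 1 one_ne_zero ⟨0, 0, by simpa using hδ⟩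
    simpa using this
  have hroots' : ∀ i : ℤ, circlePoint e₁ e₂ (-(i * A)) ∈ cs.roots := fun i => by
    have := hroots (-i)
    push_cast at this
    rwa [neg_mul] at this
  have hRA : (1 + τ ^ 2 * (k ^ 2 + x ^ 2 - 1)) * Real.sin A ^ 2 = (R * Real.sin r) ^ 2 +
      (R * Real.sin (A - r)) ^ 2 + 2 * (R * Real.sin r) * (R * Real.sin (A - r)) * Real.cos A := by
    rw [← hRR, Real.sin_sub]
    linear_combination R ^ 2 * Real.sin A ^ 2 * (-Real.sin_sq_add_cos_sq r) +
      R ^ 2 * Real.sin r ^ 2 * Real.sin_sq_add_cos_sq A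
  have h5 : m = 5 → τ ≤ 1.05 * (2 * (k * Real.cos (2 * (Real.pi / 5)) -
      |x| * Real.sin (2 * (Real.pi / 5)))) := by
    intro h5
    have hA5 : A = Real.pi / 5 := by rw [hA, h5]; norm_num
    rw [hA5] at hb
    have hc : Real.cos (Real.pi / 5) = (1 + √5) / 4 := Real.cos_pi_div_five
    have hval : ∃ t, circlePoint e₁ e₂ t ∈ cs.roots ∧ M.geomForm (circlePoint e₁ e₂ t) δ =
        k * Real.cos (2 * (Real.pi / 5)) - |x| * Real.sin (2 * (Real.pi / 5)) := by
      rcases le_total 0 x with hx | hx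
      · refine ⟨-((2 : ℤ) * A), hroots' 2, ?_⟩
        rw [hcoord, abs_of_nonneg hx, hA5, Real.cos_neg, Real.sin_neg]
        push_cast; ring
      · refine ⟨(2 : ℤ) * A, hroots 2, ?_⟩
        rw [hcoord, abs_of_nonpos hx, hA5]
        push_cast; ring
    obtain ⟨t, ht, hte⟩ := hval
    have hs0 : 0 < Real.sin (Real.pi / 5) :=
      Real.sin_pos_of_pos_of_lt_pi (by linarith) (by linarith)
    rw [← hte]
    have hbd : 0 < M.geomForm (circlePoint e₁ e₂ t) δ ∧
        M.geomForm (circlePoint e₁ e₂ t) δ ≤ 1 / 2 := by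
      rw [hte, Real.cos_two_mul, Real.sin_two_mul]
      exact dihedral_five_bounds hk (abs_nonneg x) hs0 hc hb
    exact almost_minimal_le hmin hδ ht hbd.1 hbd.2
  have h4 : m = 4 → x ≠ 0 → τ ≤ 1.05 * (2 * |x|) := by
    intro h4 hx
    have hA4 : A = Real.pi / 4 := by rw [hA, h4]; norm_num
    rw [hA4, Real.cos_pi_div_four, Real.sin_pi_div_four] at hb
    have h2A : ((2 : ℤ) : ℝ) * A = Real.pi / 2 := by rw [hA4]; push_cast; ring
    have hXlt : |x| ≤ 1 / 2 := by
      have := lt_sqrt_two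
      have := sqrt_two_lt
      have hX0 := abs_nonneg x
      nlinarith
    have hval : ∃ t, circlePoint e₁ e₂ t ∈ cs.roots ∧
        M.geomForm (circlePoint e₁ e₂ t) δ = |x| := by
      rcases le_total 0 x with hx | hx
      · refine ⟨(2 : ℤ) * A, hroots 2, ?_⟩
        rw [hcoord, abs_of_nonneg hx, h2A]
        simp
      · refine ⟨-((2 : ℤ) * A), hroots' 2, ?_⟩
        rw [hcoord, abs_of_nonpos hx, h2A]
        simp
    obtain ⟨t, ht, hte⟩ := hval
    rw [← hte] at hXlt ⊢
    exact almost_minimal_le hmin hδ ht (by rw [hte]; exact abs_pos.2 hx) hXlt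
  subst hA
  exact dihedral_numeric hm hk hb hτ0 hτ1 hRA hgu hgv h5 h4

end CoxeterSystem

/-! ### Comparing a simple root of a dihedral system with its neighbour. -/

namespace CoxeterSystem

open CoxeterMatrix

variable {B W : Type*} [Group W] {M : CoxeterMatrix B} {cs : CoxeterSystem M W}

theorem circlePoint_mul_mem_roots {e₁ e₂ : B →₀ ℝ} (h : M.IsOrthonormalPair e₁ e₂) {A : ℝ}
    (h0 : circlePoint e₁ e₂ 0 ∈ cs.roots) (h1 : circlePoint e₁ e₂ A ∈ cs.roots) (i : ℤ) :
    circlePoint e₁ e₂ (i * A) ∈ cs.roots := by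
  have step : ∀ a b, circlePoint e₁ e₂ a ∈ cs.roots → circlePoint e₁ e₂ b ∈ cs.roots →
      circlePoint e₁ e₂ (2 * a - b) ∈ cs.roots := fun a b ha hb => by
    have := neg_mem_roots (reflect_mem_roots ha hb)
    rwa [h.reflect_circlePoint, neg_neg] at this
  suffices key : circlePoint e₁ e₂ (i * A) ∈ cs.roots ∧
      circlePoint e₁ e₂ ((i + 1) * A) ∈ cs.roots from key.1
  induction i using Int.induction_on with
  | zero => simpa using ⟨h0, h1⟩
  | succ i ih =>
    push_cast at ih ⊢
    refine ⟨ih.2, ?_⟩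
    convert step _ _ ih.2 ih.1 using 2
    ring
  | pred i ih =>
    push_cast at ih ⊢
    refine ⟨?_, ?_⟩
    · convert step _ _ ih.1 ih.2 using 2
      ring
    · convert ih.1 using 2
      ring

/-- Properties of a root `δ` which is dominated by `α`, but not by the image `β` of `γ` under
the reflection in `α`. -/
theorem dihedral_bad_root {m : ℕ} (hm : 4 ≤ m) {α γ δ : B →₀ ℝ} (hα : cs.IsPositiveRoot α)
    (hγ : cs.IsPositiveRoot γ) (hαγ : M.geomForm α γ = -Real.cos (Real.pi / m))
    {f : (B →₀ ℝ) →ₗ[ℝ] ℝ} (hf : {β | cs.IsPositiveRoot β ∧ f β < 1}.Finite) (hfα : f α = 0)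
    (hδ : δ ∈ cs.dominatedRoots α) (hbad : ¬ cs.Dominates (M.reflect α γ) δ) :
    1 ≤ M.geomForm δ α ∧ M.geomForm δ γ < 0 ∧ -1 < M.geomForm δ γ ∧
      M.geomForm δ (M.reflect α γ) < 1 ∧ f δ < 0 := by
  have hpi := Real.pi_pos
  have hm' : (4 : ℝ) ≤ m := by exact_mod_cast hm
  have hA0 : 0 < Real.pi / m := by positivity
  have hc0 : √2 / 2 ≤ Real.cos (Real.pi / m) := by
    rw [← Real.cos_pi_div_four]
    apply Real.cos_le_cos_of_nonneg_of_le_pi (by positivity) (by linarith)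
    gcongr
  have hc1 : Real.cos (Real.pi / m) < 1 := by
    rw [← Real.cos_zero]
    apply Real.cos_lt_cos_of_nonneg_of_le_pi le_rfl _ hA0
    exact div_le_self hpi.le (by linarith)
  set c := Real.cos (Real.pi / m) with hc
  have hc7 : 0.7 < c := by linarith [lt_sqrt_two]
  obtain ⟨hδp, hδα, hdom⟩ := hδ
  have hγα : M.geomForm γ α = -c := by rw [M.geomForm_comm, hαγ]
  have hββ : M.reflect α γ ∈ cs.roots := reflect_mem_roots hα.1 hγ.1
  have hk : 1 ≤ M.geomForm δ α := by
    rw [M.geomForm_comm]; exact hdom.one_le_geomForm hα.1 hδp.1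
  have hγδ : M.geomForm δ γ < 0 := by
    by_contra! hc
    apply hbad
    rw [M.geomForm_comm] at hc
    have h1 := hdom.reflect_left hα.1 hγ.1 hδp.1 hc (by rw [hγα]; linarith)
    intro w hw
    by_contra hn
    have h2 : ∀ ρ, ρ ∈ cs.roots → cs.Dominates ρ δ → 0 ≤ cs.geomRep w⁻¹ ρ := fun ρ hρ hd => by
      rcases isPositiveRoot_or_isNegativeRoot (geomRep_mem_roots w⁻¹ hρ) with hp | hne
      · exact hp.2
      · exact absurd (hd w hne) hn
    -- `s_α γ` is a nonnegative combination of `s_γ α` and `α`. Both dominate `δ`, hence so does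
    -- `s_α γ`, against `hbad`.
    have e : M.reflect α γ = (1 / (2 * c)) • M.reflect γ α + ((4 * c ^ 2 - 1) / (2 * c)) • α := by
      simp only [CoxeterMatrix.reflect, hγα, hαγ]
      have : c ≠ 0 := by linarith
      match_scalars <;> field_simp
      ring
    have hr := geomRep_mem_roots w⁻¹ hββ
    rw [e, map_add, map_smul, map_smul] at hw hr
    exact (isPositiveRoot_of_nonneg_comb (by positivity) (div_nonneg (by nlinarith) (by linarith))
      (h2 _ (reflect_mem_roots hγ.1 hα.1) h1) (h2 _ hα.1 hdom) hr).not_isNegativeRoot hw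
  refine ⟨hk, hγδ, ?_, ?_, ?_⟩
  · by_contra! hc
    have h1 : 1 ≤ M.geomForm (-γ) δ := by
      rw [map_neg, LinearMap.neg_apply, M.geomForm_comm]; linarith
    rcases dominates_or_dominates (neg_mem_roots hγ.1) hδp.1 h1 with h2 | h2
    · have := h2 1 (by rw [inv_one, geomRep_one]; exact isNegativeRoot_neg.2 hγ)
      rw [inv_one, geomRep_one] at this
      exact hδp.not_isNegativeRoot this
    · have := (hdom.trans h2).one_le_geomForm hα.1 (neg_mem_roots hγ.1)
      rw [map_neg, hαγ] at this
      linarith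
  · by_contra! hge
    rcases dominates_or_dominates hδp.1 hββ hge with h2 | h2
    · have := (hdom.trans h2).one_le_geomForm hα.1 hββ
      rw [M.geomForm_reflect_right, hαγ, geomForm_self hα.1] at this
      linarith
    · exact hbad h2
  · by_contra! hc
    exact not_dominates_of_functional_le hf hα hδp.1 hδα.symm hc (by rw [hfα]; exact hc) hdom

/-- Roots dominated by both `α` and `β = s_α γ` are kept. By rigidity the remaining ones occur only
for `m = 4` and `m = 6` in special position, and there a reflection image is dominated by `β` but
not by `α`, so it does not collide with the kept roots. -/
theorem encard_dominatedRoots_le_of_angle {m : ℕ} (hm : 4 ≤ m) {α γ : B →₀ ℝ}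
    (hα : cs.IsPositiveRoot α) (hγ : cs.IsPositiveRoot γ)
    (hαγ : M.geomForm α γ = -Real.cos (Real.pi / m)) :
    (cs.dominatedRoots α).encard ≤ (cs.dominatedRoots (M.reflect α γ)).encard := by
  classical
  have hpi := Real.pi_pos
  have hm' : (4 : ℝ) ≤ m := by exact_mod_cast hm
  have hm0 : (m : ℝ) ≠ 0 := by positivity
  obtain ⟨A, hA⟩ : ∃ A, A = Real.pi / m := ⟨_, rfl⟩
  have hA0 : 0 < A := by rw [hA]; positivity
  have hA1 : A < Real.pi := by rw [hA]; exact div_lt_self hpi (by linarith)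
  have hs : 0 < Real.sin A := Real.sin_pos_of_pos_of_lt_pi hA0 hA1
  have hs' : Real.sin (Real.pi - A) ≠ 0 := by rw [Real.sin_pi_sub]; exact hs.ne'
  have horth := isOrthonormalPair_secondAxis (M := M) (φ := Real.pi - A) (geomForm_self hα.1)
    (geomForm_self hγ.1) (by rw [hαγ, Real.cos_pi_sub, hA]) hs'
  have hcγ := circlePoint_secondAxis (x := α) (y := γ) hs'
  set e₂ := secondAxis α γ (Real.pi - A) with he₂
  have hc0 : circlePoint α e₂ 0 = α := circlePoint_zero α e₂
  have hcβ : circlePoint α e₂ A = M.reflect α γ := by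
    have := horth.reflect_circlePoint 0 (Real.pi - A)
    rw [hc0, hcγ] at this
    rw [this, ← circlePoint_add_pi]
    congr 1
    ring
  set β := M.reflect α γ with hβ
  have hβr : β ∈ cs.roots := reflect_mem_roots hα.1 hγ.1
  have hcA := circlePoint_mul_mem_roots (cs := cs) horth (A := A) (by rw [hc0]; exact hα.1)
    (by rw [hcβ]; exact hβr)
  obtain ⟨f, hf, hfc⟩ := exists_functional (cs := cs) horth (m := m) (by omega)
    (by rw [hc0]; exact hα.1) (by rw [← hA, hcβ]; exact hβr)
  have hfα : f α = 0 := by rw [← hc0]; exact hfc 0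
  have hfβ : f β = 0 := by rw [← hcβ]; exact hfc A
  have hfγ : f γ = 0 := by rw [← hcγ]; exact hfc _
  have hδγ : ∀ δ, M.geomForm δ γ = -(Real.cos A * M.geomForm δ α) +
      Real.sin A * M.geomForm δ e₂ := fun δ => by
    conv_lhs => rw [← hcγ, geomForm_circlePoint_right, Real.cos_pi_sub, Real.sin_pi_sub]
    ring
  have hδβ : ∀ δ, M.geomForm δ β = Real.cos A * M.geomForm δ α +
      Real.sin A * M.geomForm δ e₂ := fun δ => by
    conv_lhs => rw [← hcβ, geomForm_circlePoint_right]
  have hbad := fun δ (hδ : δ ∈ cs.dominatedRoots α) (hb : ¬ cs.Dominates β δ) =>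
    dihedral_bad_root hm hα hγ hαγ hf hfα hδ hb
  have hcls : ∀ δ ∈ cs.dominatedRoots α, ¬ cs.Dominates β δ →
      m = 4 ∧ M.geomForm δ e₂ = 0 ∨
        m = 6 ∧ M.geomForm δ α = 1 ∧ M.geomForm δ e₂ = 0 := fun δ hδ hb => by
    obtain ⟨hk, h1, h2, h3, h4⟩ := hbad δ hδ hb
    rw [hδγ] at h1 h2
    rw [hδβ] at h3
    refine dihedral_rigidity hm horth (by rw [← hA]; exact hcA) hf hfc hδ.1.1 h4.ne hk ?_
    rw [← hA]
    rcases le_total 0 (M.geomForm δ e₂) with hx | hx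
    · rw [abs_of_nonneg hx]; linarith
    · rw [abs_of_nonpos hx]; linarith
  have himage : ∀ η, cs.IsPositiveRoot η → f η < 0 → 1 ≤ M.geomForm β η →
      η ∈ cs.dominatedRoots β := fun η hη hfη h1 => by
    have hne : η ≠ β := by rintro rfl; linarith
    refine ⟨hη, hne, (dominates_or_dominates hβr hη.1 h1).resolve_right ?_⟩
    exact not_dominates_of_functional_le hf hη hβr hne hfβ.ge (by rw [hfβ]; exact hfη.le)
  have hgood : ∀ δ ∈ cs.dominatedRoots α, cs.Dominates β δ → δ ∈ cs.dominatedRoots β :=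
      fun δ hδ hd => by
    refine ⟨hδ.1, ?_, hd⟩
    rintro rfl
    have h1 := hδ.2.2.one_le_geomForm hα.1 hβr
    rw [hδβ, horth.fst, horth.fst_snd] at h1
    have : Real.cos A < 1 := by
      rw [← Real.cos_zero]
      exact Real.cos_lt_cos_of_nonneg_of_le_pi le_rfl hA1.le hA0
    linarith
  have hγγ := geomForm_self hγ.1
  have hγα : M.geomForm γ α = -Real.cos A := by rw [M.geomForm_comm, hαγ, hA]
  have hγe : M.geomForm γ e₂ = Real.sin A := by
    have := hδγ γ
    rw [hγγ, hγα] at this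
    have h2 := Real.sin_sq_add_cos_sq A
    apply mul_left_cancel₀ hs.ne'
    linarith
  have hγβ : M.geomForm β γ = 1 - 2 * Real.cos A ^ 2 := by
    rw [M.geomForm_comm, hδβ, hγα, hγe]
    linear_combination Real.sin_sq_add_cos_sq A
  -- Product at least 1 with `β` and negative `f` put an image among the roots dominated by `β`;
  -- product below 1 with `α` separates it from the roots left fixed.
  have hinj : ∀ (a b : (B →₀ ℝ) → ℝ), (∀ δ ∈ cs.dominatedRoots α, ¬ cs.Dominates β δ →
      cs.IsPositiveRoot (a δ • γ + b δ • δ) ∧ 0 < b δ ∧ 1 ≤ M.geomForm β (a δ • γ + b δ • δ) ∧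
        M.geomForm α (a δ • γ + b δ • δ) < 1) →
      (∀ δ ∈ cs.dominatedRoots α, ¬ cs.Dominates β δ → ∀ δ' ∈ cs.dominatedRoots α,
        ¬ cs.Dominates β δ' → a δ • γ + b δ • δ = a δ' • γ + b δ' • δ' → δ = δ') →
      (cs.dominatedRoots α).encard ≤ (cs.dominatedRoots β).encard := by
    intro a b h1 h2
    refine Set.encard_le_encard_of_injOn
      (f := fun δ => if cs.Dominates β δ then δ else a δ • γ + b δ • δ) ?_ ?_
    · intro δ hδ
      dsimp only
      split_ifs with hd
      · exact hgood δ hδ hd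
      · obtain ⟨g1, g2, g3, g4⟩ := h1 δ hδ hd
        refine himage _ g1 ?_ g3
        rw [map_add, map_smul, map_smul, hfγ, smul_eq_mul, smul_eq_mul]
        nlinarith [(hbad δ hδ hd).2.2.2.2]
    · intro δ hδ δ' hδ' he
      dsimp only at he
      split_ifs at he with hd hd' hd'
      · exact he
      · have := hδ.2.2.one_le_geomForm hα.1 hδ.1.1
        rw [he] at this
        linarith [(h1 δ' hδ' hd').2.2.2]
      · have := hδ'.2.2.one_le_geomForm hα.1 hδ'.1.1
        rw [← he] at this
        linarith [(h1 δ hδ hd).2.2.2]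
      · exact h2 δ hδ hd δ' hδ' hd' he
  rcases eq_or_ne m 4 with rfl | hm4
  · have hcos : Real.cos A = √2 / 2 := by rw [hA]; push_cast; exact Real.cos_pi_div_four
    have h2s : √2 ^ 2 = 2 := Real.sq_sqrt zero_le_two
    have hx0 : ∀ δ ∈ cs.dominatedRoots α, ¬ cs.Dominates β δ → M.geomForm δ e₂ = 0 :=
        fun δ hδ hb => by
      rcases hcls δ hδ hb with h | h
      · exact h.2
      · exact h.2.2
    -- For `m = 4` the image is `s_γ s_δ γ`; its product with `γ` is `k² - 1`, from which `k` and
    -- then `δ` are recovered.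
    refine hinj (fun δ => 2 * M.geomForm δ α ^ 2 - 1) (fun δ => √2 * M.geomForm δ α) ?_ ?_
    · intro δ hδ hd
      have hk := (hbad δ hδ hd).1
      have hx := hx0 δ hδ hd
      have e1 : M.geomForm δ γ = -(√2 / 2 * M.geomForm δ α) := by rw [hδγ, hx, hcos]; ring
      have e2 : M.geomForm δ β = √2 / 2 * M.geomForm δ α := by rw [hδβ, hx, hcos]; ring
      set k := M.geomForm δ α with hkd
      have hroot : (2 * k ^ 2 - 1) • γ + (√2 * k) • δ ∈ cs.roots := by
        have := reflect_mem_roots hγ.1 (reflect_mem_roots hδ.1.1 hγ.1)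
        convert this using 1
        simp only [CoxeterMatrix.reflect, map_sub, map_smul, e1, M.geomForm_comm γ δ, hγγ,
          smul_eq_mul]
        match_scalars
        · linear_combination -(k ^ 2) * h2s
        · ring
      refine ⟨isPositiveRoot_of_nonneg_comb (by nlinarith) (by positivity) hγ.2 hδ.1.2 hroot,
        by positivity, ?_, ?_⟩
      · rw [map_add, map_smul, map_smul, hγβ, M.geomForm_comm β δ, e2, hcos, smul_eq_mul,
          smul_eq_mul]
        have : (2 * k ^ 2 - 1) * (1 - 2 * (√2 / 2) ^ 2) + √2 * k * (√2 / 2 * k) = k ^ 2 := by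
          linear_combination (-k ^ 2 / 2 + 1 / 2) * h2s
        rw [this]
        nlinarith
      · rw [map_add, map_smul, map_smul, M.geomForm_comm α γ, hγα, M.geomForm_comm α δ, ← hkd,
          hcos, smul_eq_mul, smul_eq_mul]
        have : (2 * k ^ 2 - 1) * -(√2 / 2) + √2 * k * k = √2 / 2 := by ring
        rw [this]
        linarith [sqrt_two_lt]
    · intro δ hδ hd δ' hδ' hd' he
      have hval : ∀ δ ∈ cs.dominatedRoots α, ¬ cs.Dominates β δ →
          M.geomForm γ ((2 * M.geomForm δ α ^ 2 - 1) • γ + (√2 * M.geomForm δ α) • δ) =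
            M.geomForm δ α ^ 2 - 1 := fun δ hδ hd => by
        rw [map_add, map_smul, map_smul, hγγ, M.geomForm_comm γ δ, hδγ, hx0 δ hδ hd, hcos,
          smul_eq_mul, smul_eq_mul]
        linear_combination (-(M.geomForm δ α) ^ 2 / 2) * h2s
      have h1 := hval δ hδ hd
      rw [he, hval δ' hδ' hd'] at h1
      have hk := (hbad δ hδ hd).1
      have hk' := (hbad δ' hδ' hd').1
      have h3 : M.geomForm δ α = M.geomForm δ' α := by
        have : M.geomForm δ' α ^ 2 = M.geomForm δ α ^ 2 := by linarith
        exact ((pow_left_inj₀ (by linarith) (by linarith) two_ne_zero).1 this).symm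
      rw [h3] at he
      have h4 := add_left_cancel he
      exact smul_right_injective _ (by positivity) h4
  · have hall : ∀ δ ∈ cs.dominatedRoots α, ¬ cs.Dominates β δ →
        m = 6 ∧ M.geomForm δ α = 1 ∧ M.geomForm δ e₂ = 0 := fun δ hδ hb =>
      (hcls δ hδ hb).resolve_left fun h => hm4 h.1
    -- For `m = 6` the image is `s_δ γ`, because `⟨δ, γ⟩ = -√3/2`.
    refine hinj (fun _ => 1) (fun _ => √3) ?_ ?_
    · intro δ hδ hd
      obtain ⟨rfl, hk, hx⟩ := hall δ hδ hd
      have hcos : Real.cos A = √3 / 2 := by rw [hA]; push_cast; exact Real.cos_pi_div_six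
      have h3s : √3 ^ 2 = 3 := Real.sq_sqrt (by norm_num)
      have e1 : M.geomForm δ γ = -(√3 / 2) := by rw [hδγ, hx, hcos, hk]; ring
      have e2 : M.geomForm δ β = √3 / 2 := by rw [hδβ, hx, hcos, hk]; ring
      have hroot : (1 : ℝ) • γ + √3 • δ ∈ cs.roots := by
        convert reflect_mem_roots hδ.1.1 hγ.1 using 1
        rw [CoxeterMatrix.reflect, e1]
        module
      refine ⟨isPositiveRoot_of_nonneg_comb zero_le_one (by positivity) hγ.2 hδ.1.2 hroot,
        by positivity, ?_, ?_⟩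
      · rw [map_add, map_smul, map_smul, hγβ, M.geomForm_comm β δ, e2, hcos, smul_eq_mul,
          smul_eq_mul]
        linarith
      · rw [map_add, map_smul, map_smul, M.geomForm_comm α γ, hγα, M.geomForm_comm α δ, hk,
          hcos, smul_eq_mul, smul_eq_mul]
        nlinarith
    · intro δ _ _ δ' _ _ he
      exact smul_right_injective _ (by positivity) (add_left_cancel he)

end CoxeterSystem

/-! ### Comparison inside a finite dihedral system. -/

namespace CoxeterMatrix

variable {B : Type*} {M : CoxeterMatrix B}

theorem circlePoint_eq_comb (e₁ e₂ : B →₀ ℝ) {a b c : ℝ} (h : Real.sin (c - a) ≠ 0) :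
    circlePoint e₁ e₂ b = (Real.sin (c - b) / Real.sin (c - a)) • circlePoint e₁ e₂ a +
      (Real.sin (b - a) / Real.sin (c - a)) • circlePoint e₁ e₂ c := by
  simp only [circlePoint]
  match_scalars
  · field_simp
    rw [Real.sin_sub, Real.sin_sub, Real.sin_sub]
    ring
  · field_simp
    rw [Real.sin_sub, Real.sin_sub, Real.sin_sub]
    ring

theorem circlePoint_neg_arccos {e₁ e₂ : B →₀ ℝ} {p q : ℝ} (h : p ^ 2 + q ^ 2 = 1) (hq : q ≤ 0) :
    circlePoint e₁ e₂ (-Real.arccos p) = p • e₁ + q • e₂ := by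
  have hs : Real.sin (Real.arccos p) = -q := by
    rw [Real.sin_arccos, ← Real.sqrt_sq (neg_nonneg.2 hq)]
    congr 1
    linarith
  rw [circlePoint, Real.cos_neg, Real.sin_neg, hs, Real.cos_arccos (by nlinarith) (by nlinarith),
    neg_neg]

theorem IsOrthonormalPair.injOn_circlePoint {e₁ e₂ : B →₀ ℝ} (h : M.IsOrthonormalPair e₁ e₂) :
    Set.InjOn (circlePoint e₁ e₂) (Set.Icc 0 Real.pi) := by
  intro s hs t ht he
  have h1 := h.geomForm_circlePoint 0 s
  rw [he, h.geomForm_circlePoint, zero_sub, zero_sub, Real.cos_neg, Real.cos_neg] at h1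
  exact Real.injOn_cos hs ht h1.symm

end CoxeterMatrix

namespace CoxeterSystem

open CoxeterMatrix

variable {B W : Type*} [Group W] {M : CoxeterMatrix B} {cs : CoxeterSystem M W}

/-- If `t` runs through the angles of roots in a plane, and `ψ` is the smallest positive one, then
all of them are multiples of `ψ`. -/
theorem exists_int_mul_of_circlePoint_mem {e₁ e₂ : B →₀ ℝ} (h : M.IsOrthonormalPair e₁ e₂) {ψ : ℝ}
    (hψ : 0 < ψ) (h0 : circlePoint e₁ e₂ 0 ∈ cs.roots) (h1 : circlePoint e₁ e₂ ψ ∈ cs.roots)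
    (hmin : ∀ t, 0 < t → circlePoint e₁ e₂ t ∈ cs.roots → ψ ≤ t) {t : ℝ}
    (ht : circlePoint e₁ e₂ t ∈ cs.roots) : ∃ n : ℤ, t = n * ψ := by
  have step : ∀ a b, circlePoint e₁ e₂ a ∈ cs.roots → circlePoint e₁ e₂ b ∈ cs.roots →
      circlePoint e₁ e₂ (2 * a - b) ∈ cs.roots := fun a b ha hb => by
    have := neg_mem_roots (reflect_mem_roots ha hb)
    rwa [h.reflect_circlePoint, neg_neg] at this
  set n := ⌊t / (2 * ψ)⌋ with hn
  have hle : n * (2 * ψ) ≤ t := (le_div_iff₀ (by positivity)).1 (Int.floor_le _)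
  have hlt : t < (n + 1) * (2 * ψ) := (div_lt_iff₀ (by positivity)).1 (Int.lt_floor_add_one _)
  have hn' : circlePoint e₁ e₂ (n * ψ) ∈ cs.roots := circlePoint_mul_mem_roots h h0 h1 n
  have hn1 : circlePoint e₁ e₂ ((n + 1 : ℤ) * ψ) ∈ cs.roots :=
    circlePoint_mul_mem_roots h h0 h1 (n + 1)
  have hr : circlePoint e₁ e₂ (t - n * (2 * ψ)) ∈ cs.roots := by
    convert step _ _ h0 (step _ _ hn' ht) using 2
    ring
  have hr' : circlePoint e₁ e₂ ((n + 1) * (2 * ψ) - t) ∈ cs.roots := by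
    convert step _ _ hn1 ht using 2
    push_cast
    ring
  have h2 := hmin _ (by linarith) hr'
  rcases hle.eq_or_lt with he | hl
  · exact ⟨2 * n, by push_cast; linarith⟩
  · have h3 := hmin _ (by linarith) hr
    exact ⟨2 * n + 1, by push_cast; linarith⟩

theorem circlePoint_mem_inversionSet {w : W} {e₁ e₂ : B →₀ ℝ} {a b c : ℝ} (hab : a ≤ b)
    (hbc : b ≤ c) (hac : a < c) (hca : c < a + Real.pi) (ha : circlePoint e₁ e₂ a ∈ cs.inversionSet w)
    (hc : circlePoint e₁ e₂ c ∈ cs.inversionSet w) (hb : circlePoint e₁ e₂ b ∈ cs.roots) :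
    circlePoint e₁ e₂ b ∈ cs.inversionSet w := by
  have hs : 0 < Real.sin (c - a) := Real.sin_pos_of_pos_of_lt_pi (by linarith) (by linarith)
  rw [circlePoint_eq_comb e₁ e₂ hs.ne' (b := b)] at hb ⊢
  refine mem_inversionSet_of_nonneg_comb (div_nonneg ?_ hs.le) (div_nonneg ?_ hs.le) ha hc hb
  · exact Real.sin_nonneg_of_nonneg_of_le_pi (by linarith) (by linarith)
  · exact Real.sin_nonneg_of_nonneg_of_le_pi (by linarith) (by linarith)

theorem isPositiveRoot_circlePoint {e₁ e₂ : B →₀ ℝ} {a b c : ℝ} (hab : a ≤ b)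
    (hbc : b ≤ c) (hac : a < c) (hca : c < a + Real.pi)
    (ha : cs.IsPositiveRoot (circlePoint e₁ e₂ a)) (hc : cs.IsPositiveRoot (circlePoint e₁ e₂ c))
    (hb : circlePoint e₁ e₂ b ∈ cs.roots) : cs.IsPositiveRoot (circlePoint e₁ e₂ b) := by
  have hs : 0 < Real.sin (c - a) := Real.sin_pos_of_pos_of_lt_pi (by linarith) (by linarith)
  rw [circlePoint_eq_comb e₁ e₂ hs.ne' (b := b)] at hb ⊢
  refine isPositiveRoot_of_nonneg_comb (div_nonneg ?_ hs.le) (div_nonneg ?_ hs.le) ha.2 hc.2 hb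
  · exact Real.sin_nonneg_of_nonneg_of_le_pi (by linarith) (by linarith)
  · exact Real.sin_nonneg_of_nonneg_of_le_pi (by linarith) (by linarith)

/-- Comparison of the number of dominated roots along a finite dihedral reflection subgroup whose
positive roots lie at the angles `0, π / m, …, (m - 1) π / m`. -/
theorem encard_dominatedRoots_le_circlePoint {e₁ e₂ : B →₀ ℝ} (h : M.IsOrthonormalPair e₁ e₂)
    {m j : ℕ} {ψ : ℝ} (hψ : 0 < ψ) (hmψ : m * ψ = Real.pi) (hj : 1 ≤ j) (hjm : j + 2 ≤ m)
    (h0 : cs.IsPositiveRoot (circlePoint e₁ e₂ 0)) (h1 : cs.IsPositiveRoot (circlePoint e₁ e₂ ψ))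
    (hlast : cs.IsPositiveRoot (circlePoint e₁ e₂ (Real.pi - ψ))) :
    (cs.dominatedRoots (circlePoint e₁ e₂ 0)).encard ≤
      (cs.dominatedRoots (circlePoint e₁ e₂ (j * ψ))).encard := by
  have hpi := Real.pi_pos
  have hjm' : (j : ℝ) + 2 ≤ m := by exact_mod_cast hjm
  have hj' : (1 : ℝ) ≤ j := by exact_mod_cast hj
  have hneg : ∀ t, -circlePoint e₁ e₂ t = circlePoint e₁ e₂ (t - Real.pi) := fun t => by
    have := circlePoint_add_pi e₁ e₂ (t - Real.pi)
    rw [sub_add_cancel] at this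
    rw [this, neg_neg]
  have hneg' : ∀ t, -circlePoint e₁ e₂ t = circlePoint e₁ e₂ (t + Real.pi) := fun t =>
    (circlePoint_add_pi e₁ e₂ t).symm
  -- From angle 0 to `ψ`, both cases using the last positive root `γ`, at `π - ψ`: for `m = 3` the
  -- target is `s_γ α`, otherwise it is `s_α γ`.
  have hfirst : (cs.dominatedRoots (circlePoint e₁ e₂ 0)).encard ≤
      (cs.dominatedRoots (circlePoint e₁ e₂ ψ)).encard := by
    rcases Nat.lt_or_ge m 4 with hm | hm
    · obtain rfl : m = 3 := by omega
      push_cast at hmψ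
      have := encard_dominatedRoots_le_reflect h0 hlast (by
        rw [h.geomForm_circlePoint]
        apply Real.cos_nonpos_of_pi_div_two_le_of_le <;> linarith)
      rw [h.reflect_circlePoint, hneg] at this
      convert this using 4
      linarith
    · have e : ψ = Real.pi / m := by
        have : (m : ℝ) ≠ 0 := by positivity
        rw [← hmψ]; field_simp
      have := encard_dominatedRoots_le_of_angle hm h0 hlast (by
        rw [h.geomForm_circlePoint, zero_sub, Real.cos_neg, Real.cos_pi_sub, e])
      rw [h.reflect_circlePoint, hneg'] at this
      convert this using 4
      ring
  -- The root at `nψ` with `2n = i + j + m` reflects angle `iψ` to `jψ`, and its angle with the root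
  -- at `iψ` is not acute. The parity of `j + m` decides between `i = 0` and, after `hfirst`, `i =
  -- 1`.
  have hsecond : ∀ i n : ℕ, i ≤ 1 → i + j + m = 2 * n → cs.IsPositiveRoot (circlePoint e₁ e₂ (i * ψ)) →
      (cs.dominatedRoots (circlePoint e₁ e₂ (i * ψ))).encard ≤
        (cs.dominatedRoots (circlePoint e₁ e₂ (j * ψ))).encard := fun i n hi hn hpos => by
    have hn' : (i : ℝ) + j + m = 2 * n := by exact_mod_cast hn
    have hi' : (i : ℝ) ≤ 1 := by exact_mod_cast hi
    have e1 : (i : ℝ) * ψ + j * ψ + Real.pi = 2 * (n * ψ) := by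
      rw [← hmψ]; linear_combination ψ * hn'
    have e2 : (j : ℝ) * ψ + 2 * ψ ≤ Real.pi := by rw [← hmψ]; nlinarith
    have e3 : (i : ℝ) * ψ ≤ ψ := by nlinarith
    have e4 : ψ ≤ (j : ℝ) * ψ := by nlinarith
    have e5 : 0 ≤ (i : ℝ) * ψ := by positivity
    have e6 : (n : ℝ) + 1 ≤ m := by exact_mod_cast (by omega : n + 1 ≤ m)
    have e7 : ((n : ℝ) + 1) * ψ ≤ Real.pi := by rw [← hmψ]; gcongr
    have hκ : cs.IsPositiveRoot (circlePoint e₁ e₂ (n * ψ)) := by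
      refine isPositiveRoot_circlePoint (a := 0) (c := Real.pi - ψ) (by positivity) (by linarith)
        (by linarith) (by linarith) h0 hlast ?_
      exact_mod_cast circlePoint_mul_mem_roots h h0.1 h1.1 (n : ℤ)
    have := encard_dominatedRoots_le_reflect hpos hκ (by
      rw [h.geomForm_circlePoint]
      apply Real.cos_nonpos_of_pi_div_two_le_of_le <;> linarith)
    rw [h.reflect_circlePoint, hneg] at this
    convert this using 4
    linarith
  rcases Nat.even_or_odd' (j + m) with ⟨n, hn | hn⟩
  · have := hsecond 0 n (by omega) (by omega) (by simpa using h0)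
    simpa using this
  · have := hsecond 1 (n + 1) le_rfl (by omega) (by simpa using h1)
    exact hfirst.trans (by simpa using this)

/-- Comparison of the number of dominated roots for a short inversion `α` of `v` and another
inversion `ρ` in a rank two situation. -/
theorem encard_dominatedRoots_le_of_short {v : W} {α ρ μ : B →₀ ℝ} {a b : ℝ}
    (hα : α ∈ cs.shortInversions v) (hρ : ρ ∈ cs.inversionSet v)
    (hdom : ¬ cs.Dominates α ρ) (hμ : cs.IsNegativeRoot (cs.geomRep v⁻¹ μ)) (hμr : μ ∈ cs.roots)
    (ha : 0 < a) (hb : 0 < b) (hαμ : α = a • ρ + b • μ) :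
    (cs.dominatedRoots α).encard ≤ (cs.dominatedRoots ρ).encard := by
  have hpi := Real.pi_pos
  rw [mem_shortInversions_iff] at hα
  obtain ⟨hα, hshort⟩ := hα
  have hαα := geomForm_self hα.1.1
  have hρρ := geomForm_self hρ.1.1
  rcases le_or_gt 1 (M.geomForm α ρ) with hk | hk
  · exact ((dominates_or_dominates hα.1.1 hρ.1.1 hk).resolve_left hdom).encard_dominatedRoots_le
      hα.1 hρ.1
  have hk' := neg_one_lt_geomForm hα hρ
  set k := M.geomForm α ρ with hkd
  obtain ⟨φ, hφ⟩ : ∃ φ, φ = Real.arccos k := ⟨_, rfl⟩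
  have hφ0 : 0 < φ := by rw [hφ]; exact Real.arccos_pos.2 hk
  have hφπ : φ < Real.pi := by rw [hφ]; exact Real.arccos_lt_pi.2 hk'
  have hcos : Real.cos φ = k := by rw [hφ]; exact Real.cos_arccos hk'.le hk.le
  have hsin : 0 < Real.sin φ := Real.sin_pos_of_pos_of_lt_pi hφ0 hφπ
  have h := isOrthonormalPair_secondAxis (M := M) hαα hρρ (φ := φ) (by rw [← hkd, hcos]) hsin.ne'
  have hcρ := circlePoint_secondAxis (x := α) (y := ρ) hsin.ne'
  set e₂ := secondAxis α ρ φ with he₂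
  have hc0 : circlePoint α e₂ 0 = α := circlePoint_zero α e₂
  have h0r : circlePoint α e₂ 0 ∈ cs.inversionSet v := by rwa [hc0]
  have hφr : circlePoint α e₂ φ ∈ cs.inversionSet v := by rwa [hcρ]
  -- Roots between `α` and `ρ` on the circle are inversions of `v`, so there are finitely many and a
  -- smallest positive angle `ψ` exists.
  have hfin : {t | 0 < t ∧ t ≤ φ ∧ circlePoint α e₂ t ∈ cs.roots}.Finite := by
    refine Set.Finite.of_finite_image (f := circlePoint α e₂)
      ((cs.finite_inversionSet v).subset ?_) ?_
    · rintro _ ⟨t, ⟨ht0, htφ, ht⟩, rfl⟩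
      exact circlePoint_mem_inversionSet ht0.le htφ hφ0 (by linarith) h0r hφr ht
    · exact h.injOn_circlePoint.mono fun t ht => Set.mem_Icc.2 ⟨ht.1.le, ht.2.1.trans hφπ.le⟩
  obtain ⟨ψ, ⟨hψ0, hψφ, hψr⟩, hψmin⟩ := Set.exists_min_image
    {t | 0 < t ∧ t ≤ φ ∧ circlePoint α e₂ t ∈ cs.roots} id hfin ⟨φ, hφ0, le_rfl, hφr.1.1⟩
  have hmin : ∀ t, 0 < t → circlePoint α e₂ t ∈ cs.roots → ψ ≤ t := fun t ht hr => by
    rcases le_or_gt t φ with hle | hgt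
    · exact hψmin t ⟨ht, hle, hr⟩
    · linarith
  have hψv : circlePoint α e₂ ψ ∈ cs.inversionSet v :=
    circlePoint_mem_inversionSet hψ0.le hψφ hφ0 (by linarith) h0r hφr hψr
  have hint := fun t (ht : circlePoint α e₂ t ∈ cs.roots) =>
    exists_int_mul_of_circlePoint_mem h hψ0 h0r.1.1 hψr hmin ht
  have hpir : circlePoint α e₂ Real.pi ∈ cs.roots := by
    have := circlePoint_add_pi α e₂ 0
    rw [zero_add] at this
    rw [this]
    exact neg_mem_roots h0r.1.1
  obtain ⟨m, hm⟩ := hint _ hpir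
  obtain ⟨j, hj⟩ := hint _ hφr.1.1
  set p := b⁻¹ * (1 - a * Real.cos φ) with hp
  set q := -(b⁻¹ * (a * Real.sin φ)) with hq
  have hμpq : μ = p • α + q • e₂ := by
    have e1 : μ = b⁻¹ • (α - a • ρ) := by
      rw [hαμ, add_sub_cancel_left, smul_smul, inv_mul_cancel₀ hb.ne', one_smul]
    have e2 : ρ = Real.cos φ • α + Real.sin φ • e₂ := hcρ.symm
    rw [e1]
    conv_lhs => rw [e2]
    rw [hp, hq]
    module
  have hq0 : q < 0 := neg_neg_of_pos (by positivity)
  have hpq : p ^ 2 + q ^ 2 = 1 := by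
    have h1 := geomForm_self hμr
    rw [hμpq] at h1
    simp only [map_add, map_smul, LinearMap.add_apply, LinearMap.smul_apply, smul_eq_mul, h.fst,
      h.snd, h.fst_snd, M.geomForm_comm e₂ α] at h1
    linear_combination h1
  obtain ⟨χ, hχ⟩ : ∃ χ, χ = Real.arccos p := ⟨_, rfl⟩
  have hμχ : circlePoint α e₂ (-χ) = μ := by
    rw [hχ, circlePoint_neg_arccos hpq hq0.le, hμpq]
  have hcχ : Real.cos χ = p := by rw [hχ, Real.cos_arccos (by nlinarith) (by nlinarith)]
  have hsχ : Real.sin χ = -q := by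
    rw [hχ, Real.sin_arccos, ← Real.sqrt_sq (neg_nonneg.2 hq0.le)]
    congr 1
    linarith
  have hχ0 : 0 < χ := by
    rcases (hχ ▸ Real.arccos_nonneg p : 0 ≤ χ).eq_or_lt with h' | h'
    · rw [← h', Real.sin_zero] at hsχ
      linarith
    · exact h'
  have hχπ : χ ≤ Real.pi := hχ ▸ Real.arccos_le_pi p
  -- `α`, at angle 0, is a positive combination of `ρ`, at `φ`, and `μ`, at `-χ`; hence these two
  -- span an angle below `π`.
  have hφχ : φ + χ < Real.pi := by
    have h1 : 0 < Real.sin (φ + χ) := by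
      rw [Real.sin_add, hcχ, hsχ, hp, hq]
      have : Real.sin φ * (b⁻¹ * (1 - a * Real.cos φ)) +
        Real.cos φ * - -(b⁻¹ * (a * Real.sin φ)) = Real.sin φ * b⁻¹ := by ring
      rw [this]
      positivity
    by_contra! hc
    have h2 : 0 ≤ Real.sin (φ + χ - Real.pi) :=
      Real.sin_nonneg_of_nonneg_of_le_pi (by linarith) (by linarith)
    rw [Real.sin_sub_pi] at h2
    linarith
  have hχr : circlePoint α e₂ χ ∈ cs.roots := by
    have := neg_mem_roots (reflect_mem_roots h0r.1.1 (hμχ.symm ▸ hμr))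
    rw [h.reflect_circlePoint, neg_neg] at this
    convert this using 2
    ring
  have hψχ : ψ ≤ χ := hmin χ hχ0 hχr
  have hφ2r : circlePoint α e₂ (-ψ) ∈ cs.roots := by
    have := neg_mem_roots (reflect_mem_roots h0r.1.1 hψr)
    rw [h.reflect_circlePoint, neg_neg] at this
    convert this using 2
    ring
  -- The root at `-ψ` lies between `μ` and `α`, both made negative by `v⁻¹`.
  have hneg : cs.IsNegativeRoot (cs.geomRep v⁻¹ (circlePoint α e₂ (-ψ))) := by
    have hs : 0 < Real.sin (0 - -χ) := Real.sin_pos_of_pos_of_lt_pi (by linarith) (by linarith)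
    have hr := geomRep_mem_roots v⁻¹ hφ2r
    rw [circlePoint_eq_comb α e₂ hs.ne' (b := -ψ), map_add, map_smul, map_smul] at hr ⊢
    refine isNegativeRoot_of_nonneg_comb (div_nonneg ?_ hs.le) (div_nonneg ?_ hs.le) ?_
      h0r.2.2 hr
    · exact Real.sin_nonneg_of_nonneg_of_le_pi (by linarith) (by linarith)
    · exact Real.sin_nonneg_of_nonneg_of_le_pi (by linarith) (by linarith)
    · rw [hμχ]
      exact hμ.2
  -- The root at `-ψ` is the partner of the one at `ψ` under `s_α`. Were it positive, it would be an
  -- inversion by `hneg`, contradicting shortness of `α`. So `α` is a simple root of the plane.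
  have hlast : cs.IsPositiveRoot (circlePoint α e₂ (Real.pi - ψ)) := by
    have h1 : circlePoint α e₂ ψ ≠ α := fun he => by
      have h2 := h.injOn_circlePoint ⟨hψ0.le, by linarith⟩ ⟨le_rfl, hpi.le⟩ (he.trans hc0.symm)
      linarith
    have h2 := hshort _ hψv h1
    have e : -M.reflect α (circlePoint α e₂ ψ) = circlePoint α e₂ (-ψ) := by
      have := h.reflect_circlePoint 0 ψ
      rw [hc0] at this
      rw [this, neg_neg]
      congr 1
      ring
    rw [e] at h2
    have h3 : ¬ cs.IsPositiveRoot (circlePoint α e₂ (-ψ)) := fun hp => h2 ⟨hp, hneg⟩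
    rw [← isNegativeRoot_iff_not hφ2r, ← isPositiveRoot_neg, ← circlePoint_add_pi] at h3
    convert h3 using 2
    ring
  have hj1 : 1 ≤ j := by
    have : (0 : ℝ) < j := by
      by_contra! hc
      nlinarith
    exact_mod_cast this
  have hjm : j + 2 ≤ m := by
    have : ((j + 1 : ℤ) : ℝ) < m := by
      push_cast
      have : (j + 1) * ψ < m * ψ := by linarith
      exact lt_of_mul_lt_mul_right this hψ0.le
    have : j + 1 < m := by exact_mod_cast this
    omega
  lift j to ℕ using by omega
  lift m to ℕ using by omega
  have := encard_dominatedRoots_le_circlePoint h hψ0 (m := m) (j := j) (by exact_mod_cast hm.symm)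
    (by omega) (by omega) h0r.1 hψv.1 hlast
  rw [hc0] at this
  have e : (j : ℝ) * ψ = φ := by rw [hj]; simp
  rwa [e, hcρ] at this

end CoxeterSystem

/-! ### Depth, and descent from short inversions to right-descent roots. -/

namespace CoxeterSystem

open CoxeterMatrix

variable {B W : Type*} [Group W] {M : CoxeterMatrix B} {cs : CoxeterSystem M W}

variable (cs) in
/-- The depth of a root `θ`: the least length of an element which makes `θ` negative. -/
noncomputable def depth (θ : B →₀ ℝ) : ℕ :=
  sInf {n | ∃ g : W, cs.length g = n ∧ cs.IsNegativeRoot (cs.geomRep g θ)}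

theorem depth_le {θ : B →₀ ℝ} {g : W} (h : cs.IsNegativeRoot (cs.geomRep g θ)) :
    cs.depth θ ≤ cs.length g := Nat.sInf_le ⟨g, rfl, h⟩

theorem exists_length_eq_depth {θ : B →₀ ℝ} (h : θ ∈ cs.roots) :
    ∃ g : W, cs.length g = cs.depth θ ∧ cs.IsNegativeRoot (cs.geomRep g θ) := by
  obtain ⟨w, hw⟩ := exists_isNegativeRoot_geomRep_inv h
  exact Nat.sInf_mem (s := {n | ∃ g : W, cs.length g = n ∧ cs.IsNegativeRoot (cs.geomRep g θ)})
    ⟨_, w⁻¹, rfl, hw⟩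

theorem depth_geomRep_le {θ : B →₀ ℝ} (h : θ ∈ cs.roots) (g : W) :
    cs.depth (cs.geomRep g θ) ≤ cs.depth θ + cs.length g := by
  obtain ⟨k, hk, hn⟩ := exists_length_eq_depth h
  have h1 : cs.depth (cs.geomRep g θ) ≤ cs.length (k * g⁻¹) := depth_le (by
    rwa [← geomRep_mul, inv_mul_cancel_right])
  have h2 := cs.length_mul_le k g⁻¹
  rw [length_inv] at h2
  omega

theorem depth_simpleRoot_le (i : B) : cs.depth (M.simpleRoot i) ≤ 1 := by
  have h : cs.depth (M.simpleRoot i) ≤ cs.length (cs.simple i) := depth_le (by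
    rw [geomRep_simple_apply, M.reflect_self (M.geomForm_simpleRoot_self i), isNegativeRoot_neg]
    exact isPositiveRoot_simpleRoot i)
  rwa [length_simple] at h

/-- An element of minimal length making `θ` negative first maps `θ` to a simple root. -/
theorem exists_geomRep_eq_simpleRoot {θ : B →₀ ℝ} (h : cs.IsPositiveRoot θ) :
    ∃ (g : W) (r : B), cs.length g + 1 = cs.depth θ ∧ cs.geomRep g θ = M.simpleRoot r := by
  obtain ⟨g, hg, hn⟩ := exists_length_eq_depth h.1
  have h1 : g ≠ 1 := by
    rintro rfl
    rw [geomRep_one] at hn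
    exact h.not_isNegativeRoot hn
  obtain ⟨r, hr⟩ := cs.exists_leftDescent_of_ne_one h1
  rw [isLeftDescent_iff] at hr
  refine ⟨cs.simple r * g, r, by omega, ?_⟩
  by_contra hne
  have h2 : ¬ cs.IsNegativeRoot (cs.geomRep (cs.simple r * g) θ) := fun hc => by
    have := depth_le hc
    omega
  rw [not_isNegativeRoot_iff (geomRep_mem_roots _ h.1)] at h2
  have h3 := h2.reflect_simpleRoot hne
  rw [← geomRep_simple_apply (cs := cs), ← geomRep_mul, simple_mul_simple_cancel_left] at h3
  exact h3.not_isNegativeRoot hn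

theorem two_le_depth {θ : B →₀ ℝ} (h : cs.IsPositiveRoot θ) (hs : ∀ i, θ ≠ M.simpleRoot i) :
    2 ≤ cs.depth θ := by
  obtain ⟨g, r, hg, he⟩ := exists_geomRep_eq_simpleRoot h
  by_contra! hc
  have : cs.length g = 0 := by omega
  rw [length_eq_zero_iff] at this
  rw [this, geomRep_one] at he
  exact hs r he

/-- Take `g` of length one less than the depth of `θ` with `g θ` simple. If `g α_i > 0`, then `g`
already makes `s_i θ` negative. Otherwise `i` is a right descent of `g`, and the shorter `g s_i`
takes `s_i θ` to a simple root. -/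
theorem depth_reflect_simpleRoot_lt {θ : B →₀ ℝ} {i : B} (h : cs.IsPositiveRoot θ)
    (hi : θ ≠ M.simpleRoot i) (hc : 0 < M.geomForm (M.simpleRoot i) θ) :
    cs.depth (M.reflect (M.simpleRoot i) θ) < cs.depth θ := by
  obtain ⟨g, r, hg, he⟩ := exists_geomRep_eq_simpleRoot h
  rcases isPositiveRoot_or_isNegativeRoot
    (geomRep_mem_roots g (simpleRoot_mem_roots (cs := cs) i)) with hp | hn
  · have hne : cs.geomRep g (M.simpleRoot i) ≠ M.simpleRoot r := fun h' =>
      hi ((cs.geomRep g).injective (he.trans h'.symm))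
    obtain ⟨j, hj, hpos⟩ := hp.exists_apply_pos hne
    have e : cs.geomRep g (M.reflect (M.simpleRoot i) θ) = M.simpleRoot r -
        (2 * M.geomForm (M.simpleRoot i) θ) • cs.geomRep g (M.simpleRoot i) := by
      rw [CoxeterMatrix.reflect, map_sub, map_smul, he]
    have hroot : cs.geomRep g (M.reflect (M.simpleRoot i) θ) ∈ cs.roots :=
      geomRep_mem_roots g (reflect_mem_roots (simpleRoot_mem_roots i) h.1)
    have hneg : cs.IsNegativeRoot (cs.geomRep g (M.reflect (M.simpleRoot i) θ)) := by
      refine (isPositiveRoot_or_isNegativeRoot hroot).resolve_left fun hp' => ?_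
      have := hp'.2 j
      rw [e, Finsupp.sub_apply, Finsupp.smul_apply, simpleRoot, Finsupp.single_eq_of_ne hj,
        smul_eq_mul] at this
      nlinarith
    have := depth_le hneg
    omega
  · rw [← isRightDescent_iff_isNegativeRoot, isRightDescent_iff] at hn
    have h1 := depth_geomRep_le (cs := cs) (simpleRoot_mem_roots r) (g * cs.simple i)⁻¹
    have e : cs.geomRep (g * cs.simple i)⁻¹ (M.simpleRoot r) = M.reflect (M.simpleRoot i) θ := by
      rw [← he, mul_inv_rev, inv_simple, geomRep_mul, geomRep_inv_geomRep, geomRep_simple_apply]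
    rw [e, length_inv] at h1
    have := depth_simpleRoot_le (cs := cs) r
    omega

theorem exists_geomForm_simpleRoot_pos {θ : B →₀ ℝ} (h : cs.IsPositiveRoot θ) :
    ∃ i, 0 < M.geomForm (M.simpleRoot i) θ := by
  by_contra! hc
  have h1 := geomForm_self h.1
  have h2 : M.geomForm θ θ = ∑ i ∈ θ.support, θ i * M.geomForm (M.simpleRoot i) θ := by
    have hθ : θ = ∑ i ∈ θ.support, θ i • M.simpleRoot i := by
      conv_lhs => rw [← Finsupp.sum_single θ]
      simp [Finsupp.sum, simpleRoot]
    conv_lhs =>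
      enter [1]
      rw [hθ]
    simp [LinearMap.sum_apply]
  have h3 : ∑ i ∈ θ.support, θ i * M.geomForm (M.simpleRoot i) θ ≤ 0 :=
    Finset.sum_nonpos fun i _ => mul_nonpos_of_nonneg_of_nonpos (h.2 i) (hc i)
  linarith

theorem isPositiveRoot_neg_geomRep_inv {v : W} {α : B →₀ ℝ} (h : α ∈ cs.inversionSet v) :
    cs.IsPositiveRoot (-cs.geomRep v⁻¹ α) := isPositiveRoot_neg.2 h.2

theorem geomRep_inv_mul_simple (v : W) (i : B) (α : B →₀ ℝ) :
    cs.geomRep (v * cs.simple i)⁻¹ α = M.reflect (M.simpleRoot i) (cs.geomRep v⁻¹ α) := by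
  rw [mul_inv_rev, inv_simple, geomRep_mul, geomRep_simple_apply]

/-- The only new inversion `v α_i` has negative product with `α`, so its partner `-s_α v α_i` has
negative coordinate sum and is no inversion. -/
theorem mem_shortInversions_mul_simple {v : W} {α : B →₀ ℝ} {i : B}
    (hα : α ∈ cs.shortInversions v) (hi : ¬ cs.IsRightDescent v i)
    (hc : 0 < M.geomForm (M.simpleRoot i) (-cs.geomRep v⁻¹ α)) :
    α ∈ cs.shortInversions (v * cs.simple i) := by
  have hv := inversionSet_mul_simple hi
  rw [mem_shortInversions_iff] at hα ⊢
  have hαα := geomForm_self hα.1.1.1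
  have hvi := not_isRightDescent_iff_isPositiveRoot.1 hi
  have hform : M.geomForm α (cs.geomRep v (M.simpleRoot i)) < 0 := by
    have := cs.geomForm_geomRep v (cs.geomRep v⁻¹ α) (M.simpleRoot i)
    rw [geomRep_geomRep_inv] at this
    rw [this, M.geomForm_comm]
    rw [map_neg] at hc
    linarith
  have hnot : -M.reflect α (cs.geomRep v (M.simpleRoot i)) ∉ cs.inversionSet (v * cs.simple i) := by
    intro hm
    have h1 := hm.1.coordSum_pos
    simp only [CoxeterMatrix.reflect, map_neg, map_sub, map_smul, smul_eq_mul] at h1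
    nlinarith [hα.1.1.coordSum_pos, hvi.coordSum_pos]
  refine ⟨hv ▸ Set.mem_insert_of_mem _ hα.1, fun μ hμ hne hm => ?_⟩
  have hμ' := hμ
  rw [hv, Set.mem_insert_iff] at hμ'
  have hm' := hm
  rw [hv, Set.mem_insert_iff] at hm'
  rcases hμ' with rfl | hμ'
  · exact hnot hm
  rcases hm' with he | hm'
  · rw [← he, M.reflect_neg, M.reflect_reflect hαα, neg_neg] at hnot
    exact hnot hμ
  · exact hα.2 μ hμ' hne hm'

/-- An element `v` above `w` for which `α` is a short inversion that is not close to the end of `v`,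
with the corresponding depth as small as the distance to `w` allows. -/
structure IsDepthWitness (cs : CoxeterSystem M W) (w : W) (α : B →₀ ℝ) (v : W) : Prop where
  subset : cs.inversionSet w ⊆ cs.inversionSet v
  short : α ∈ cs.shortInversions v
  depth_add_le : cs.depth (-cs.geomRep v⁻¹ α) + cs.length (w⁻¹ * v) ≤
    cs.depth (-cs.geomRep w⁻¹ α)
  ne_simple : ∀ i, -cs.geomRep v⁻¹ α ≠ M.simpleRoot i

namespace IsDepthWitness

variable {w v : W} {α : B →₀ ℝ}

theorem isPositiveRoot (h : cs.IsDepthWitness w α v) : cs.IsPositiveRoot (-cs.geomRep v⁻¹ α) :=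
  isPositiveRoot_neg_geomRep_inv h.short.1

/-- Take `ρ = -v α_d`. The element `v s_d` still inverts `α` but not `ρ`, so `α` does not dominate
`ρ` and the rank-two comparison applies. The depth drops because `-w⁻¹ρ` is the image of a simple
root under `w⁻¹v`, while `-v⁻¹α` has depth at least 2. -/
theorem exists_shortInversions (h : cs.IsDepthWitness w α v) {d : B} (hd : cs.IsRightDescent v d)
    (hwd : ¬ cs.IsRightDescent (w⁻¹ * v) d) {ν : B →₀ ℝ} (hν : cs.IsPositiveRoot ν) {a b : ℝ}
    (ha : 0 < a) (hb : 0 < b) (he : -cs.geomRep v⁻¹ α = a • M.simpleRoot d + b • ν) :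
    ∃ ρ ∈ cs.shortInversions w, (cs.dominatedRoots α).encard ≤ (cs.dominatedRoots ρ).encard ∧
      cs.depth (-cs.geomRep w⁻¹ ρ) < cs.depth (-cs.geomRep w⁻¹ α) := by
  set ρ := -cs.geomRep v (M.simpleRoot d) with hρ
  have hρv : ρ ∈ cs.shortInversions v := rightDescentRoots_subset_shortInversions v ⟨d, hd, rfl⟩
  have e : -cs.geomRep w⁻¹ ρ = cs.geomRep (w⁻¹ * v) (M.simpleRoot d) := by
    rw [hρ, map_neg, neg_neg, geomRep_mul]
  have hρw : ρ ∈ cs.inversionSet w := by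
    refine ⟨hρv.1.1, ?_⟩
    rw [← isPositiveRoot_neg, e]
    exact not_isRightDescent_iff_isPositiveRoot.1 hwd
  refine ⟨ρ, mem_shortInversions_of_subset h.subset hρw hρv, ?_, ?_⟩
  · have hvρ : cs.geomRep v⁻¹ ρ = -M.simpleRoot d := by rw [hρ, map_neg, geomRep_inv_geomRep]
    refine encard_dominatedRoots_le_of_short h.short hρv.1 (μ := -cs.geomRep v ν) ?_ ?_
      (neg_mem_roots (geomRep_mem_roots v hν.1)) ha hb ?_
    · intro hdom
      have h1 := hdom (v * cs.simple d) (by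
        rw [geomRep_inv_mul_simple, ← isPositiveRoot_neg, ← M.reflect_neg]
        exact h.isPositiveRoot.reflect_simpleRoot (h.ne_simple d))
      rw [geomRep_inv_mul_simple, hvρ, M.reflect_neg, M.reflect_self (M.geomForm_simpleRoot_self d),
        neg_neg] at h1
      exact (isPositiveRoot_simpleRoot d).not_isNegativeRoot h1
    · rw [map_neg, geomRep_inv_geomRep, isNegativeRoot_neg]
      exact hν
    · have h1 := congrArg (fun x => -cs.geomRep v x) he
      simp only [map_neg, map_add, map_smul, geomRep_geomRep_inv, neg_neg] at h1
      rw [h1, hρ]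
      module
  · rw [e]
    have h1 := depth_geomRep_le (cs := cs) (simpleRoot_mem_roots d) (w⁻¹ * v)
    have h2 := depth_simpleRoot_le (cs := cs) d
    have h3 := two_le_depth h.isPositiveRoot h.ne_simple
    have h4 := h.depth_add_le
    omega

/-- If `q` were a right descent of `w⁻¹v`, both the depth over `v` and the distance to `w` would
drop on passing to `v s_q`, reaching `-w⁻¹α` in fewer steps than its depth. -/
theorem not_isRightDescent (h : cs.IsDepthWitness w α v) {q : B}
    (hq : 0 < M.geomForm (M.simpleRoot q) (-cs.geomRep v⁻¹ α)) :
    ¬ cs.IsRightDescent (w⁻¹ * v) q := fun hd => by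
  rw [isRightDescent_iff] at hd
  have h1 := depth_reflect_simpleRoot_lt h.isPositiveRoot (h.ne_simple q) hq
  have h2 := depth_geomRep_le (cs := cs)
    (reflect_mem_roots (simpleRoot_mem_roots q) h.isPositiveRoot.1) (w⁻¹ * v * cs.simple q)
  rw [← geomRep_simple_apply (cs := cs), ← geomRep_mul, simple_mul_simple_cancel_right, map_neg,
    geomRep_mul, geomRep_geomRep_inv, ← map_neg, geomRep_simple_apply] at h2
  rw [map_neg] at h2
  have h3 := h.depth_add_le
  omega

theorem mul_simple (h : cs.IsDepthWitness w α v) {q : B} (hd : ¬ cs.IsRightDescent v q)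
    (hq : 0 < M.geomForm (M.simpleRoot q) (-cs.geomRep v⁻¹ α))
    (hne : ∀ i, M.reflect (M.simpleRoot q) (-cs.geomRep v⁻¹ α) ≠ M.simpleRoot i) :
    cs.IsDepthWitness w α (v * cs.simple q) := by
  have h1 := depth_reflect_simpleRoot_lt h.isPositiveRoot (h.ne_simple q) hq
  refine ⟨h.subset.trans ?_, mem_shortInversions_mul_simple h.short hd hq, ?_, ?_⟩
  · rw [inversionSet_mul_simple hd]
    exact Set.subset_insert _ _
  · rw [geomRep_inv_mul_simple, ← M.reflect_neg]
    have h2 := cs.length_mul_le (w⁻¹ * v) (cs.simple q)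
    rw [length_simple, mul_assoc] at h2
    have h3 := h.depth_add_le
    omega
  · intro i
    rw [geomRep_inv_mul_simple, ← M.reflect_neg]
    exact hne i

/-- A step back towards `w` raises the depth by at most one and lowers the distance by one. The new
root cannot be simple, as the depth of `-w⁻¹α` would then be at most the distance from `v` to `w`.
-/
theorem mul_simple_of_isRightDescent (h : cs.IsDepthWitness w α v)
    (hα : α ∈ cs.inversionSet w) {p : B} (hd : cs.IsRightDescent (w⁻¹ * v) p) :
    cs.IsDepthWitness w α (v * cs.simple p) := by
  rw [isRightDescent_iff] at hd
  have hl := inversionSet_subset_iff.1 h.subset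
  have e : w⁻¹ * (v * cs.simple p) = w⁻¹ * v * cs.simple p := by rw [mul_assoc]
  have h1 := cs.length_mul_le w (w⁻¹ * v * cs.simple p)
  rw [← mul_assoc, mul_inv_cancel_left] at h1
  have h2 := cs.length_mul_simple v p
  have hsub : cs.inversionSet w ⊆ cs.inversionSet (v * cs.simple p) :=
    inversionSet_subset_iff.2 (by rw [e]; omega)
  have hdv : cs.IsRightDescent v p := by unfold IsRightDescent; omega
  have hsub' : cs.inversionSet (v * cs.simple p) ⊆ cs.inversionSet v := by
    have := inversionSet_mul_simple (cs.isRightDescent_iff_not_isRightDescent_mul.1 hdv)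
    rw [simple_mul_simple_cancel_right] at this
    rw [this]
    exact Set.subset_insert _ _
  have hθ : cs.geomRep (cs.simple p) (-cs.geomRep v⁻¹ α) =
      -cs.geomRep (v * cs.simple p)⁻¹ α := by
    rw [geomRep_inv_mul_simple, geomRep_simple_apply, M.reflect_neg]
  have h3 := depth_geomRep_le h.isPositiveRoot.1 (cs.simple p)
  rw [length_simple, hθ] at h3
  have h4 := h.depth_add_le
  refine ⟨hsub, mem_shortInversions_of_subset hsub' (hsub hα) h.short, by rw [e]; omega, ?_⟩
  intro i hi
  have h5 := depth_simpleRoot_le (cs := cs) i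
  have h6 := two_le_depth h.isPositiveRoot h.ne_simple
  have h7 := depth_geomRep_le (cs := cs) (simpleRoot_mem_roots i) (w⁻¹ * v * cs.simple p)
  rw [← hi, map_neg, ← e, geomRep_mul, geomRep_geomRep_inv, hi, e] at h7
  omega

end IsDepthWitness

/-- Take a witness `v` of least depth and a simple `α_q` with positive product with `θ = -v⁻¹α`. If
`q` is a right descent of `v`, then `-v α_q` serves. If not, minimality forces `s_q θ` to be simple,
so `θ` lies in the span of two simple roots, and the search moves back towards `w`. -/
theorem exists_shortInversions_depth_lt {w : W} {α : B →₀ ℝ} (hα : α ∈ cs.shortInversions w)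
    (hne : ∀ i, -cs.geomRep w⁻¹ α ≠ M.simpleRoot i) :
    ∃ ρ ∈ cs.shortInversions w, (cs.dominatedRoots α).encard ≤ (cs.dominatedRoots ρ).encard ∧
      cs.depth (-cs.geomRep w⁻¹ ρ) < cs.depth (-cs.geomRep w⁻¹ α) := by
  have hw : cs.IsDepthWitness w α w := ⟨subset_rfl, hα, by simp, hne⟩
  obtain ⟨v, hv, hvmin⟩ := WellFounded.has_min
    (measure fun v : W => cs.depth (-cs.geomRep v⁻¹ α)).wf {v | cs.IsDepthWitness w α v} ⟨w, hw⟩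
  replace hv : cs.IsDepthWitness w α v := hv
  replace hvmin : ∀ v', cs.IsDepthWitness w α v' →
      cs.depth (-cs.geomRep v⁻¹ α) ≤ cs.depth (-cs.geomRep v'⁻¹ α) :=
    fun v' hv' => not_lt.1 (hvmin v' hv')
  obtain ⟨q, hq⟩ := exists_geomForm_simpleRoot_pos hv.isPositiveRoot
  have hθ := hv.isPositiveRoot
  by_cases hd : cs.IsRightDescent v q
  · set θ := -cs.geomRep v⁻¹ α with hθd
    set k := M.geomForm (M.simpleRoot q) θ with hk
    have hroot : -M.reflect θ (M.simpleRoot q) ∈ cs.roots :=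
      neg_mem_roots (reflect_mem_roots hθ.1 (simpleRoot_mem_roots q))
    have e : -M.reflect θ (M.simpleRoot q) = (2 * k) • θ - M.simpleRoot q := by
      rw [CoxeterMatrix.reflect, M.geomForm_comm, ← hk]
      module
    have hpos : cs.IsPositiveRoot (-M.reflect θ (M.simpleRoot q)) := by
      refine (isPositiveRoot_or_isNegativeRoot hroot).resolve_right fun hn => ?_
      obtain ⟨j, hj, hjpos⟩ := hθ.exists_apply_pos (hv.ne_simple q)
      have := hn.2 j
      rw [e, Finsupp.sub_apply, Finsupp.smul_apply, simpleRoot, Finsupp.single_eq_of_ne hj,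
        smul_eq_mul] at this
      nlinarith
    refine hv.exists_shortInversions hd (hv.not_isRightDescent hq) hpos (a := 1 / (2 * k))
      (b := 1 / (2 * k)) (by positivity) (by positivity) ?_
    rw [e, ← hθd]
    match_scalars <;> field_simp
    ring
  · obtain ⟨r, hr⟩ : ∃ r, M.reflect (M.simpleRoot q) (-cs.geomRep v⁻¹ α) = M.simpleRoot r := by
      by_contra! hc
      have h1 := hvmin _ (hv.mul_simple hd hq hc)
      have h2 := depth_reflect_simpleRoot_lt hθ (hv.ne_simple q) hq
      rw [geomRep_inv_mul_simple, ← M.reflect_neg] at h1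
      omega
    have hspan : ∃ a b : ℝ, -cs.geomRep v⁻¹ α = a • M.simpleRoot q + b • M.simpleRoot r := by
      have h1 := M.reflect_reflect (M.geomForm_simpleRoot_self q) (-cs.geomRep v⁻¹ α)
      rw [hr] at h1
      exact ⟨-(2 * M.geomForm (M.simpleRoot q) (M.simpleRoot r)), 1, by
        rw [← h1, CoxeterMatrix.reflect]; module⟩
    -- Among witnesses whose root is spanned by `α_q` and `α_r`, take one closest to `w`: then
    -- neither is a right descent of `w⁻¹u`. But one of them is a right descent of `u`, since
    -- otherwise `-α`, a nonnegative combination of `u α_q` and `u α_r`, would be positive.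
    obtain ⟨u, ⟨hu, hus⟩, humin⟩ := WellFounded.has_min
      (measure fun v : W => cs.length (w⁻¹ * v)).wf {v | cs.IsDepthWitness w α v ∧
        ∃ a b : ℝ, -cs.geomRep v⁻¹ α = a • M.simpleRoot q + b • M.simpleRoot r} ⟨v, hv, hspan⟩
    have humin' : ∀ p, p = q ∨ p = r → ¬ cs.IsRightDescent (w⁻¹ * u) p := fun p hp hdp => by
      refine humin (u * cs.simple p) ⟨hu.mul_simple_of_isRightDescent hα.1 hdp, ?_⟩ ?_
      · obtain ⟨a, b, hab⟩ := hus
        rw [geomRep_inv_mul_simple, ← M.reflect_neg, hab, CoxeterMatrix.reflect]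
        rcases hp with rfl | rfl
        · exact ⟨_, _, by rw [add_sub_right_comm, ← sub_smul]⟩
        · exact ⟨_, _, by rw [add_sub_assoc, ← sub_smul]⟩
      · change cs.length (w⁻¹ * (u * cs.simple p)) < cs.length (w⁻¹ * u)
        rw [← mul_assoc]
        exact hdp
    have hqr : q ≠ r := by
      rintro rfl
      have h1 := M.reflect_reflect (M.geomForm_simpleRoot_self q) (-cs.geomRep v⁻¹ α)
      rw [hr, M.reflect_self (M.geomForm_simpleRoot_self q)] at h1
      rw [← h1] at hθ
      exact (isPositiveRoot_simpleRoot q).not_isNegativeRoot (isPositiveRoot_neg.1 hθ)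
    obtain ⟨a, b, hab⟩ := hus
    have hup := hu.isPositiveRoot
    have haq : (-cs.geomRep u⁻¹ α) q = a := by
      rw [hab]
      simp [simpleRoot, hqr]
    have hbr : (-cs.geomRep u⁻¹ α) r = b := by
      rw [hab]
      simp [simpleRoot, hqr.symm]
    have ha0 : 0 ≤ a := haq ▸ hup.2 q
    have hb0 : 0 ≤ b := hbr ▸ hup.2 r
    have ha : 0 < a := by
      refine ha0.lt_of_ne fun h0 => hu.ne_simple r ?_
      rw [← h0, zero_smul, zero_add] at hab
      exact hup.eq_of_smul_eq (isPositiveRoot_simpleRoot r) hab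
    have hb : 0 < b := by
      refine hb0.lt_of_ne fun h0 => hu.ne_simple q ?_
      rw [← h0, zero_smul, add_zero] at hab
      exact hup.eq_of_smul_eq (isPositiveRoot_simpleRoot q) hab
    by_cases hdq : cs.IsRightDescent u q
    · exact hu.exists_shortInversions hdq (humin' q (Or.inl rfl)) (isPositiveRoot_simpleRoot r)
        ha hb hab
    · by_cases hdr : cs.IsRightDescent u r
      · exact hu.exists_shortInversions hdr (humin' r (Or.inr rfl)) (isPositiveRoot_simpleRoot q)
          hb ha (by rw [hab, add_comm])
      · exfalso
        rw [not_isRightDescent_iff_isPositiveRoot] at hdq hdr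
        have h1 := congrArg (fun x => cs.geomRep u x) hab
        simp only [map_neg, map_add, map_smul, geomRep_geomRep_inv] at h1
        have h2 : cs.IsPositiveRoot (-α) := by
          have hr := neg_mem_roots hα.1.1.1
          rw [h1] at hr ⊢
          exact isPositiveRoot_of_nonneg_comb ha0 hb0 hdq.2 hdr.2 hr
        exact hα.1.1.not_isNegativeRoot (isPositiveRoot_neg.1 h2)

/-- The maximal number of roots dominated by a short inversion is attained at a right descent. -/
theorem exists_rightDescentRoots_encard_le {w : W} {α : B →₀ ℝ} (hα : α ∈ cs.shortInversions w) :
    ∃ ρ ∈ cs.rightDescentRoots w,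
      (cs.dominatedRoots α).encard ≤ (cs.dominatedRoots ρ).encard := by
  induction hn : cs.depth (-cs.geomRep w⁻¹ α) using Nat.strong_induction_on generalizing α with
  | _ n ih =>
  subst hn
  by_cases hs : ∃ i, -cs.geomRep w⁻¹ α = M.simpleRoot i
  · obtain ⟨i, hi⟩ := hs
    have e : α = -cs.geomRep w (M.simpleRoot i) := by
      rw [← hi, map_neg, geomRep_geomRep_inv, neg_neg]
    refine ⟨α, ⟨i, ?_, e⟩, le_rfl⟩
    rw [isRightDescent_iff_isNegativeRoot, ← isPositiveRoot_neg, ← e]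
    exact hα.1.1
  · push Not at hs
    obtain ⟨ρ, hρ, hle, hlt⟩ := exists_shortInversions_depth_lt hα hs
    obtain ⟨ρ', hρ', hle'⟩ := ih _ hlt hρ rfl
    exact ⟨ρ', hρ', hle.trans hle'⟩

end CoxeterSystem

/-! ### Low elements as gates, and join-irreducibility. -/

namespace CoxeterSystem

variable {B W : Type*} [Group W] {M : CoxeterMatrix B} {cs : CoxeterSystem M W}

theorem mem_lowElements_of_rightDescentRoots_subset {m : ℕ} {w : W}
    (h : cs.rightDescentRoots w ⊆ cs.elementaryRoots m) : w ∈ cs.lowElements m := fun α hα => by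
  obtain ⟨ρ, hρ, hle⟩ := exists_rightDescentRoots_encard_le hα
  exact mem_elementaryRoots_iff.2 ⟨hα.1.1, hle.trans (mem_elementaryRoots_iff.1 (h hρ)).2⟩

theorem inversionSet_subset_of_elementaryInversionSet_subset [Finite B] {m : ℕ} {x y : W}
    (hx : x ∈ cs.lowElements m) (h : cs.elementaryInversionSet m x ⊆ cs.inversionSet y) :
    cs.inversionSet x ⊆ cs.inversionSet y :=
  inversionSet_subset_of_shortInversions_subset fun _ hβ => h ⟨hβ.1, hx hβ⟩

theorem inversionSet_eq_insert {w : W} {i : B} (h : cs.IsRightDescent w i) :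
    cs.inversionSet w =
      insert (-cs.geomRep w (M.simpleRoot i)) (cs.inversionSet (w * cs.simple i)) := by
  have := inversionSet_mul_simple (cs.isRightDescent_iff_not_isRightDescent_mul.1 h)
  rwa [simple_mul_simple_cancel_right, geomRep_mul, geomRep_simple_apply,
    M.reflect_self (M.geomForm_simpleRoot_self i), map_neg] at this

theorem inversionSet_mul_simple_subset {w : W} {i : B} (h : cs.IsRightDescent w i) :
    cs.inversionSet (w * cs.simple i) ⊆ cs.inversionSet w := by
  rw [inversionSet_eq_insert h]
  exact Set.subset_insert _ _

theorem neg_geomRep_simpleRoot_notMem (w : W) (i : B) :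
    -cs.geomRep w (M.simpleRoot i) ∉ cs.inversionSet (w * cs.simple i) := by
  have := geomRep_simpleRoot_notMem_inversionSet (cs := cs) (w * cs.simple i) i
  rwa [geomRep_mul, geomRep_simple_apply, M.reflect_self (M.geomForm_simpleRoot_self i),
    map_neg] at this

theorem not_inversionSet_subset_mul_simple {w : W} {i : B} (h : cs.IsRightDescent w i) :
    ¬ cs.inversionSet w ⊆ cs.inversionSet (w * cs.simple i) := fun hs =>
  neg_geomRep_simpleRoot_notMem w i (hs (inversionSet_eq_insert h ▸ Set.mem_insert _ _))

theorem exists_isRightDescent_of_inversionSet_subset {a g : W}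
    (h : cs.inversionSet a ⊆ cs.inversionSet g) (hne : a ≠ g) :
    ∃ j, cs.IsRightDescent g j ∧ cs.inversionSet a ⊆ cs.inversionSet (g * cs.simple j) := by
  rw [inversionSet_subset_iff] at h
  have hu : a⁻¹ * g ≠ 1 := fun he => hne (inv_mul_eq_one.1 he)
  obtain ⟨j, hj⟩ := cs.exists_rightDescent_of_ne_one hu
  rw [isRightDescent_iff, mul_assoc] at hj
  have h1 := cs.length_mul_le a (a⁻¹ * (g * cs.simple j))
  rw [mul_inv_cancel_left] at h1
  have h2 := cs.length_mul_simple g j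
  exact ⟨j, by unfold IsRightDescent; omega, inversionSet_subset_iff.2 (by omega)⟩

variable (cs) in
-- Removing a right descent deletes a single root from the inversion set. If that root is not
-- `m`-elementary, the part stays the same.
theorem exists_lowElements (m : ℕ) (y : W) :
    ∃ g ∈ cs.lowElements m, cs.elementaryInversionSet m g = cs.elementaryInversionSet m y ∧
      cs.inversionSet g ⊆ cs.inversionSet y := by
  induction hn : cs.length y using Nat.strong_induction_on generalizing y with
  | _ n ih =>
  subst hn
  by_cases h : cs.rightDescentRoots y ⊆ cs.elementaryRoots m
  · exact ⟨y, mem_lowElements_of_rightDescentRoots_subset h, rfl, subset_rfl⟩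
  · obtain ⟨_, ⟨i, hi, rfl⟩, hne⟩ := Set.not_subset.1 h
    obtain ⟨g, hg, he, hs⟩ := ih _ hi (y * cs.simple i) rfl
    refine ⟨g, hg, he.trans ?_, hs.trans (inversionSet_mul_simple_subset hi)⟩
    rw [elementaryInversionSet, elementaryInversionSet, inversionSet_eq_insert hi,
      Set.insert_inter_of_notMem hne]

theorem rightWeakOrder_le_iff {x y : W} :
    cs.rightWeakOrder.le x y ↔ cs.inversionSet x ⊆ cs.inversionSet y :=
  inversionSet_subset_iff.symm

theorem inversionSet_injective : Function.Injective cs.inversionSet := fun _ _ h =>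
  cs.rightWeakOrder.le_antisymm _ _ (rightWeakOrder_le_iff.2 h.subset)
    (rightWeakOrder_le_iff.2 h.superset)

theorem isGate_iff {X : Set W} {g : W} :
    cs.IsGate X g ↔ g ∈ X ∧ ∀ x ∈ X, cs.inversionSet g ⊆ cs.inversionSet x :=
  and_congr_right fun _ => forall₂_congr fun _ _ => rightWeakOrder_le_iff

theorem mem_classes_shiPartition {m : ℕ} {X : Set W} : X ∈ (cs.shiPartition m).classes ↔
    ∃ y, X = {x | cs.elementaryInversionSet m x = cs.elementaryInversionSet m y} := Iff.rfl

theorem isGate_of_mem_lowElements [Finite B] {m : ℕ} {g : W} (hg : g ∈ cs.lowElements m) {y : W}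
    (h : cs.elementaryInversionSet m g = cs.elementaryInversionSet m y) :
    cs.IsGate {x | cs.elementaryInversionSet m x = cs.elementaryInversionSet m y} g := by
  refine isGate_iff.2 ⟨h, fun x hx => ?_⟩
  refine inversionSet_subset_of_elementaryInversionSet_subset hg ?_
  rw [h.trans (Eq.symm hx)]
  exact Set.inter_subset_left

theorem isGated_shiPartition [Finite B] (m : ℕ) : cs.IsGated (cs.shiPartition m) := fun X hX => by
  obtain ⟨y, rfl⟩ := mem_classes_shiPartition.1 hX
  obtain ⟨g, hg, he, -⟩ := cs.exists_lowElements m y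
  exact ⟨g, isGate_of_mem_lowElements hg he⟩

theorem gates_shiPartition [Finite B] (m : ℕ) :
    cs.gates (cs.shiPartition m) = cs.lowElements m := by
  ext g
  constructor
  · rintro ⟨X, hX, hg⟩
    obtain ⟨y, rfl⟩ := mem_classes_shiPartition.1 hX
    obtain ⟨g', hg', he, -⟩ := cs.exists_lowElements m y
    have h1 := (isGate_iff.1 hg).2 g' he
    have h2 := (isGate_iff.1 (isGate_of_mem_lowElements hg' he)).2 g (isGate_iff.1 hg).1
    rwa [inversionSet_injective (h1.antisymm h2)]
  · exact fun hg => ⟨_, mem_classes_shiPartition.2 ⟨g, rfl⟩, isGate_of_mem_lowElements hg rfl⟩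

theorem shortInversions_one : cs.shortInversions 1 = ∅ :=
  Set.subset_empty_iff.1 (inversionSet_one (cs := cs) ▸ shortInversions_subset 1)

theorem one_mem_lowElements (m : ℕ) : (1 : W) ∈ cs.lowElements m := by
  rw [lowElements, Set.mem_ofPred_eq, shortInversions_one]
  exact Set.empty_subset _

/-- Join-irreducibility of low elements in terms of inclusions of inversion sets. -/
theorem mem_joinIrreducibles_iff {P : Set W} {g : W} : g ∈ cs.joinIrreducibles P ↔
    g ∈ P ∧ (∃ a ∈ P, cs.inversionSet a ⊆ cs.inversionSet g ∧ a ≠ g) ∧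
      ∀ a ∈ P, ∀ b ∈ P, cs.inversionSet a ⊆ cs.inversionSet g →
        cs.inversionSet b ⊆ cs.inversionSet g →
        (∀ c ∈ P, cs.inversionSet a ⊆ cs.inversionSet c →
          cs.inversionSet b ⊆ cs.inversionSet c → cs.inversionSet g ⊆ cs.inversionSet c) →
        g = a ∨ g = b := by
  let := cs.rightWeakOrder
  have hle : ∀ x y : P, x ≤ y ↔ cs.inversionSet x ⊆ cs.inversionSet y := fun x y =>
    rightWeakOrder_le_iff
  have hmin : ∀ x : P, ¬ IsMin x ↔
      ∃ a ∈ P, cs.inversionSet a ⊆ cs.inversionSet x ∧ a ≠ x := fun x => by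
    rw [not_isMin_iff]
    constructor
    · rintro ⟨a, ha⟩
      exact ⟨a, a.2, (hle _ _).1 ha.le, fun h => ha.ne (Subtype.ext h)⟩
    · rintro ⟨a, ha, h1, h2⟩
      have h3 : (⟨a, ha⟩ : P) ≤ x := (hle ⟨a, ha⟩ x).2 h1
      exact ⟨⟨a, ha⟩, lt_of_le_of_ne h3 fun h => h2 (congrArg Subtype.val h)⟩
  have hlub : ∀ a b x : P, IsLUB {a, b} x ↔ cs.inversionSet a ⊆ cs.inversionSet x ∧
      cs.inversionSet b ⊆ cs.inversionSet x ∧ ∀ c : P, cs.inversionSet a ⊆ cs.inversionSet c →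
          cs.inversionSet b ⊆ cs.inversionSet c → cs.inversionSet x ⊆ cs.inversionSet c :=
      fun a b x => by
    constructor
    · intro h
      refine ⟨(hle a x).1 (h.1 (Set.mem_insert a _)),
        (hle b x).1 (h.1 (Set.mem_insert_of_mem a rfl)), fun c h1 h2 => (hle x c).1 (h.2 ?_)⟩
      rintro _ (rfl | rfl)
      exacts [(hle _ c).2 h1, (hle _ c).2 h2]
    · rintro ⟨h1, h2, h3⟩
      refine ⟨?_, fun c hc => (hle x c).2 (h3 c ((hle a c).1 (hc (Set.mem_insert a _)))
        ((hle b c).1 (hc (Set.mem_insert_of_mem a rfl))))⟩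
      rintro _ (rfl | rfl)
      exacts [(hle _ x).2 h1, (hle _ x).2 h2]
  constructor
  · rintro ⟨hg, h1, h2⟩
    refine ⟨hg, (hmin ⟨g, hg⟩).1 h1, fun a ha b hb hag hbg hc => ?_⟩
    have := h2 ⟨a, ha⟩ ⟨b, hb⟩
      ((hlub ⟨a, ha⟩ ⟨b, hb⟩ ⟨g, hg⟩).2 ⟨hag, hbg, fun c => hc c c.2⟩)
    exact this.imp (congrArg Subtype.val) (congrArg Subtype.val)
  · rintro ⟨hg, h1, h2⟩
    refine ⟨hg, (hmin ⟨g, hg⟩).2 h1, fun a b hab => ?_⟩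
    obtain ⟨hag, hbg, hc⟩ := (hlub a b ⟨g, hg⟩).1 hab
    exact (h2 a a.2 b b.2 hag hbg fun c hcP => hc ⟨c, hcP⟩).imp
      (fun h => Subtype.ext h) (fun h => Subtype.ext h)

theorem tight_lowElements [Finite B] (m : ℕ) :
    cs.tight (cs.lowElements m) = cs.joinIrreducibles (cs.lowElements m) := by
  ext g
  rw [mem_joinIrreducibles_iff]
  refine and_congr_right fun hg => ?_
  rw [Set.encard_eq_one]
  constructor
  · rintro ⟨β, hβ⟩
    obtain ⟨i, hi, rfl⟩ : β ∈ cs.rightDescentRoots g := hβ ▸ Set.mem_singleton β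
    have huniq : ∀ j, cs.IsRightDescent g j → j = i := fun j hj => by
      have hmem : -cs.geomRep g (M.simpleRoot j) ∈ cs.rightDescentRoots g := ⟨j, hj, rfl⟩
      rw [hβ, Set.mem_singleton_iff, neg_inj] at hmem
      exact Finsupp.single_left_injective one_ne_zero ((cs.geomRep g).injective hmem)
    refine ⟨⟨1, one_mem_lowElements m, by rw [inversionSet_one]; exact Set.empty_subset _, ?_⟩, ?_⟩
    · rintro rfl
      exact cs.not_isRightDescent_one i hi
    · intro a ha b hb hag hbg hlub
      by_contra! hc
      -- `h` is the low element in the part of `g s_i`. Every low element strictly below `g` lies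
      -- below `g s_i`, as `i` is the only descent, and hence below `h`. So `h` is an upper bound of
      -- `a` and `b` that is not above `g`.
      obtain ⟨h, hh, he, hhs⟩ := cs.exists_lowElements m (g * cs.simple i)
      have key : ∀ a ∈ cs.lowElements m, cs.inversionSet a ⊆ cs.inversionSet g → g ≠ a →
          cs.inversionSet a ⊆ cs.inversionSet h := fun a ha hag hne => by
        obtain ⟨j, hj, hs⟩ := exists_isRightDescent_of_inversionSet_subset hag hne.symm
        rw [huniq j hj] at hs
        refine inversionSet_subset_of_elementaryInversionSet_subset ha fun β hβ => ?_
        have : β ∈ cs.elementaryInversionSet m h := by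
          rw [he]
          exact ⟨hs hβ.1, hβ.2⟩
        exact this.1
      exact not_inversionSet_subset_mul_simple hi
        ((hlub h hh (key a ha hag hc.1) (key b hb hbg hc.2)).trans hhs)
  · rintro ⟨⟨a, -, hag, hne⟩, hirr⟩
    obtain ⟨i, hi, -⟩ := exists_isRightDescent_of_inversionSet_subset hag hne
    refine ⟨-cs.geomRep g (M.simpleRoot i), Set.eq_singleton_iff_unique_mem.2 ⟨⟨i, hi, rfl⟩, ?_⟩⟩
    rintro _ ⟨j, hj, rfl⟩
    by_contra hij
    obtain ⟨x, hx, hxe, hxs⟩ := cs.exists_lowElements m (g * cs.simple i)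
    obtain ⟨y, hy, hye, hys⟩ := cs.exists_lowElements m (g * cs.simple j)
    -- `Φ(g s_i)` and `Φ(g s_j)` omit different roots, so they cover `Φ(g)`. Their `m`-elementary
    -- parts are those of `x` and `y`, so any `c` above both contains all `m`-elementary inversions
    -- of the low element `g`.
    have hjoin : ∀ c ∈ cs.lowElements m, cs.inversionSet x ⊆ cs.inversionSet c →
        cs.inversionSet y ⊆ cs.inversionSet c → cs.inversionSet g ⊆ cs.inversionSet c := by
      intro c _ hxc hyc
      refine inversionSet_subset_of_elementaryInversionSet_subset hg fun β hβ => ?_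
      by_cases hβi : β ∈ cs.inversionSet (g * cs.simple i)
      · have : β ∈ cs.elementaryInversionSet m x := by rw [hxe]; exact ⟨hβi, hβ.2⟩
        exact hxc this.1
      · have h1 := hβ.1
        rw [inversionSet_eq_insert hi, Set.mem_insert_iff] at h1
        have h2 := h1.resolve_right hβi
        have h3 := hβ.1
        rw [inversionSet_eq_insert hj, Set.mem_insert_iff] at h3
        have h4 := h3.resolve_left fun h => hij (h.symm.trans h2)
        have : β ∈ cs.elementaryInversionSet m y := by rw [hye]; exact ⟨h4, hβ.2⟩
        exact hyc this.1
    rcases hirr x hx y hy (hxs.trans (inversionSet_mul_simple_subset hi))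
      (hys.trans (inversionSet_mul_simple_subset hj)) hjoin with h | h
    · rw [← h] at hxs
      exact not_inversionSet_subset_mul_simple hi hxs
    · rw [← h] at hys
      exact not_inversionSet_subset_mul_simple hj hys

end CoxeterSystem

theorem theorem1p7 {B W : Type*} [Finite B] [Group W] {M : CoxeterMatrix B}
    (cs : CoxeterSystem M W) (m : ℕ) :
    cs.IsGated (cs.shiPartition m) ∧
    cs.gates (cs.shiPartition m) = cs.lowElements m ∧
    cs.tight (cs.lowElements m) = cs.joinIrreducibles (cs.lowElements m) :=
  ⟨CoxeterSystem.isGated_shiPartition m, CoxeterSystem.gates_shiPartition m,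
    CoxeterSystem.tight_lowElements m⟩
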